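/- Let $\Xi^{(0)}$ be a stationary renewal process on $\mathbb{R}$ of unit intensity (i.e. a simple, locally finite stationary point process of intensity $1$ whose gaps, under its Palm distribution, are i.i.d.), and assume that the inter-renewal law has finite variance. Given $\Xi^{(t)}$, each of its points moves halfway towards its left or its right neighbour, chosen with probability $1/2$ each, independently of the other points and of the past; points that arrive at the same location are merged into one point; and space is then multiplied by $3/4$. This defines $\Xi^{(t+1)}$. For a point $z$ of $\Xi^{(t)}$ let $G^{(t)}_z$ be the number of points of $\Xi^{(0)}$ that have been merged into $z$ by time $t$. Write configurations as sequences $\Xi=(\Xi_i)_{i\in\mathbb{Z}}$ with $\cdots<\Xi_{-1}<0\le\Xi_0<\Xi_1<\cdots$, and give $\mathbb{R}^{\mathbb{Z}}$ the product topology. Let $\Theta$ denote passage to the Palm version (the process seen from a typical point, so that $(\Theta\Xi)_0=0$), and let $(\Theta\Xi^{(t)},G^{(t)})$ be the pair formed by the Palm version of $\Xi^{(t)}$ and the cluster size of its point at the origin, that is, $$\mathbb{P}\big((\Theta\Xi^{(t)},(3/4)^tG^{(t)})\in A\big)=\mathbb{E}\,\#\{z\in\Xi^{(t)}\cap[0,1):(\Xi^{(t)}-z,(3/4)^tG^{(t)}_z)\in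 A\},$$ which is a probability distribution for every $t$. Then there are a simple, locally finite stationary point process $\Xi^{(\infty)}$ of unit intensity and a probability distribution on $\mathbb{R}^{\mathbb{Z}}\times\mathbb{R}$, that of a pair $(\Theta\Xi^{(\infty)},G^{(\infty)})$ whose first component is the Palm version of $\Xi^{(\infty)}$, neither depending on the choice of $\Xi^{(0)}$, such that $\Xi^{(\infty)}$ is the limit of $\Xi^{(t)}$ in the sense of finite-dimensional distributions of $(\Xi^{(t)}_i)_{i\in\mathbb{Z}}$; $G^{(\infty)}$ is, in law, the limit of $(3/4)^tG^{(t)}$ in $L^p$ for all $2\le p<\infty$ (the variables $(3/4)^tG^{(t)}$, each with its own law, can be realized on one probability space so that they converge in $L^p$, for all such $p$, to a variable with the law of $G^{(\infty)}$); and, as $t\to\infty$, the pair converges jointly in distribution: $$\left(\Theta\Xi^{(t)},\left(\tfrac34\right)^tG^{(t)}\right)\Rightarrow\left(\Theta\Xi^{(\infty)},G^{(\infty)}\right).$$ -/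

import Mathlib

open MeasureTheory ProbabilityTheory Filter Topology Set
open scoped ENNReal

namespace Clustering

noncomputable section

/-- The right neighbour of the location `x` in the point configuration `S`. -/
def nextPt (S : Set ℝ) (x : ℝ) : ℝ := sInf (S ∩ Ioi x)

/-- The left neighbour of the location `x` in the point configuration `S`. -/
def prevPt (S : Set ℝ) (x : ℝ) : ℝ := sSup (S ∩ Iio x)

/-- The increasing enumeration `⋯ < S₋₁ < 0 ≤ S₀ < S₁ < ⋯` of a configuration that is locally
finite and unbounded in both directions. If `0 ∈ S`, then `S₀ = 0`. -/
def enum (S : Set ℝ) : ℤ → ℝ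
  | Int.ofNat n => (nextPt S)^[n] (sInf (S ∩ Ici 0))
  | Int.negSucc n => (prevPt S)^[n + 1] (sInf (S ∩ Ici 0))

/-- The configuration `S` seen from the location `z`. -/
def seenFrom (S : Set ℝ) (z : ℝ) : ℤ → ℝ := enum ((fun y => y - z) '' S)

/-- The gap sequence of an enumerated configuration. -/
def gaps (x : ℤ → ℝ) (i : ℤ) : ℝ := x (i + 1) - x i

/-! ### The dynamics

A state is a sequence `y : ℤ → ℝ`, where `y i` is the current location of the original point with
label `i`; labels with the same location form one merged point. -/

/-- The label whose coin moves the merged point that contains the label `i`: the smallest label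
in that merged point. -/
def leader (y : ℤ → ℝ) (i : ℤ) : ℤ := sInf {j | y j = y i}

/-- One step: every (merged) point moves halfway towards its right neighbour (coin `true`) or its
left neighbour (coin `false`), and then space is multiplied by `3 / 4`. -/
def step (c : ℤ → Bool) (y : ℤ → ℝ) (i : ℤ) : ℝ :=
  3 / 4 * ((y i + if c (leader y i) = true then nextPt (range y) (y i)
    else prevPt (range y) (y i)) / 2)

/-- Location at time `t` of every original point, from the initial locations `x` and the coins. -/
def location (x : ℤ → ℝ) (c : ℕ → ℤ → Bool) : ℕ → ℤ → ℝ
  | 0 => x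
  | t + 1 => step (c t) (location x c t)

/-- The point configuration at time `t`. -/
def config (x : ℤ → ℝ) (c : ℕ → ℤ → Bool) (t : ℕ) : Set ℝ := range (location x c t)

/-- Number of original points that have merged, by time `t`, into the point located at `z`. -/
def clusterSize (x : ℤ → ℝ) (c : ℕ → ℤ → Bool) (t : ℕ) (z : ℝ) : ℕ :=
  {i | location x c t i = z}.ncard

/-! ### Stationary point processes and Palm distributions -/

/-- Palm distribution, for a random configuration `S` of unit intensity, of an observable `F ω z`
attached to its points `z`: it gives a set `A` the mass
`𝔼 #{z ∈ S ∩ [0, 1) : F (ω, z) ∈ A}`. -/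
def palm {Ω β : Type*} [MeasurableSpace Ω] [MeasurableSpace β] (μ : Measure Ω)
    (S : Ω → Set ℝ) (F : Ω → ℝ → β) : Measure β :=
  Measure.sum fun i : ℤ =>
    (μ.restrict {ω | enum (S ω) i ∈ Ico (0 : ℝ) 1}).map fun ω => F ω (enum (S ω) i)

/-- The points `X i`, `i ∈ ℤ`, listed increasingly, form a simple, locally finite stationary point
process on `ℝ` of intensity one. -/
structure IsUnitStationary {Ω : Type*} [MeasurableSpace Ω] (μ : Measure Ω)
    (X : Ω → ℤ → ℝ) : Prop where
  measurable : Measurable X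
  strictMono : ∀ᵐ ω ∂μ, StrictMono (X ω)
  tendsto_atTop : ∀ᵐ ω ∂μ, Tendsto (X ω) atTop atTop
  tendsto_atBot : ∀ᵐ ω ∂μ, Tendsto (X ω) atBot atBot
  stationary : ∀ s : ℝ,
    μ.map (fun ω => seenFrom (range (X ω)) s) = μ.map (fun ω => enum (range (X ω)))
  intensity : ∫⁻ ω, ((range (X ω) ∩ Ico (0 : ℝ) 1).encard : ℝ≥0∞) ∂μ = 1

/-- A stationary renewal process of unit intensity whose inter-renewal law has finite variance:
seen from a typical point, the gaps are independent with a common square-integrable law. -/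
structure IsUnitRenewal {Ω : Type*} [MeasurableSpace Ω] (μ : Measure Ω)
    (X : Ω → ℤ → ℝ) : Prop extends IsUnitStationary μ X where
  renewal : ∃ (ν : Measure ℝ) (_ : IsProbabilityMeasure ν), MemLp id 2 ν ∧
    palm μ (fun ω => range (X ω)) (fun ω z => gaps (seenFrom (range (X ω)) z)) =
      Measure.infinitePi fun _ : ℤ => ν

/-- Independent fair coins `c t i`. -/
structure IsFairCoins {Ω : Type*} [MeasurableSpace Ω] (μ : Measure Ω)
    (c : Ω → ℕ → ℤ → Bool) : Prop where
  measurable : Measurable c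
  indep : iIndepFun (fun (k : ℕ × ℤ) ω => c ω k.1 k.2) μ
  fair : ∀ t i, μ {ω | c ω t i = true} = 1 / 2

/-- The joint law of the Palm version of the configuration at time `t` and of `(3 / 4) ^ t` times
the number of original points merged into its point at the origin. -/
def palmPair {Ω : Type*} [MeasurableSpace Ω] (μ : Measure Ω) (X : Ω → ℤ → ℝ)
    (c : Ω → ℕ → ℤ → Bool) (t : ℕ) : Measure ((ℤ → ℝ) × ℝ) :=
  palm μ (fun ω => config (X ω) (c ω) t) fun ω z =>
    (seenFrom (config (X ω) (c ω) t) z, (3 / 4 : ℝ) ^ t * clusterSize (X ω) (c ω) t z)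

/-- `L` is the law of a limit in `Lᵖ`, for all `2 ≤ p < ∞` at once, of random variables with the
laws `l t`, realized on one probability space. -/
def IsLpLimitLaw (l : ℕ → Measure ℝ) (L : Measure ℝ) : Prop :=
  ∃ (Ω : Type) (_ : MeasurableSpace Ω) (P : Measure Ω) (_ : IsProbabilityMeasure P)
    (W : ℕ → Ω → ℝ) (V : Ω → ℝ),
    (∀ t, Measurable (W t) ∧ P.map (W t) = l t) ∧ (Measurable V ∧ P.map V = L) ∧
    ∀ p : ℝ≥0∞, 2 ≤ p → p < ∞ →
      MemLp V p P ∧ Tendsto (fun t => eLpNorm (W t - V) p P) atTop (𝓝 0)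

end

end Clustering

namespace Clustering

noncomputable section

/-! ### Occupied gaps

The gap `k` lies between the points `k` and `k + 1`; its midpoint becomes a point when the point
`k` moves to the right or the point `k + 1` moves to the left. -/

/-! Number the points at some time by the integers. One step replaces them by the midpoints of the
occupied gaps. A gap is occupied with probability 3/4, and the rescaling by 3/4 restores unit
intensity. Every merged point consists of consecutive original points, so the clusters can be
recorded by their first labels. Seen from a typical point, the positions evolve by `thin` and the
first labels by `merge`. Both use the same row of coins, with law `palmRow`: fair coins conditioned
on gap 0 being occupied. `campbell` shows by induction on time that the Palm version at time t is
obtained by t independent such steps from the initial Palm version, which is a random walk with the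
renewal gaps.

Only the law at each time matters, so the rows may be applied from the outside inwards (`iter`): row
0 is the latest step, and passing to time t + 1 inserts a new row innermost. In this coupling the
states converge almost surely. Indeed both operators are linear, and if increments over n indices
have second moment at most C n, then after one step the bound is (3/4)² C times the mean number 4n/3
of old indices, that is (3/4) C n (`Contracting`). One step from the integer lattice differs from
the lattice by such a diffusive sequence; this rests on the variance estimate `cwalk_moments`. Hence
successive iterates from the lattice differ in mean square by a multiple of (3/4)^t, and they
converge (`exists_limit`).

A random walk with mean step one and finite variance also differs from the lattice by a diffusive
sequence, and this difference is forgotten at the same rate (`ae_tendsto_iter_of_diffusive`). So the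
limit is a function of the coins alone and does not depend on the initial process. Positions and
masses are driven by the same rows, so they converge jointly.

The limit is the Palm version of a point process: invariance under recentring passes to the limit; a
fixed-point equation and the linear variance bound exclude coinciding points
(`measure_limit_eq_zero`); and the same bound gives mean gap one and unboundedness on both sides.
`stationaryLaw` inverts the Palm distribution by integrating over all translates. Fatou's lemma
makes it lower semicontinuous on open sets, so convergence of Palm versions implies that of the
stationary processes. Finally, Lyapunov functions (`exists_lyapunov`) bound every moment of the
rescaled cluster sizes uniformly in time, which turns almost sure convergence into convergence in
every Lᵖ. -/

/-- The midpoint of the gap `k` is occupied after the step with coins `b`. -/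
def Occ (b : ℤ → Bool) (k : ℤ) : Prop := b k = true ∨ b (k + 1) = false

instance (b : ℤ → Bool) (k : ℤ) : Decidable (Occ b k) := by unfold Occ; infer_instance

/-- The occupied gap following an occupied gap. -/
def nextOcc (b : ℤ → Bool) (k : ℤ) : ℤ := if Occ b (k + 1) then k + 1 else k + 2

/-- The occupied gap preceding an occupied gap. -/
def prevOcc (b : ℤ → Bool) (k : ℤ) : ℤ := if Occ b (k - 1) then k - 1 else k - 2

/-- The first occupied gap with nonnegative index. -/
def firstOcc (b : ℤ → Bool) : ℤ := if Occ b 0 then 0 else 1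

/-- The increasing enumeration of the occupied gaps. -/
def occIdx (b : ℤ → Bool) : ℤ → ℤ
  | Int.ofNat n => (nextOcc b)^[n] (firstOcc b)
  | Int.negSucc n => (prevOcc b)^[n + 1] (firstOcc b)

/-- The index of the first point that moves to the midpoint of an occupied gap. -/
def firstPt (b : ℤ → Bool) (k : ℤ) : ℤ := if b k = true then k else k + 1

/-- A sequence seen from the index `k`. -/
def shift {α : Type*} (k : ℤ) (b : ℤ → α) : ℤ → α := fun i => b (k + i)

/-- A sequence seen from its `k`-th value. -/
def recenter {α : Type*} [Sub α] (k : ℤ) (y : ℤ → α) : ℤ → α := fun i => y (k + i) - y k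

variable {b : ℤ → Bool}

/-- The right end of an empty gap moves right, into the next gap. So two adjacent gaps are never
both empty, and `nextOcc` has only two candidates. -/
lemma occ_succ_of_not_occ {k : ℤ} (h : ¬ Occ b k) : Occ b (k + 1) := by
  simp only [Occ, not_or, Bool.not_eq_false, Bool.not_eq_true] at *
  exact Or.inl h.2

lemma occ_pred_of_not_occ {k : ℤ} (h : ¬ Occ b k) : Occ b (k - 1) := by
  simp only [Occ, not_or, Bool.not_eq_false, Bool.not_eq_true] at *
  exact Or.inr (by simpa using h.1)

lemma occ_nextOcc (k : ℤ) : Occ b (nextOcc b k) := by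
  unfold nextOcc
  split_ifs with h
  · exact h
  · convert occ_succ_of_not_occ h using 1; ring

lemma occ_prevOcc (k : ℤ) : Occ b (prevOcc b k) := by
  unfold prevOcc
  split_ifs with h
  · exact h
  · convert occ_pred_of_not_occ h using 1; ring

lemma nextOcc_prevOcc {k : ℤ} (hk : Occ b k) : nextOcc b (prevOcc b k) = k := by
  unfold prevOcc
  split_ifs with h
  · simp [nextOcc, hk]
  · have : ¬ Occ b (k - 2 + 1) := by convert h using 2; ring
    simp [nextOcc, this]

lemma prevOcc_nextOcc {k : ℤ} (hk : Occ b k) : prevOcc b (nextOcc b k) = k := by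
  unfold nextOcc
  split_ifs with h
  · simp [prevOcc, hk]
  · have : ¬ Occ b (k + 2 - 1) := by convert h using 2; ring
    simp [prevOcc, this]

lemma occ_firstOcc : Occ b (firstOcc b) := by
  unfold firstOcc
  split_ifs with h
  · exact h
  · simpa using occ_succ_of_not_occ h

lemma occ_occIdx (j : ℤ) : Occ b (occIdx b j) := by
  rcases j with n | n
  · cases n with
    | zero => exact occ_firstOcc
    | succ n => simp only [occIdx, Function.iterate_succ_apply']; exact occ_nextOcc _
  · simp only [occIdx, Function.iterate_succ_apply']; exact occ_prevOcc _

lemma occIdx_succ (j : ℤ) : occIdx b (j + 1) = nextOcc b (occIdx b j) := by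
  rcases j with n | n
  · change (nextOcc b)^[n + 1] _ = _
    rw [Function.iterate_succ_apply']; rfl
  · cases n with
    | zero =>
      change firstOcc b = nextOcc b (prevOcc b (firstOcc b))
      rw [nextOcc_prevOcc occ_firstOcc]
    | succ n =>
      have h : Int.negSucc (n + 1) + 1 = Int.negSucc n := by omega
      rw [h]
      change (prevOcc b)^[n + 1] _ = nextOcc b ((prevOcc b)^[n + 1 + 1] _)
      rw [Function.iterate_succ_apply' _ (n + 1)]
      exact (nextOcc_prevOcc (occ_occIdx (b := b) (Int.negSucc n))).symm

lemma occIdx_zero (h : Occ b 0) : occIdx b 0 = 0 := by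
  change firstOcc b = 0
  simp [firstOcc, h]

lemma lt_nextOcc (k : ℤ) : k < nextOcc b k := by
  unfold nextOcc; split_ifs <;> omega

lemma occIdx_strictMono (b : ℤ → Bool) : StrictMono (occIdx b) :=
  strictMono_int_of_lt_succ fun j => by rw [occIdx_succ]; exact lt_nextOcc _

/-- A strictly increasing integer sequence brackets every integer. -/
lemma exists_bracket {f : ℤ → ℤ} (hf : StrictMono f) (k : ℤ) : ∃ j, f j ≤ k ∧ k < f (j + 1) := by
  have hup : ∀ n : ℕ, f 0 + n ≤ f n := fun n => by
    induction n with
    | zero => simp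
    | succ n ih => have := hf (show (n : ℤ) < (n + 1 : ℕ) by simp); push_cast at *; omega
  have hdn : ∀ n : ℕ, f (-n) ≤ f 0 - n := fun n => by
    induction n with
    | zero => simp
    | succ n ih => have := hf (show (-(n + 1 : ℕ) : ℤ) < -n by simp); push_cast at *; omega
  obtain ⟨j, hj, hmax⟩ := Int.exists_greatest_of_bdd (P := fun j => f j ≤ k)
    ⟨(k - f 0).natAbs + 1, fun z hz => by
      by_contra! h
      have h1 := hup ((k - f 0).natAbs + 1)
      have h2 := hf h
      have h3 := le_abs_self (k - f 0)
      push_cast at *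
      omega⟩
    ⟨-((f 0 - k).natAbs : ℤ), by have := hdn (f 0 - k).natAbs; omega⟩
  refine ⟨j, hj, ?_⟩
  by_contra! h
  have := hmax _ h
  omega

lemma exists_occIdx_eq {k : ℤ} (hk : Occ b k) : ∃ j, occIdx b j = k := by
  obtain ⟨j, h1, h2⟩ := exists_bracket (occIdx_strictMono b) k
  refine ⟨j, ?_⟩
  rw [occIdx_succ] at h2
  unfold nextOcc at h2
  split_ifs at h2 with h
  · omega
  · by_contra hne
    have : k = occIdx b j + 1 := by omega
    exact h (this ▸ hk)

lemma range_occIdx (b : ℤ → Bool) : range (occIdx b) = {k | Occ b k} := by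
  ext k
  constructor
  · rintro ⟨j, rfl⟩; exact occ_occIdx j
  · exact exists_occIdx_eq

lemma occ_shift {k i : ℤ} : Occ (shift k b) i ↔ Occ b (k + i) := by
  simp [Occ, shift, add_assoc]

lemma nextOcc_shift (k i : ℤ) : nextOcc (shift k b) i = nextOcc b (k + i) - k := by
  simp only [nextOcc, occ_shift, ← add_assoc]
  split_ifs <;> ring

/-- Cocycle identity: the enumeration can be restarted at any occupied gap. All recentring below
rests on it. -/
lemma occIdx_add (j i : ℤ) :
    occIdx b (j + i) = occIdx b j + occIdx (shift (occIdx b j) b) i := by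
  have h0 : Occ (shift (occIdx b j) b) 0 := by rw [occ_shift, add_zero]; exact occ_occIdx j
  induction i using Int.induction_on with
  | zero => rw [occIdx_zero h0]; simp
  | succ i ih =>
    rw [← add_assoc, occIdx_succ, occIdx_succ, nextOcc_shift, ih]; ring
  | pred i ih =>
    have h1 := occIdx_succ (b := b) (j + (-i - 1))
    have h2 := occIdx_succ (b := shift (occIdx b j) b) (-i - 1)
    rw [sub_add_cancel] at h2
    rw [show j + (-(i : ℤ) - 1) + 1 = j + -i by ring, ih, h2, nextOcc_shift, add_sub_cancel] at h1
    -- On occupied gaps `nextOcc` is invertible, which carries the identity backwards.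
    have h3 := congrArg (prevOcc b) h1
    rw [prevOcc_nextOcc (occ_occIdx _), prevOcc_nextOcc] at h3
    · exact h3.symm
    · rw [← occ_shift]; exact occ_occIdx _

lemma occIdx_shift (j i : ℤ) :
    occIdx (shift (occIdx b j) b) i = occIdx b (j + i) - occIdx b j := by
  rw [occIdx_add]; ring

lemma shift_shift {α : Type*} (j k : ℤ) (f : ℤ → α) : shift j (shift k f) = shift (k + j) f := by
  ext i; simp [shift, add_assoc]

@[simp] lemma shift_zero {α : Type*} (f : ℤ → α) : shift 0 f = f := by
  ext i; simp [shift]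

/-- Reversibility of the passage to the `n`-th occupied gap. -/
lemma occIdx_eq_iff_shift {n k : ℤ} :
    (Occ b 0 ∧ occIdx b n = k) ↔ (Occ (shift k b) 0 ∧ Occ b 0 ∧ occIdx (shift k b) (-n) = -k) := by
  constructor
  · rintro ⟨h0, rfl⟩
    refine ⟨by rw [occ_shift, add_zero]; exact occ_occIdx n, h0, ?_⟩
    rw [occIdx_shift, add_neg_cancel, occIdx_zero h0]; ring
  · rintro ⟨h0, h1, h2⟩
    refine ⟨h1, ?_⟩
    have := occIdx_add (b := shift k b) (-n) n
    rw [h2, shift_shift, add_neg_cancel, shift_zero, neg_add_cancel, occIdx_zero h0] at this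
    omega

lemma firstPt_shift (k i : ℤ) : firstPt (shift k b) i = firstPt b (k + i) - k := by
  by_cases h : b (k + i) = true
  · simp [firstPt, shift, h]
  · simp [firstPt, shift, h]; ring

lemma le_firstPt (k : ℤ) : k ≤ firstPt b k := by unfold firstPt; split_ifs <;> omega

lemma firstPt_le (k : ℤ) : firstPt b k ≤ k + 1 := by unfold firstPt; split_ifs <;> omega

/-- The point `k + 1` either moves right and opens the next cluster, or moves left into gap `k`;
then the next cluster opens at `k + 2`. -/
lemma firstPt_nextOcc (k : ℤ) :
    firstPt b (nextOcc b k) = if b (k + 1) = true then k + 1 else k + 2 := by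
  unfold nextOcc
  by_cases h : Occ b (k + 1)
  · simp only [h, if_true, firstPt, add_assoc]; norm_num
  · simp only [h, if_false]
    simp only [Occ, not_or, Bool.not_eq_false, Bool.not_eq_true, add_assoc] at h
    norm_num at h
    simp [firstPt, h.1, h.2]

/-- The points `i` with `firstPt b (occIdx b j) ≤ i < firstPt b (occIdx b (j + 1))` are those
that move to the midpoint of the gap `occIdx b j`. -/
lemma mem_cluster_iff {i j : ℤ} :
    (firstPt b (occIdx b j) ≤ i ∧ i < firstPt b (occIdx b (j + 1))) ↔
      (if b i = true then i else i - 1) = occIdx b j := by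
  rw [occIdx_succ, firstPt_nextOcc]
  have hocc := occ_occIdx (b := b) j
  set k := occIdx b j
  constructor
  · rintro ⟨h1, h2⟩
    have h3 := le_firstPt (b := b) k
    have h4 : i < k + 2 := by split_ifs at h2 <;> omega
    obtain rfl | rfl : i = k ∨ i = k + 1 := by omega
    · by_cases hb : b k = true
      · simp [hb]
      · simp [firstPt, hb] at h1
    · by_cases hb : b (k + 1) = true
      · simp [hb] at h2
      · simp [hb]
  · intro h
    split_ifs at h with hb
    · subst h
      simp only [firstPt, hb, if_true, le_refl, true_and]
      split_ifs <;> omega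
    · have : i = k + 1 := by omega
      subst this
      refine ⟨firstPt_le k, ?_⟩
      simp [hb]

lemma firstPt_occIdx_lt (j : ℤ) : firstPt b (occIdx b j) < firstPt b (occIdx b (j + 1)) := by
  rw [occIdx_succ, firstPt_nextOcc]
  have hocc := occ_occIdx (b := b) j
  simp only [Occ] at hocc
  unfold firstPt
  split_ifs with h1 h2 h2 <;> simp_all

lemma firstPt_occIdx_strictMono (b : ℤ → Bool) : StrictMono fun j => firstPt b (occIdx b j) :=
  strictMono_int_of_lt_succ firstPt_occIdx_lt

lemma sub_le_occIdx_sub {i j : ℤ} (h : i ≤ j) : j - i ≤ occIdx b j - occIdx b i := by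
  obtain ⟨n, rfl⟩ := Int.le.dest h
  induction n with
  | zero => simp
  | succ n ih =>
    have := ih (by omega)
    have := occIdx_strictMono b (show i + n < i + (n + 1 : ℕ) by simp)
    push_cast at *
    omega

/-- Going over to the occupied midpoints, seen from the gap at the origin; space is multiplied by
`3 / 4`. -/
def thin (b : ℤ → Bool) (y : ℤ → ℝ) (j : ℤ) : ℝ :=
  3 / 4 * ((y (occIdx b j) + y (occIdx b j + 1)) / 2 - (y (occIdx b 0) + y (occIdx b 0 + 1)) / 2)

/-- Merging of clusters: a cluster is coded by the index of its first member. -/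
def merge {α : Type*} [Sub α] (b : ℤ → Bool) (l : ℤ → α) (j : ℤ) : α :=
  l (firstPt b (occIdx b j)) - l (firstPt b (occIdx b 0))

@[simp] lemma thin_zero (y : ℤ → ℝ) : thin b y 0 = 0 := by simp [thin]

/-- Changing the viewpoint after a step amounts to changing that of the coins and of the old
sequence before it. With `lintegral_palmRow_shift` this gives stationarity under recentring. -/
lemma recenter_thin (n : ℤ) (y : ℤ → ℝ) :
    recenter n (thin b y) = thin (shift (occIdx b n) b) (recenter (occIdx b n) y) := by
  ext j
  have h0 : Occ (shift (occIdx b n) b) 0 := by rw [occ_shift, add_zero]; exact occ_occIdx n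
  simp only [recenter, thin, occIdx_zero h0, occIdx_add n j]
  ring_nf

lemma recenter_merge {α : Type*} [AddCommGroup α] (n : ℤ) (l : ℤ → α) :
    recenter n (merge b l) = merge (shift (occIdx b n) b) (recenter (occIdx b n) l) := by
  ext j
  have h0 : Occ (shift (occIdx b n) b) 0 := by rw [occ_shift, add_zero]; exact occ_occIdx n
  simp only [recenter, merge, occIdx_zero h0, occIdx_add n j, firstPt_shift, add_sub_cancel,
    add_zero]
  abel

lemma thin_strictMono {y : ℤ → ℝ} (hy : StrictMono y) : StrictMono (thin b y) := fun i j h => by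
  have h1 := hy (occIdx_strictMono b h)
  have h2 := hy (add_lt_add_left (occIdx_strictMono b h) 1)
  simp only [thin]
  linarith

lemma merge_strictMono {l : ℤ → ℤ} (hl : StrictMono l) : StrictMono (merge b l) := fun i j h => by
  have h1 := hl (firstPt_occIdx_strictMono b h)
  simp only [merge]
  linarith

/-! ### Measurability -/

section Measurability

variable {α β : Type*} [MeasurableSpace α] [MeasurableSpace β]

/-- Evaluation at a random index is measurable because there are countably many indices. -/
lemma measurable_apply_int {y : α → ℤ → β} {k : α → ℤ} (hy : Measurable y) (hk : Measurable k) :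
    Measurable fun a => y a (k a) := by
  have h : Measurable fun p : (ℤ → β) × ℤ => p.1 p.2 :=
    measurable_from_prod_countable_left fun k => measurable_pi_apply k
  exact h.comp (hy.prodMk hk)

lemma measurable_shift {y : α → ℤ → β} {k : α → ℤ} (hy : Measurable y) (hk : Measurable k) :
    Measurable fun a => shift (k a) (y a) :=
  measurable_pi_lambda _ fun i => measurable_apply_int (k := fun a => k a + i) hy (hk.add_const i)

lemma measurable_recenter [Sub β] [MeasurableSub₂ β] {y : α → ℤ → β} {k : α → ℤ}
    (hy : Measurable y) (hk : Measurable k) : Measurable fun a => recenter (k a) (y a) :=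
  measurable_pi_lambda _ fun i =>
    (measurable_apply_int hy (hk.add_const i)).sub (measurable_apply_int hy hk)

lemma measurableSet_occ {b : α → ℤ → Bool} {k : α → ℤ} (hb : Measurable b) (hk : Measurable k) :
    MeasurableSet {a | Occ (b a) (k a)} := by
  have h1 : MeasurableSet {a | b a (k a) = true} :=
    measurable_apply_int hb hk (measurableSet_singleton true)
  have h2 : MeasurableSet {a | b a (k a + 1) = false} :=
    measurable_apply_int hb (hk.add_const 1) (measurableSet_singleton false)
  exact h1.union h2

lemma measurable_nextOcc {b : α → ℤ → Bool} {k : α → ℤ} (hb : Measurable b) (hk : Measurable k) :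
    Measurable fun a => nextOcc (b a) (k a) :=
  Measurable.ite (measurableSet_occ hb (hk.add_const 1)) (hk.add_const 1) (hk.add_const 2)

lemma measurable_prevOcc {b : α → ℤ → Bool} {k : α → ℤ} (hb : Measurable b) (hk : Measurable k) :
    Measurable fun a => prevOcc (b a) (k a) :=
  Measurable.ite (measurableSet_occ hb (hk.sub_const 1)) (hk.sub_const 1) (hk.sub_const 2)

lemma measurable_firstPt {b : α → ℤ → Bool} {k : α → ℤ} (hb : Measurable b) (hk : Measurable k) :
    Measurable fun a => firstPt (b a) (k a) :=
  Measurable.ite (measurable_apply_int hb hk (measurableSet_singleton true)) hk (hk.add_const 1)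

lemma measurable_occIdx {b : α → ℤ → Bool} (hb : Measurable b) (j : ℤ) :
    Measurable fun a => occIdx (b a) j := by
  have h0 : Measurable fun a => firstOcc (b a) :=
    Measurable.ite (measurableSet_occ hb measurable_const) measurable_const measurable_const
  have h1 : ∀ n : ℕ, Measurable fun a => (nextOcc (b a))^[n] (firstOcc (b a)) := fun n => by
    induction n with
    | zero => exact h0
    | succ n ih => simp only [Function.iterate_succ_apply']; exact measurable_nextOcc hb ih
  have h2 : ∀ n : ℕ, Measurable fun a => (prevOcc (b a))^[n] (firstOcc (b a)) := fun n => by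
    induction n with
    | zero => exact h0
    | succ n ih => simp only [Function.iterate_succ_apply']; exact measurable_prevOcc hb ih
  rcases j with n | n
  · exact h1 n
  · exact h2 (n + 1)

lemma measurable_thin {b : α → ℤ → Bool} {y : α → ℤ → ℝ} (hb : Measurable b) (hy : Measurable y) :
    Measurable fun a => thin (b a) (y a) := by
  refine measurable_pi_lambda _ fun j => ?_
  have h : ∀ j, Measurable fun a => y a (occIdx (b a) j) :=
    fun j => measurable_apply_int hy (measurable_occIdx hb j)
  have h' : ∀ j, Measurable fun a => y a (occIdx (b a) j + 1) :=
    fun j => measurable_apply_int hy ((measurable_occIdx hb j).add_const 1)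
  exact ((((h j).add (h' j)).div_const 2).sub (((h 0).add (h' 0)).div_const 2)).const_mul _

lemma measurable_merge [Sub β] [MeasurableSub₂ β] {b : α → ℤ → Bool} {l : α → ℤ → β}
    (hb : Measurable b) (hl : Measurable l) : Measurable fun a => merge (b a) (l a) := by
  have h : ∀ j, Measurable fun a => l a (firstPt (b a) (occIdx (b a) j)) :=
    fun j => measurable_apply_int hl (measurable_firstPt hb (measurable_occIdx hb j))
  exact measurable_pi_lambda _ fun j => (h j).sub (h 0)

end Measurability

/-! ### Independent sequences -/

section Cons

variable {E : Type*} [MeasurableSpace E]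

/-- Prepending a first term to a sequence. -/
def cons (x : E) (s : ℕ → E) : ℕ → E
  | 0 => x
  | n + 1 => s n

/-- Removing the first term of a sequence. -/
def tail (s : ℕ → E) : ℕ → E := fun n => s (n + 1)

omit [MeasurableSpace E] in
@[simp] lemma cons_zero (x : E) (s : ℕ → E) : cons x s 0 = x := rfl
omit [MeasurableSpace E] in
@[simp] lemma cons_succ (x : E) (s : ℕ → E) (n : ℕ) : cons x s (n + 1) = s n := rfl
omit [MeasurableSpace E] in
@[simp] lemma tail_cons (x : E) (s : ℕ → E) : tail (cons x s) = s := rfl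

lemma measurable_tail : Measurable (tail : (ℕ → E) → ℕ → E) :=
  measurable_pi_lambda _ fun n => measurable_pi_apply (n + 1)

lemma measurable_cons : Measurable fun p : E × (ℕ → E) => cons p.1 p.2 := by
  refine measurable_pi_lambda _ fun n => ?_
  cases n with
  | zero => exact measurable_fst
  | succ n => exact (measurable_pi_apply n).comp measurable_snd

/-- Checked on finite cylinders: the constraint at index 0 is separated from those at successors. -/
lemma map_cons_prod_infinitePi (ρ : Measure E) [IsProbabilityMeasure ρ] :
    (ρ.prod (Measure.infinitePi fun _ : ℕ => ρ)).map (fun p => cons p.1 p.2) =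
      Measure.infinitePi fun _ : ℕ => ρ := by
  refine Measure.eq_infinitePi _ fun s t ht => ?_
  classical
  rw [Measure.map_apply measurable_cons (.pi s.countable_toSet fun i _ => ht i)]
  let s' : Finset ℕ := s.preimage Nat.succ Nat.succ_injective.injOn
  have hpre : (fun p : E × (ℕ → E) => cons p.1 p.2) ⁻¹' (s : Set ℕ).pi t =
      (if 0 ∈ s then t 0 else univ) ×ˢ (s' : Set ℕ).pi fun n => t (n + 1) := by
    ext ⟨x, f⟩
    simp only [mem_preimage, Set.mem_pi, Finset.mem_coe, mem_prod, s', Finset.mem_preimage]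
    constructor
    · intro h
      refine ⟨?_, fun i hi => h (i + 1) hi⟩
      split_ifs with h0
      · exact h 0 h0
      · trivial
    · rintro ⟨h0, h1⟩ i hi
      cases i with
      | zero => rw [if_pos hi] at h0; exact h0
      | succ i => exact h1 i hi
  rw [hpre, Measure.prod_prod, Measure.infinitePi_pi _ fun i _ => ht (i + 1)]
  have hs : ∏ i ∈ s.filter (· ∈ range Nat.succ), ρ (t i) = ∏ i ∈ s', ρ (t (i + 1)) :=
    (Finset.prod_preimage' Nat.succ s Nat.succ_injective.injOn (fun i => ρ (t i))).symm
  have h0 : ρ (if 0 ∈ s then t 0 else univ) =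
      ∏ i ∈ s.filter (¬ · ∈ range Nat.succ), ρ (t i) := by
    have hf : s.filter (¬ · ∈ range Nat.succ) = if 0 ∈ s then {0} else ∅ := by
      ext i
      cases i with
      | zero => split_ifs with h <;> simp [h]
      | succ i => split_ifs with h <;> simp
    rw [hf]
    split_ifs <;> simp
  rw [h0, ← hs, mul_comm, Finset.prod_filter_mul_prod_filter_not]

lemma measurePreserving_head_tail (ρ : Measure E) [IsProbabilityMeasure ρ] :
    MeasurePreserving (fun s : ℕ → E => (s 0, tail s)) (Measure.infinitePi fun _ : ℕ => ρ)
      (ρ.prod (Measure.infinitePi fun _ : ℕ => ρ)) := by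
  have hm : Measurable fun s : ℕ → E => (s 0, tail s) :=
    (measurable_pi_apply 0).prodMk measurable_tail
  refine ⟨hm, ?_⟩
  conv_lhs => rw [← map_cons_prod_infinitePi ρ]
  rw [Measure.map_map hm measurable_cons]
  exact Measure.map_id

lemma lintegral_infinitePi_cons (ρ : Measure E) [IsProbabilityMeasure ρ] {f : (ℕ → E) → ℝ≥0∞}
    (hf : Measurable f) :
    ∫⁻ s, f s ∂(Measure.infinitePi fun _ : ℕ => ρ) =
      ∫⁻ x, ∫⁻ s, f (cons x s) ∂(Measure.infinitePi fun _ : ℕ => ρ) ∂ρ := by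
  conv_lhs => rw [← map_cons_prod_infinitePi ρ]
  have hm : Measurable fun p : E × (ℕ → E) => f (cons p.1 p.2) := hf.comp measurable_cons
  rw [lintegral_map hf measurable_cons, lintegral_prod _ hm.aemeasurable]

end Cons

/-! ### Fair coins -/

/-- The law of a fair coin. -/
def fairCoin : Measure Bool := (2 : ℝ≥0∞)⁻¹ • Measure.dirac true + (2 : ℝ≥0∞)⁻¹ • Measure.dirac false

instance : IsProbabilityMeasure fairCoin :=
  ⟨by simp [fairCoin, ENNReal.inv_two_add_inv_two]⟩

/-- The law of a two-sided sequence of fair coins. -/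
def fairRow : Measure (ℤ → Bool) := Measure.infinitePi fun _ => fairCoin

/-- The law of a one-sided sequence of fair coins. -/
def fairSeq : Measure (ℕ → Bool) := Measure.infinitePi fun _ => fairCoin

instance : IsProbabilityMeasure fairRow := by unfold fairRow; infer_instance

instance : IsProbabilityMeasure fairSeq := by unfold fairSeq; infer_instance

lemma lintegral_fairCoin (f : Bool → ℝ≥0∞) :
    ∫⁻ x, f x ∂fairCoin = 2⁻¹ * f true + 2⁻¹ * f false := by
  simp [fairCoin, lintegral_add_measure, lintegral_smul_measure]

lemma lintegral_fairSeq_cons {f : (ℕ → Bool) → ℝ≥0∞} (hf : Measurable f) :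
    ∫⁻ s, f s ∂fairSeq =
      2⁻¹ * ∫⁻ s, f (cons true s) ∂fairSeq + 2⁻¹ * ∫⁻ s, f (cons false s) ∂fairSeq := by
  rw [fairSeq, lintegral_infinitePi_cons _ hf, lintegral_fairCoin]

lemma integral_fairSeq_cons {f : (ℕ → Bool) → ℝ} (hf : Measurable f) {C : ℝ}
    (hC : ∀ s, |f s| ≤ C) :
    ∫ s, f s ∂fairSeq =
      2⁻¹ * ∫ s, f (cons true s) ∂fairSeq + 2⁻¹ * ∫ s, f (cons false s) ∂fairSeq := by
  have hi : Integrable f fairSeq :=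
    Integrable.of_bound hf.aestronglyMeasurable C (ae_of_all _ hC)
  have hm := hf.comp (measurable_cons (E := Bool))
  conv_lhs => rw [fairSeq, ← map_cons_prod_infinitePi fairCoin]
  rw [integral_map measurable_cons.aemeasurable hf.aestronglyMeasurable]
  have hi2 : Integrable (fun p : Bool × (ℕ → Bool) => f (cons p.1 p.2))
      (fairCoin.prod (Measure.infinitePi fun _ : ℕ => fairCoin)) :=
    Integrable.of_bound hm.aestronglyMeasurable C (ae_of_all _ fun p => hC _)
  rw [integral_prod _ hi2]
  change ∫ x, (fun x => ∫ s, f (cons x s) ∂fairSeq) x ∂fairCoin = _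
  generalize hF : (fun x => ∫ s, f (cons x s) ∂fairSeq) = F
  have hint : ∀ c : Bool, Integrable F ((2 : ℝ≥0∞)⁻¹ • Measure.dirac c) := fun c =>
    (integrable_dirac (by simp)).smul_measure (by simp)
  rw [fairCoin, integral_add_measure (hint true) (hint false)]
  simp [integral_smul_measure, ← hF]

lemma fairRow_map_comp {l : ℤ → ℤ} (hl : Function.Injective l) :
    fairRow.map (fun b i => b (l i)) = fairRow :=
  Measure.map_infinitePi_infinitePi_of_inj (P := fun _ : ℤ => fairCoin) hl

lemma measurable_comp_int {β : Type*} [MeasurableSpace β] (l : ℤ → ℤ) :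
    Measurable fun (b : ℤ → β) i => b (l i) :=
  measurable_pi_lambda _ fun i => measurable_pi_apply (l i)

lemma lintegral_fairRow_comp {l : ℤ → ℤ} (hl : Function.Injective l) {f : (ℤ → Bool) → ℝ≥0∞}
    (hf : Measurable f) : ∫⁻ b, f (fun i => b (l i)) ∂fairRow = ∫⁻ b, f b ∂fairRow := by
  conv_rhs => rw [← fairRow_map_comp hl]
  rw [lintegral_map hf (measurable_comp_int l)]

lemma lintegral_fairRow_shift (k : ℤ) {f : (ℤ → Bool) → ℝ≥0∞}
    (hf : Measurable f) : ∫⁻ b, f (shift k b) ∂fairRow = ∫⁻ b, f b ∂fairRow :=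
  lintegral_fairRow_comp (add_right_injective k) hf

lemma lintegral_fairRow_nat (k : ℤ) {f : (ℕ → Bool) → ℝ≥0∞} (hf : Measurable f) :
    ∫⁻ b, f (fun n => b (n + k)) ∂fairRow = ∫⁻ s, f s ∂fairSeq := by
  have h : fairRow.map (fun b (n : ℕ) => b (n + k)) = fairSeq :=
    Measure.map_infinitePi_infinitePi_of_inj (P := fun _ : ℤ => fairCoin)
      (f := fun n : ℕ => (n : ℤ) + k) fun m n h => by simpa using h
  rw [← h, lintegral_map hf (measurable_pi_lambda _ fun n => measurable_pi_apply _)]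

/-- The coins seen from a typical occupied gap. -/
def palmRow : Measure (ℤ → Bool) := (4 / 3 : ℝ≥0∞) • fairRow.restrict {b | Occ b 0}

lemma measurableSet_occ_zero : MeasurableSet {b : ℤ → Bool | Occ b 0} :=
  measurableSet_occ measurable_id measurable_const

lemma lintegral_palmRow (f : (ℤ → Bool) → ℝ≥0∞) :
    ∫⁻ b, f b ∂palmRow = 4 / 3 * ∫⁻ b in {b | Occ b 0}, f b ∂fairRow := by
  simp [palmRow, lintegral_smul_measure]

/-- Functions of three consecutive coins. -/
lemma lintegral_fairRow_three (f : Bool → Bool → Bool → ℝ≥0∞) :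
    ∫⁻ b, f (b 0) (b 1) (b 2) ∂fairRow =
      8⁻¹ * ∑ x : Bool, ∑ y : Bool, ∑ z : Bool, f x y z := by
  have hm : Measurable fun s : ℕ → Bool => f (s 0) (s 1) (s 2) := by
    have : Measurable fun p : Bool × Bool × Bool => f p.1 p.2.1 p.2.2 := measurable_of_finite _
    exact this.comp (g := fun p : Bool × Bool × Bool => f p.1 p.2.1 p.2.2)
      (f := fun s : ℕ → Bool => (s 0, s 1, s 2)) (by fun_prop)
  have h := lintegral_fairRow_nat 0 hm
  simp only [add_zero, Nat.cast_zero, Nat.cast_one, Nat.cast_ofNat] at h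
  rw [h, lintegral_fairSeq_cons hm]
  have hm2 : ∀ x, Measurable fun s : ℕ → Bool => f x (s 0) (s 1) := fun x => by
    have : Measurable fun p : Bool × Bool => f x p.1 p.2 := measurable_of_finite _
    exact this.comp (g := fun p : Bool × Bool => f x p.1 p.2)
      (f := fun s : ℕ → Bool => (s 0, s 1)) (by fun_prop)
  have hm1 : ∀ x y, Measurable fun s : ℕ → Bool => f x y (s 0) := fun x y => by
    have : Measurable fun p : Bool => f x y p := measurable_of_finite _
    exact this.comp (measurable_pi_apply 0)
  have e1 : ∀ x s, f (cons x s 0) (cons x s 1) (cons x s 2) = f x (s 0) (s 1) := fun _ _ => rfl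
  have e2 : ∀ x y s, f x (cons y s 0) (cons y s 1) = f x y (s 0) := fun _ _ _ => rfl
  have e3 : ∀ x y z s, f x y (cons z s 0) = f x y z := fun _ _ _ _ => rfl
  have h8 : (8 : ℝ≥0∞)⁻¹ = 2⁻¹ * (2⁻¹ * 2⁻¹) := by
    rw [← ENNReal.mul_inv (by simp) (by simp), ← ENNReal.mul_inv (by simp) (by simp)]; norm_num
  simp only [e1, lintegral_fairSeq_cons (hm2 _), e2, lintegral_fairSeq_cons (hm1 _ _), e3,
    lintegral_const, measure_univ, mul_one, h8, Fintype.sum_bool]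
  ring

lemma fairRow_occ : fairRow {b | Occ b 0} = 3 / 4 := by
  rw [← lintegral_indicator_one measurableSet_occ_zero]
  have h := lintegral_fairRow_three fun x y _ => if x = true ∨ y = false then 1 else 0
  have e : ∀ b : ℤ → Bool, ({b | Occ b 0} : Set (ℤ → Bool)).indicator
      (1 : (ℤ → Bool) → ℝ≥0∞) b = if b 0 = true ∨ b 1 = false then 1 else 0 := fun b => by
    simp [indicator, Occ]
  simp only [e, h, Fintype.sum_bool]
  norm_num
  rw [ENNReal.div_eq_inv_mul, show (8 : ℝ≥0∞) = 4 * 2 by norm_num,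
    show (6 : ℝ≥0∞) = 2 * 3 by norm_num, ENNReal.mul_inv (by simp) (by simp), mul_assoc,
    ← mul_assoc 2⁻¹, ENNReal.inv_mul_cancel (by simp) (by simp), one_mul]

lemma four_thirds_mul_three_quarters : (4 / 3 : ℝ≥0∞) * (3 / 4) = 1 := by
  rw [← mul_div_assoc, ENNReal.div_mul_cancel (by simp) (by simp)]
  exact ENNReal.div_self (by simp) (by simp)

instance : IsProbabilityMeasure palmRow :=
  ⟨by simp [palmRow, fairRow_occ, four_thirds_mul_three_quarters]⟩

/-- Under the Palm distribution, the coins look the same from every occupied gap. -/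
lemma lintegral_palmRow_shift (n : ℤ) {f : (ℤ → Bool) → ℝ≥0∞} (hf : Measurable f) :
    ∫⁻ b, f (shift (occIdx b n) b) ∂palmRow = ∫⁻ b, f b ∂palmRow := by
  rw [lintegral_palmRow, lintegral_palmRow]
  congr 1
  rw [← lintegral_indicator measurableSet_occ_zero, ← lintegral_indicator measurableSet_occ_zero]
  have hS : ∀ k n : ℤ, MeasurableSet {b : ℤ → Bool | occIdx b n = k} := fun k n =>
    measurable_occIdx measurable_id n (measurableSet_singleton k)
  have hO : ∀ k : ℤ, MeasurableSet {b : ℤ → Bool | Occ b k} := fun k =>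
    measurableSet_occ measurable_id measurable_const
  have hsh : ∀ k : ℤ, Measurable (shift k : (ℤ → Bool) → ℤ → Bool) := fun k =>
    measurable_shift measurable_id measurable_const
  classical
  -- Mass transport: sort the rows by the value `k` of `occIdx b n`. Seen from gap `k`, the
  -- condition says that gap `-k` is occupied and has number `-n`. Shift invariance of the fair row
  -- then matches the two sums term by term.
  let g : ℤ → (ℤ → Bool) → ℝ≥0∞ := fun k =>
    ({b | Occ b 0} ∩ {b | Occ b (-k)} ∩ {b | occIdx b (-n) = -k}).indicator f
  have hg : ∀ k, Measurable (g k) := fun k =>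
    hf.indicator (((hO 0).inter (hO (-k))).inter (hS (-k) (-n)))
  have h1 : ∀ b : ℤ → Bool, ({b | Occ b 0} : Set (ℤ → Bool)).indicator
      (fun b => f (shift (occIdx b n) b)) b = ∑' k, g k (shift k b) := fun b => by
    by_cases h0 : Occ b 0
    · rw [indicator_of_mem (by exact h0), tsum_eq_single (occIdx b n)]
      · refine (indicator_of_mem ?_ _).symm
        have h := (occIdx_eq_iff_shift (b := b) (n := n) (k := occIdx b n)).1 ⟨h0, rfl⟩
        exact ⟨⟨h.1, by simpa [occ_shift] using h.2.1⟩, h.2.2⟩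
      · intro k hk
        refine indicator_of_notMem ?_ _
        rintro ⟨⟨h2, h3⟩, h4⟩
        exact hk (occIdx_eq_iff_shift.2 ⟨h2, h0, h4⟩).2.symm
    · rw [indicator_of_notMem (by exact h0)]
      refine (ENNReal.tsum_eq_zero.2 fun k => indicator_of_notMem ?_ _).symm
      rintro ⟨⟨h2, h3⟩, h4⟩
      exact h0 (by simpa [occ_shift] using h3)
  have h2 : ∀ b : ℤ → Bool, ({b | Occ b 0} : Set (ℤ → Bool)).indicator f b = ∑' k, g k b :=
    fun b => by
    by_cases h0 : Occ b 0
    · rw [indicator_of_mem (by exact h0), tsum_eq_single (-occIdx b (-n))]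
      · have h3 : Occ b (- -occIdx b (-n)) := by simpa using occ_occIdx (b := b) (-n)
        have h4 : occIdx b (-n) = - -occIdx b (-n) := by simp
        refine (indicator_of_mem ?_ _).symm
        exact ⟨⟨h0, h3⟩, h4⟩
      · intro k hk
        refine indicator_of_notMem ?_ _
        rintro ⟨-, h4⟩
        simp only [mem_ofPred_eq] at h4
        omega
    · rw [indicator_of_notMem (by exact h0)]
      exact (ENNReal.tsum_eq_zero.2 fun k => indicator_of_notMem (fun h => h0 h.1.1) _).symm
  simp only [h1, h2]
  have hgs : ∀ k, Measurable fun b => g k (shift k b) := fun k => (hg k).comp (hsh k)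
  rw [lintegral_tsum fun k => (hgs k).aemeasurable,
    lintegral_tsum fun k => (hg k).aemeasurable]
  exact tsum_congr fun k => lintegral_fairRow_shift k (hg k)

/-! ### First moments under the Palm distribution of the coins -/

/-- The eight coin patterns have probability 1/8 each, so `hsum` gives mean one under the fair law;
the factor 4/3 comes from conditioning on an occupied gap. `h0` removes the patterns that leave gap
0 empty. -/
lemma lintegral_palmRow_three {g : (ℤ → Bool) → ℝ≥0∞} (f : Bool → Bool → Bool → ℝ≥0∞)
    (h : ∀ b, Occ b 0 → g b = f (b 0) (b 1) (b 2)) (h0 : ∀ z, f false true z = 0)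
    (hsum : ∑ x : Bool, ∑ y : Bool, ∑ z : Bool, f x y z = 8) :
    ∫⁻ b, g b ∂palmRow = 4 / 3 := by
  rw [lintegral_palmRow, ← lintegral_indicator measurableSet_occ_zero]
  have e : ∀ b : ℤ → Bool, ({b | Occ b 0} : Set (ℤ → Bool)).indicator g b = f (b 0) (b 1) (b 2) :=
    fun b => by
    by_cases hb : Occ b 0
    · rw [indicator_of_mem (by exact hb), h b hb]
    · rw [indicator_of_notMem (by exact hb)]
      simp only [Occ, not_or, Bool.not_eq_false, Bool.not_eq_true, zero_add] at hb
      rw [hb.1, hb.2, h0]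
  simp only [e]
  rw [lintegral_fairRow_three, hsum, ENNReal.inv_mul_cancel (by simp) (by simp), mul_one]

/-- Occupied gaps have density 3/4. The distance to the next one is 1, or 2 if gap 1 is empty. -/
lemma lintegral_palmRow_occIdx_one :
    ∫⁻ b, ENNReal.ofReal ((occIdx b 1 - occIdx b 0 : ℤ) : ℝ) ∂palmRow = 4 / 3 := by
  refine lintegral_palmRow_three
    (fun x y z => if x = true ∨ y = false then (if y = true ∨ z = false then 1 else 2) else 0)
    (fun b hb => ?_) (by simp) (by simp; norm_num)
  have h1 := occIdx_succ (b := b) 0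
  rw [zero_add, occIdx_zero hb] at h1
  rw [occIdx_zero hb, h1]
  have hb' : b 0 = true ∨ b 1 = false := by simpa [Occ] using hb
  simp only [hb', if_true, nextOcc, Occ]
  norm_num
  split_ifs <;> simp

lemma lintegral_palmRow_firstPt_one :
    ∫⁻ b, ENNReal.ofReal ((firstPt b (occIdx b 1) - firstPt b (occIdx b 0) : ℤ) : ℝ) ∂palmRow =
      4 / 3 := by
  refine lintegral_palmRow_three
    -- The value is the size of the cluster in gap 0, determined by the coins of its two ends.
    (fun x y z => if x = true then (if y = true then 1 else 2) else (if y = true then 0 else 1))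
    (fun b hb => ?_) (by simp) (by simp; norm_num)
  have h1 := occIdx_succ (b := b) 0
  rw [zero_add, occIdx_zero hb] at h1
  rw [occIdx_zero hb, h1, firstPt_nextOcc]
  have hb' : b 0 = true ∨ b 1 = false := by simpa [Occ] using hb
  simp only [firstPt]
  norm_num
  cases h0 : b 0 <;> cases h1 : b 1 <;> simp_all
  norm_num

/-- Expectation of a stationary sequence of increments with mean `4 / 3`. -/
lemma lintegral_palmRow_cocycle {D : (ℤ → Bool) → ℤ → ℤ} (hD : ∀ j, Measurable fun b => D b j)
    (hmono : ∀ b, Monotone (D b))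
    (hco : ∀ b j, D b (j + 1) - D b j = D (shift (occIdx b j) b) 1 - D (shift (occIdx b j) b) 0)
    (hone : ∫⁻ b, ENNReal.ofReal ((D b 1 - D b 0 : ℤ) : ℝ) ∂palmRow = 4 / 3)
    {i j : ℤ} (hij : i ≤ j) :
    ∫⁻ b, ENNReal.ofReal ((D b j - D b i : ℤ) : ℝ) ∂palmRow =
      ENNReal.ofReal (4 / 3 * ((j : ℝ) - i)) := by
  obtain ⟨n, rfl⟩ := Int.le.dest hij
  have hm : ∀ j i, Measurable fun b => ENNReal.ofReal ((D b j - D b i : ℤ) : ℝ) := fun j i =>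
    ENNReal.measurable_ofReal.comp (measurable_from_top.comp ((hD j).sub (hD i)))
  induction n with
  | zero => simp
  | succ n ih =>
    have e : ∀ b, ENNReal.ofReal ((D b (i + (n + 1 : ℕ)) - D b i : ℤ) : ℝ) =
        ENNReal.ofReal ((D b (i + n) - D b i : ℤ) : ℝ) +
        ENNReal.ofReal ((D (shift (occIdx b (i + n)) b) 1 -
          D (shift (occIdx b (i + n)) b) 0 : ℤ) : ℝ) := fun b => by
      rw [← hco, ← ENNReal.ofReal_add]
      · push_cast; congr 1; ring_nf
      · exact_mod_cast sub_nonneg.2 (hmono b (by omega))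
      · exact_mod_cast sub_nonneg.2 (hmono b (by omega))
    simp only [e]
    rw [lintegral_add_left (hm _ _), ih (by omega),
      lintegral_palmRow_shift _ (f := fun b => ENNReal.ofReal ((D b 1 - D b 0 : ℤ) : ℝ)) (hm 1 0),
      hone]
    have h43 : (4 / 3 : ℝ≥0∞) = ENNReal.ofReal (4 / 3) := by
      rw [ENNReal.ofReal_div_of_pos (by norm_num)]; simp
    rw [h43, ← ENNReal.ofReal_add (by push_cast; simp) (by norm_num)]
    congr 1
    push_cast
    ring

lemma measurable_firstPt_occIdx (j : ℤ) : Measurable fun b => firstPt b (occIdx b j) :=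
  measurable_firstPt measurable_id (measurable_occIdx measurable_id j)

lemma lintegral_palmRow_occIdx {i j : ℤ} (hij : i ≤ j) :
    ∫⁻ b, ENNReal.ofReal ((occIdx b j - occIdx b i : ℤ) : ℝ) ∂palmRow =
      ENNReal.ofReal (4 / 3 * ((j : ℝ) - i)) := by
  refine lintegral_palmRow_cocycle (D := occIdx) (measurable_occIdx measurable_id)
    (fun b => (occIdx_strictMono b).monotone) (fun b j => ?_) lintegral_palmRow_occIdx_one hij
  rw [occIdx_shift, occIdx_shift]; simp

lemma lintegral_palmRow_firstPt {i j : ℤ} (hij : i ≤ j) :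
    ∫⁻ b, ENNReal.ofReal ((firstPt b (occIdx b j) - firstPt b (occIdx b i) : ℤ) : ℝ) ∂palmRow =
      ENNReal.ofReal (4 / 3 * ((j : ℝ) - i)) := by
  refine lintegral_palmRow_cocycle (D := fun b j => firstPt b (occIdx b j))
    measurable_firstPt_occIdx (fun b => (firstPt_occIdx_strictMono b).monotone) (fun b j => ?_)
    lintegral_palmRow_firstPt_one hij
  simp only [occIdx_shift, firstPt_shift, add_sub_cancel, add_zero]
  ring

/-! ### Fluctuations of the number of old points -/

/-- The number of steps along the gaps needed to pass `n` occupied gaps. -/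
def walk : ℕ → (ℕ → Bool) → ℤ
  | 0, _ => 0
  | n + 1, s => if s 0 = false ∧ s 1 = true then 2 + walk n (fun i => s (i + 2))
      else 1 + walk n (tail s)

/-- Whether the gap after the current one is empty depends on the coins of its two ends, so from gap
0 the reading starts at coin 1. Skipping an empty gap uses up both coins. -/
lemma occIdx_eq_walk (n : ℕ) (b : ℤ → Bool) (h : Occ b 0) :
    occIdx b n = walk n (fun i => b (i + 1)) := by
  induction n generalizing b with
  | zero => exact occIdx_zero h
  | succ n ih =>
    have h1 := occIdx_succ (b := b) 0
    rw [zero_add, occIdx_zero h] at h1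
    have hocc : Occ (shift (occIdx b 1) b) 0 := by rw [occ_shift, add_zero]; exact occ_occIdx 1
    have h2 := occIdx_add (b := b) 1 n
    rw [Nat.cast_succ, add_comm (n : ℤ), h2, ih _ hocc, h1]
    have hs : ∀ k : ℕ, (fun i : ℕ => shift (k : ℤ) b (i + 1)) = fun i => b ((i + k : ℕ) + 1) :=
      fun k => funext fun i => by simp only [shift]; congr 1; push_cast; ring
    by_cases hc : b 1 = false ∧ b 2 = true
    · have hn : nextOcc b 0 = (2 : ℕ) := by simp [nextOcc, Occ, hc]
      rw [hn, hs, walk, if_pos (by simpa using hc)]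
      rfl
    · have hn : nextOcc b 0 = (1 : ℕ) := by
        have : b 1 = true ∨ b 2 = false := by
          cases h1 : b 1 <;> simp_all
        simp [nextOcc, Occ, this]
      rw [hn, hs, walk, if_neg (by simpa using hc)]
      rfl

lemma measurable_walk (n : ℕ) : Measurable (walk n) := by
  induction n with
  | zero => exact measurable_const
  | succ n ih =>
    refine Measurable.ite ?_ ?_ ?_
    · have h : ∀ (i : ℕ) (x : Bool), MeasurableSet {s : ℕ → Bool | s i = x} := fun i x =>
        measurable_pi_apply (X := fun _ : ℕ => Bool) i (measurableSet_singleton x)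
      exact (h 0 false).inter (h 1 true)
    · exact (ih.comp (measurable_pi_lambda _ fun i => measurable_pi_apply (i + 2))).const_add 2
    · exact (ih.comp measurable_tail).const_add 1

lemma walk_bounds (n : ℕ) (s : ℕ → Bool) : n ≤ walk n s ∧ walk n s ≤ 2 * n := by
  induction n generalizing s with
  | zero => simp [walk]
  | succ n ih =>
    unfold walk
    have h1 := ih fun i => s (i + 2)
    have h2 := ih (tail s)
    split_ifs <;> (push_cast; omega)

/-- The centred walk. -/
def cwalk (n : ℕ) (s : ℕ → Bool) : ℝ := walk n s - 4 / 3 * n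

lemma measurable_cwalk (n : ℕ) : Measurable (cwalk n) :=
  (measurable_from_top.comp (measurable_walk n)).sub_const _

lemma abs_cwalk_le (n : ℕ) (s : ℕ → Bool) : |cwalk n s| ≤ n := by
  obtain ⟨h1, h2⟩ := walk_bounds n s
  have h1' : (n : ℝ) ≤ walk n s := by exact_mod_cast h1
  have h2' : (walk n s : ℝ) ≤ 2 * n := by exact_mod_cast h2
  unfold cwalk
  rw [abs_le]
  constructor <;> linarith [(Nat.cast_nonneg n : (0 : ℝ) ≤ n)]

lemma cwalk_true (n : ℕ) (s : ℕ → Bool) : cwalk (n + 1) (cons true s) = cwalk n s - 1 / 3 := by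
  simp [cwalk, walk]; ring

lemma cwalk_false_false (n : ℕ) (s : ℕ → Bool) :
    cwalk (n + 1) (cons false (cons false s)) = cwalk n (cons false s) - 1 / 3 := by
  simp [cwalk, walk]; ring

lemma cwalk_false_true (n : ℕ) (s : ℕ → Bool) :
    cwalk (n + 1) (cons false (cons true s)) = cwalk n s + 2 / 3 := by
  simp [cwalk, walk]; ring

lemma measurable_cons_left (x : Bool) : Measurable (cons x : (ℕ → Bool) → ℕ → Bool) :=
  measurable_cons.comp measurable_prodMk_left

/-- The mean and the second moment of the centred walk, given its first coin. -/
lemma cwalk_moments (n : ℕ) :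
    (-2 / 3 ≤ ∫ s, cwalk n (cons true s) ∂fairSeq - ∫ s, cwalk n (cons false s) ∂fairSeq ∧
      ∫ s, cwalk n (cons true s) ∂fairSeq - ∫ s, cwalk n (cons false s) ∂fairSeq ≤ 0) ∧
    ∫ s, cwalk n (cons true s) ^ 2 ∂fairSeq + 2 * ∫ s, cwalk n (cons false s) ^ 2 ∂fairSeq ≤
      2 / 3 * n := by
  -- The next coin to be read is a Markov chain: after `true` it is fair, after `false` it is
  -- `false` again with probability 3/4. Its stationary law (1/3, 2/3) explains the weights 1 and 2,
  -- for which the drifts cancel. The weighted second moment grows per step by 2/3 plus one third of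
  -- the difference d of the conditional means. Since d evolves by d ↦ d/4 - 1/2 with fixed point
  -- -2/3, it stays in [-2/3, 0].
  induction n with
  | zero => norm_num [cwalk, walk]
  | succ n ih =>
    have hm := measurable_cwalk n
    have hb := abs_cwalk_le n
    have hsq : ∀ s, |cwalk n s ^ 2| ≤ (n : ℝ) ^ 2 := fun s => by
      rw [abs_pow]; exact pow_le_pow_left₀ (abs_nonneg _) (hb s) 2
    have I : ∀ x, Integrable (fun s => cwalk n (cons x s)) fairSeq := fun x =>
      Integrable.of_bound (hm.comp (measurable_cons_left x)).aestronglyMeasurable n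
        (ae_of_all _ fun s => hb _)
    have I2 : ∀ x, Integrable (fun s => cwalk n (cons x s) ^ 2) fairSeq := fun x =>
      Integrable.of_bound ((hm.comp (measurable_cons_left x)).pow_const 2).aestronglyMeasurable
        ((n : ℝ) ^ 2) (ae_of_all _ fun s => hsq _)
    have J : Integrable (cwalk n) fairSeq :=
      Integrable.of_bound hm.aestronglyMeasurable n (ae_of_all _ hb)
    have J2 : Integrable (fun s => cwalk n s ^ 2) fairSeq :=
      Integrable.of_bound (hm.pow_const 2).aestronglyMeasurable ((n : ℝ) ^ 2) (ae_of_all _ hsq)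
    have sq : ∀ f : (ℕ → Bool) → ℝ, Integrable f fairSeq → Integrable (fun s => f s ^ 2) fairSeq →
        ∀ a : ℝ, ∫ s, (f s + a) ^ 2 ∂fairSeq =
          ∫ s, f s ^ 2 ∂fairSeq + 2 * a * ∫ s, f s ∂fairSeq + a ^ 2 := fun f hf hf2 a => by
      have e : ∀ s, (f s + a) ^ 2 = f s ^ 2 + 2 * a * f s + a ^ 2 := fun s => by ring
      simp only [e]
      have hf3 : Integrable (fun s => 2 * a * f s) fairSeq := hf.const_mul _
      have hf4 : Integrable (fun s => f s ^ 2 + 2 * a * f s) fairSeq := hf2.add hf3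
      rw [integral_add hf4 (integrable_const _), integral_add hf2 hf3, integral_const_mul]
      simp
    have li : ∀ f : (ℕ → Bool) → ℝ, Integrable f fairSeq → ∀ a : ℝ,
        ∫ s, (f s + a) ∂fairSeq = ∫ s, f s ∂fairSeq + a := fun f hf a => by
      rw [integral_add hf (integrable_const _)]; simp
    have m' := measurable_cwalk (n + 1)
    have b' := abs_cwalk_le (n + 1)
    have b2 : ∀ s, |cwalk (n + 1) s ^ 2| ≤ ((n + 1 : ℕ) : ℝ) ^ 2 := fun s => by
      rw [abs_pow]; exact pow_le_pow_left₀ (abs_nonneg _) (b' s) 2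
    have M : ∫ s, cwalk n s ∂fairSeq = _ := integral_fairSeq_cons hm hb
    have P : ∫ s, cwalk n s ^ 2 ∂fairSeq = _ := integral_fairSeq_cons (hm.pow_const 2) hsq
    have T1 : ∫ s, cwalk (n + 1) (cons true s) ∂fairSeq = ∫ s, cwalk n s ∂fairSeq - 1 / 3 := by
      simp only [cwalk_true, sub_eq_add_neg]; rw [li _ J]
    have T2 : ∫ s, cwalk (n + 1) (cons true s) ^ 2 ∂fairSeq =
        ∫ s, cwalk n s ^ 2 ∂fairSeq - 2 / 3 * ∫ s, cwalk n s ∂fairSeq + 1 / 9 := by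
      simp only [cwalk_true, sub_eq_add_neg]; rw [sq _ J J2]; ring
    have F1 : ∫ s, cwalk (n + 1) (cons false s) ∂fairSeq =
        2⁻¹ * (∫ s, cwalk n s ∂fairSeq + 2 / 3) +
          2⁻¹ * (∫ s, cwalk n (cons false s) ∂fairSeq - 1 / 3) := by
      rw [integral_fairSeq_cons (f := fun s => cwalk (n + 1) (cons false s))
        (m'.comp (measurable_cons_left false)) fun s => b' _]
      simp only [cwalk_false_false, cwalk_false_true, sub_eq_add_neg]
      rw [li _ J, li _ (I false)]
    have F2 : ∫ s, cwalk (n + 1) (cons false s) ^ 2 ∂fairSeq =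
        2⁻¹ * (∫ s, cwalk n s ^ 2 ∂fairSeq + 4 / 3 * ∫ s, cwalk n s ∂fairSeq + 4 / 9) +
          2⁻¹ * (∫ s, cwalk n (cons false s) ^ 2 ∂fairSeq
            - 2 / 3 * ∫ s, cwalk n (cons false s) ∂fairSeq + 1 / 9) := by
      rw [integral_fairSeq_cons (f := fun s => cwalk (n + 1) (cons false s) ^ 2)
        ((m'.comp (measurable_cons_left false)).pow_const 2) fun s => b2 _]
      simp only [cwalk_false_false, cwalk_false_true, sub_eq_add_neg]
      rw [sq _ J J2, sq _ (I false) (I2 false)]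
      ring
    rw [T1, T2, F1, F2, P, M]
    obtain ⟨⟨ih1, ih2⟩, ih3⟩ := ih
    push_cast
    refine ⟨⟨?_, ?_⟩, ?_⟩ <;> linarith

/-- The two first coins have weight 1/2 each. Raising the weight of `false` to 1 gives half of the
quantity bounded in `cwalk_moments`. -/
lemma lintegral_cwalk_sq_le (n : ℕ) :
    ∫⁻ s, ENNReal.ofReal (cwalk n s ^ 2) ∂fairSeq ≤ ENNReal.ofReal (n / 3) := by
  have hsq : ∀ s, |cwalk n s ^ 2| ≤ (n : ℝ) ^ 2 := fun s => by
    rw [abs_pow]; exact pow_le_pow_left₀ (abs_nonneg _) (abs_cwalk_le n s) 2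
  have hm := (measurable_cwalk n).pow_const 2
  rw [← ofReal_integral_eq_lintegral_ofReal
    (Integrable.of_bound hm.aestronglyMeasurable _ (ae_of_all _ hsq))
    (ae_of_all _ fun s => sq_nonneg _)]
  refine ENNReal.ofReal_le_ofReal ?_
  rw [integral_fairSeq_cons hm hsq]
  have h := (cwalk_moments n).2
  have h2 : 0 ≤ ∫ s, cwalk n (cons false s) ^ 2 ∂fairSeq := integral_nonneg fun s => sq_nonneg _
  linarith

/-- Dropping the condition that gap 0 is occupied costs at most its normalization 4/3, whence 4/3 ·
n/3. -/
lemma lintegral_palmRow_sq_occIdx (n : ℕ) :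
    ∫⁻ b, ENNReal.ofReal (((occIdx b n : ℤ) - 4 / 3 * n : ℝ) ^ 2) ∂palmRow ≤
      ENNReal.ofReal (4 / 9 * n) := by
  rw [lintegral_palmRow]
  have e : ∫⁻ b in {b | Occ b 0}, ENNReal.ofReal (((occIdx b n : ℤ) - 4 / 3 * n : ℝ) ^ 2)
      ∂fairRow = ∫⁻ b in {b | Occ b 0}, ENNReal.ofReal (cwalk n (fun i => b (i + 1)) ^ 2)
      ∂fairRow :=
    setLIntegral_congr_fun measurableSet_occ_zero fun b hb => by
      simp only [cwalk, occIdx_eq_walk n b hb]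
  rw [e]
  have h43 : (4 / 3 : ℝ≥0∞) = ENNReal.ofReal (4 / 3) := by
    rw [ENNReal.ofReal_div_of_pos (by norm_num)]; simp
  calc 4 / 3 * ∫⁻ b in {b | Occ b 0}, ENNReal.ofReal (cwalk n (fun i => b (i + 1)) ^ 2) ∂fairRow
      ≤ 4 / 3 * ∫⁻ b, ENNReal.ofReal (cwalk n (fun i => b (i + 1)) ^ 2) ∂fairRow := by
        exact mul_le_mul_right (setLIntegral_le_lintegral _ _) _
    _ = 4 / 3 * ∫⁻ s, ENNReal.ofReal (cwalk n s ^ 2) ∂fairSeq := by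
        rw [lintegral_fairRow_nat 1 (f := fun s => ENNReal.ofReal (cwalk n s ^ 2))
          (ENNReal.measurable_ofReal.comp ((measurable_cwalk n).pow_const 2))]
    _ ≤ 4 / 3 * ENNReal.ofReal (n / 3) := by gcongr; exact lintegral_cwalk_sq_le n
    _ = ENNReal.ofReal (4 / 9 * n) := by
        rw [h43, ← ENNReal.ofReal_mul (by norm_num)]; congr 1; ring

/-! ### Second moments and contraction -/

/-- The increments of the random sequence `Φ` have second moments that grow at most linearly. -/
structure Diffusive {X : Type*} [MeasurableSpace X] (P : Measure X) (Φ : X → ℤ → ℝ) (C : ℝ) :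
    Prop where
  measurable : Measurable Φ
  nonneg : 0 ≤ C
  bound : ∀ i j : ℤ, i ≤ j →
    ∫⁻ x, ENNReal.ofReal ((Φ x j - Φ x i) ^ 2) ∂P ≤ ENNReal.ofReal (C * ((j : ℝ) - i))

/-- The sequence of the integers. -/
def lattice : ℤ → ℝ := fun n => n

/-- A random linear operator on sequences, driven by a row of coins, that contracts second moments
of increments. -/
structure Contracting (op : (ℤ → Bool) → (ℤ → ℝ) → ℤ → ℝ) : Prop where
  measurable : Measurable fun p : (ℤ → Bool) × (ℤ → ℝ) => op p.1 p.2
  sub : ∀ b y z, op b (y - z) = op b y - op b z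
  zero : ∀ b y, op b y 0 = 0
  contract : ∀ {X : Type} [MeasurableSpace X] (P : Measure X) [IsProbabilityMeasure P]
    (Φ : X → ℤ → ℝ) (C : ℝ), Diffusive P Φ C → ∀ i j : ℤ, i ≤ j →
    ∫⁻ b, ∫⁻ x, ENNReal.ofReal ((op b (Φ x) j - op b (Φ x) i) ^ 2) ∂P ∂palmRow ≤
      ENNReal.ofReal (3 / 4 * C * ((j : ℝ) - i))
  start : ∃ C, Diffusive palmRow (fun b => op b lattice - lattice) C

/-- Repeated application of an operator, with the rows of coins taken from the outside inwards. -/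
def iter {β : Type*} (op : (ℤ → Bool) → β → β) : ℕ → (ℕ → ℤ → Bool) → β → β
  | 0, _, y => y
  | t + 1, s, y => op (s 0) (iter op t (tail s) y)

lemma measurable_iter {β : Type*} [MeasurableSpace β] {op : (ℤ → Bool) → β → β}
    (h : Measurable fun p : (ℤ → Bool) × β => op p.1 p.2) (t : ℕ) :
    Measurable fun p : (ℕ → ℤ → Bool) × β => iter op t p.1 p.2 := by
  induction t with
  | zero => exact measurable_snd
  | succ t ih =>
    have h1 : Measurable fun p : (ℕ → ℤ → Bool) × β => iter op t (tail p.1) p.2 :=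
      ih.comp ((measurable_tail.comp measurable_fst).prodMk measurable_snd)
    exact h.comp (((measurable_pi_apply 0).comp measurable_fst).prodMk h1)

/-- Independent rows of coins, each with the Palm distribution. -/
def palmPath : Measure (ℕ → ℤ → Bool) := Measure.infinitePi fun _ => palmRow

instance : IsProbabilityMeasure palmPath := by unfold palmPath; infer_instance

lemma measurePreserving_palmPath :
    MeasurePreserving (fun s : ℕ → ℤ → Bool => (s 0, tail s)) palmPath
      (palmRow.prod palmPath) :=
  measurePreserving_head_tail palmRow

lemma measurePreserving_palmPath_prod {Y : Type*} [MeasurableSpace Y] (ρ : Measure Y)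
    [IsProbabilityMeasure ρ] :
    MeasurePreserving (fun p : (ℕ → ℤ → Bool) × Y => (p.1 0, (tail p.1, p.2)))
      (palmPath.prod ρ) (palmRow.prod (palmPath.prod ρ)) :=
  (measurePreserving_prodAssoc palmRow palmPath ρ).comp
    (measurePreserving_palmPath.prod (MeasurePreserving.id ρ))

/-! ### Splitting off the outermost row -/

section Lift

variable {X : Type} [MeasurableSpace X] {P : Measure X} [IsProbabilityMeasure P]
  {hd : X → ℤ → Bool} {tl : X → X} {op : (ℤ → Bool) → (ℤ → ℝ) → ℤ → ℝ} {Φ : X → ℤ → ℝ} {C : ℝ}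

/-- The head is independent of the tail, and the tail has again the law `P`; every induction over
the outermost row uses this form. -/
lemma lintegral_headTail (h : MeasurePreserving (fun x => (hd x, tl x)) P (palmRow.prod P))
    {f : (ℤ → Bool) → X → ℝ≥0∞} (hf : Measurable fun p : (ℤ → Bool) × X => f p.1 p.2) :
    ∫⁻ x, f (hd x) (tl x) ∂P = ∫⁻ b, ∫⁻ x, f b x ∂P ∂palmRow := by
  have h1 := h.lintegral_comp hf
  rw [lintegral_prod _ hf.aemeasurable] at h1
  exact h1

lemma Diffusive.lift (hop : Contracting op)
    (h : MeasurePreserving (fun x => (hd x, tl x)) P (palmRow.prod P)) (hΦ : Diffusive P Φ C) :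
    Diffusive P (fun x => op (hd x) (Φ (tl x))) (3 / 4 * C) where
  measurable := by
    have h1 : Measurable fun p : (ℤ → Bool) × X => op p.1 (Φ p.2) :=
      hop.measurable.comp (measurable_fst.prodMk (hΦ.measurable.comp measurable_snd))
    exact h1.comp h.measurable
  nonneg := by linarith [hΦ.nonneg]
  bound i j hij := by
    have h1 : Measurable fun p : (ℤ → Bool) × X => op p.1 (Φ p.2) :=
      hop.measurable.comp (measurable_fst.prodMk (hΦ.measurable.comp measurable_snd))
    rw [lintegral_headTail h
      (f := fun b x => ENNReal.ofReal ((op b (Φ x) j - op b (Φ x) i) ^ 2))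
      (ENNReal.measurable_ofReal.comp
        ((((measurable_pi_apply j).comp h1).sub ((measurable_pi_apply i).comp h1)).pow_const 2))]
    exact hop.contract P Φ C hΦ i j hij

end Lift

lemma Diffusive.comp {X Y : Type*} [MeasurableSpace X] [MeasurableSpace Y] {P : Measure X}
    {R : Measure Y} {Φ : Y → ℤ → ℝ} {C : ℝ} (hΦ : Diffusive R Φ C) {f : X → Y}
    (hf : MeasurePreserving f P R) : Diffusive P (fun x => Φ (f x)) C where
  measurable := hΦ.measurable.comp hf.measurable
  nonneg := hΦ.nonneg
  bound i j hij := by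
    have hm := hΦ.measurable
    rw [hf.lintegral_comp (f := fun y => ENNReal.ofReal ((Φ y j - Φ y i) ^ 2)) (by fun_prop)]
    exact hΦ.bound i j hij

/-- Young's inequality (a + b)² ≤ (7/6) a² + 7 b². The weight 7/6 is small enough that 7/6 · 3/4 <
1. -/
lemma Diffusive.add {X : Type*} [MeasurableSpace X] {P : Measure X} {Φ Ψ : X → ℤ → ℝ} {C D : ℝ}
    (hΦ : Diffusive P Φ C) (hΨ : Diffusive P Ψ D) :
    Diffusive P (fun x => Φ x + Ψ x) (7 / 6 * C + 7 * D) where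
  measurable := hΦ.measurable.add hΨ.measurable
  nonneg := by linarith [hΦ.nonneg, hΨ.nonneg]
  bound i j hij := by
    have h1 := hΦ.measurable
    have h2 := hΨ.measurable
    have hij' : (0 : ℝ) ≤ (j : ℝ) - i := by simpa using (Int.cast_le (R := ℝ)).2 hij
    calc ∫⁻ x, ENNReal.ofReal (((Φ x + Ψ x) j - (Φ x + Ψ x) i) ^ 2) ∂P
        ≤ ∫⁻ x, (ENNReal.ofReal (7 / 6) * ENNReal.ofReal ((Φ x j - Φ x i) ^ 2) +
            ENNReal.ofReal 7 * ENNReal.ofReal ((Ψ x j - Ψ x i) ^ 2)) ∂P := by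
          refine lintegral_mono fun x => ?_
          rw [← ENNReal.ofReal_mul (by norm_num), ← ENNReal.ofReal_mul (by norm_num),
            ← ENNReal.ofReal_add (by positivity) (by positivity)]
          refine ENNReal.ofReal_le_ofReal ?_
          simp only [Pi.add_apply]
          nlinarith [sq_nonneg ((Φ x j - Φ x i) - 6 * (Ψ x j - Ψ x i))]
      _ = ENNReal.ofReal (7 / 6) * ∫⁻ x, ENNReal.ofReal ((Φ x j - Φ x i) ^ 2) ∂P +
            ENNReal.ofReal 7 * ∫⁻ x, ENNReal.ofReal ((Ψ x j - Ψ x i) ^ 2) ∂P := by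
          rw [lintegral_add_left (by fun_prop), lintegral_const_mul _ (by fun_prop),
            lintegral_const_mul _ (by fun_prop)]
      _ ≤ ENNReal.ofReal (7 / 6) * ENNReal.ofReal (C * ((j : ℝ) - i)) +
            ENNReal.ofReal 7 * ENNReal.ofReal (D * ((j : ℝ) - i)) := by
          gcongr
          · exact hΦ.bound i j hij
          · exact hΨ.bound i j hij
      _ = ENNReal.ofReal ((7 / 6 * C + 7 * D) * ((j : ℝ) - i)) := by
          rw [← ENNReal.ofReal_mul (by norm_num), ← ENNReal.ofReal_mul (by norm_num),
            ← ENNReal.ofReal_add (mul_nonneg (by norm_num) (mul_nonneg hΦ.nonneg hij'))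
              (mul_nonneg (by norm_num) (mul_nonneg hΨ.nonneg hij'))]
          congr 1; ring

/-! ### Almost sure convergence of the iterates -/

section Convergence

variable {op : (ℤ → Bool) → (ℤ → ℝ) → ℤ → ℝ}

lemma measurable_iter_lattice (hop : Contracting op) (t : ℕ) :
    Measurable fun s => iter op t s lattice :=
  (measurable_iter hop.measurable t).comp measurable_prodMk_right

/-- By linearity, the difference of two consecutive iterates is the outer operator applied to the
same difference along the tail, so each row contributes a factor 3/4. -/
lemma diffusive_iter_succ_sub (hop : Contracting op) :
    ∃ C, ∀ t, Diffusive palmPath (fun s => iter op (t + 1) s lattice - iter op t s lattice)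
      ((3 / 4) ^ t * C) := by
  obtain ⟨C, hC⟩ := hop.start
  refine ⟨C, fun t => ?_⟩
  induction t with
  | zero =>
    have hp : MeasurePreserving (fun s : ℕ → ℤ → Bool => s 0) palmPath palmRow :=
      measurePreserving_eval_infinitePi (fun _ : ℕ => palmRow) 0
    simpa [iter] using hC.comp hp
  | succ t ih =>
    have h := ih.lift hop measurePreserving_palmPath
    rw [pow_succ', mul_assoc]
    simp only [hop.sub] at h
    exact h

lemma diffusive_iter_sub_lattice (hop : Contracting op) :
    ∃ C, ∀ t, Diffusive palmPath (fun s => iter op t s lattice - lattice) C := by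
  obtain ⟨C, hC⟩ := hop.start
  -- `56 * C` is the fixed point of D ↦ 7/6 · 3/4 · D + 7 C.
  refine ⟨56 * C, fun t => ?_⟩
  induction t with
  | zero =>
    refine ⟨by simp only [iter, sub_self]; exact measurable_const, by linarith [hC.nonneg], ?_⟩
    intro i j hij
    simp [iter]
  | succ t ih =>
    have hp : MeasurePreserving (fun s : ℕ → ℤ → Bool => s 0) palmPath palmRow :=
      measurePreserving_eval_infinitePi (fun _ : ℕ => palmRow) 0
    have h := (ih.lift hop measurePreserving_palmPath).add (hC.comp hp)
    have e : 7 / 6 * (3 / 4 * (56 * C)) + 7 * C = 56 * C := by ring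
    rw [e] at h
    simp only [hop.sub, sub_add_sub_cancel] at h
    exact h

/-- The initial sequence is forgotten: two starting points driven by the same rows approach each
other. -/
lemma diffusive_iter_sub_iter (hop : Contracting op) {ρ : Measure (ℤ → ℝ)}
    [IsProbabilityMeasure ρ] {C : ℝ} (hρ : Diffusive ρ (fun y => y - lattice) C) (t : ℕ) :
    Diffusive (palmPath.prod ρ) (fun p => iter op t p.1 p.2 - iter op t p.1 lattice)
      ((3 / 4) ^ t * C) := by
  induction t with
  | zero =>
    have hp : MeasurePreserving (Prod.snd : (ℕ → ℤ → Bool) × (ℤ → ℝ) → _) (palmPath.prod ρ) ρ :=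
      measurePreserving_snd
    simpa [iter] using hρ.comp hp
  | succ t ih =>
    have h := ih.lift hop (measurePreserving_palmPath_prod ρ)
    rw [pow_succ', mul_assoc]
    simp only [hop.sub] at h
    exact h

/-- A sequence of variables with geometrically decaying second moments is summable. -/
lemma ae_summable_of_sq_le {X : Type*} [MeasurableSpace X] {P : Measure X}
    [IsProbabilityMeasure P] {d : ℕ → X → ℝ} (hd : ∀ t, Measurable (d t)) {K : ℝ} (hK : 0 ≤ K)
    (h : ∀ t, ∫⁻ x, ENNReal.ofReal (d t x ^ 2) ∂P ≤ ENNReal.ofReal ((3 / 4) ^ t * K)) :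
    ∀ᵐ x ∂P, Summable fun t => d t x := by
  -- By |d| ≤ (7/8)^t + (8/7)^t d² and 8/7 · 3/4 = 6/7, the expectations of |d t| are summable.
  have h1 : ∀ t, ∫⁻ x, ENNReal.ofReal |d t x| ∂P ≤
      ENNReal.ofReal ((7 / 8) ^ t + (6 / 7) ^ t * K) := fun t => by
    have hdt := hd t
    calc ∫⁻ x, ENNReal.ofReal |d t x| ∂P
        ≤ ∫⁻ x, (ENNReal.ofReal ((7 / 8) ^ t) +
            ENNReal.ofReal ((8 / 7) ^ t) * ENNReal.ofReal (d t x ^ 2)) ∂P := by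
          refine lintegral_mono fun x => ?_
          rw [← ENNReal.ofReal_mul (by positivity),
            ← ENNReal.ofReal_add (by positivity) (by positivity)]
          refine ENNReal.ofReal_le_ofReal ?_
          have e : (8 / 7 : ℝ) ^ t * (7 / 8) ^ t = 1 := by rw [← mul_pow]; norm_num
          have hpos : (0 : ℝ) < (7 / 8) ^ t := by positivity
          have hpos' : (0 : ℝ) < (8 / 7) ^ t := by positivity
          rw [← sq_abs (d t x)]
          have h0 := abs_nonneg (d t x)
          by_cases hc : |d t x| ≤ (7 / 8) ^ t
          · nlinarith [mul_nonneg hpos'.le (sq_nonneg |d t x|)]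
          · push Not at hc
            have h2 := mul_le_mul_of_nonneg_left hc.le hpos'.le
            rw [e] at h2
            nlinarith [mul_le_mul_of_nonneg_right h2 h0]
      _ = ENNReal.ofReal ((7 / 8) ^ t) +
            ENNReal.ofReal ((8 / 7) ^ t) * ∫⁻ x, ENNReal.ofReal (d t x ^ 2) ∂P := by
          rw [lintegral_add_left (by fun_prop), lintegral_const_mul _ (by fun_prop)]
          simp
      _ ≤ ENNReal.ofReal ((7 / 8) ^ t) +
            ENNReal.ofReal ((8 / 7) ^ t) * ENNReal.ofReal ((3 / 4) ^ t * K) := by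
          gcongr; exact h t
      _ = ENNReal.ofReal ((7 / 8) ^ t + (6 / 7) ^ t * K) := by
          rw [← ENNReal.ofReal_mul (by positivity),
            ← ENNReal.ofReal_add (by positivity) (by positivity), ← mul_assoc, ← mul_pow]
          norm_num
  have h2 : ∫⁻ x, ∑' t, ENNReal.ofReal |d t x| ∂P ≠ ∞ := by
    rw [lintegral_tsum fun t => by have := hd t; fun_prop]
    refine ne_top_of_le_ne_top ?_ (ENNReal.tsum_le_tsum h1)
    rw [← ENNReal.ofReal_tsum_of_nonneg (fun t => by positivity)
      ((summable_geometric_of_lt_one (by norm_num) (by norm_num)).add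
        ((summable_geometric_of_lt_one (by norm_num) (by norm_num)).mul_right K))]
    exact ENNReal.ofReal_ne_top
  filter_upwards [ae_lt_top' (by have := hd; fun_prop) h2] with x hx
  have h3 := ENNReal.summable_toReal hx.ne
  refine Summable.of_abs ?_
  simpa [ENNReal.toReal_ofReal] using h3

lemma iter_zero_apply (hop : Contracting op) (t : ℕ) (s : ℕ → ℤ → Bool) :
    iter op t s lattice 0 = 0 := by
  cases t with
  | zero => simp [iter, lattice]
  | succ t => exact hop.zero _ _

/-- Second moments of a diffusive sequence that vanishes at the origin. -/
lemma Diffusive.sq_le {X : Type*} [MeasurableSpace X] {P : Measure X} {Φ : X → ℤ → ℝ} {C : ℝ}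
    (hΦ : Diffusive P Φ C) (h0 : ∀ x, Φ x 0 = 0) (n : ℤ) :
    ∫⁻ x, ENNReal.ofReal (Φ x n ^ 2) ∂P ≤ ENNReal.ofReal (C * |(n : ℝ)|) := by
  rcases le_total 0 n with h | h
  · have := hΦ.bound 0 n h
    rw [abs_of_nonneg (by exact_mod_cast h)]
    simpa [h0] using this
  · have := hΦ.bound n 0 h
    rw [abs_of_nonpos (by exact_mod_cast h)]
    simpa [h0] using this

lemma ae_tendsto_iter (hop : Contracting op) :
    ∀ᵐ s ∂palmPath, ∃ z : ℤ → ℝ, Tendsto (fun t => iter op t s lattice) atTop (𝓝 z) := by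
  obtain ⟨C, hC⟩ := diffusive_iter_succ_sub hop
  have hC0 : 0 ≤ C := by simpa using (hC 0).nonneg
  have h : ∀ n : ℤ, ∀ᵐ s ∂palmPath,
      Summable fun t => (iter op (t + 1) s lattice - iter op t s lattice) n := fun n => by
    refine ae_summable_of_sq_le (K := C * |(n : ℝ)|)
      (fun t => (measurable_pi_apply n).comp (hC t).measurable) (by positivity) fun t => ?_
    rw [← mul_assoc]
    exact (hC t).sq_le (fun s => by simp [iter_zero_apply hop]) n
  filter_upwards [ae_all_iff.2 h] with s hs
  refine ⟨fun n => ∑' t, (iter op (t + 1) s lattice - iter op t s lattice) n + lattice n, ?_⟩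
  rw [tendsto_pi_nhds]
  intro n
  have h1 := ((hs n).hasSum.tendsto_sum_nat).add_const (lattice n)
  refine h1.congr fun t => ?_
  simp only [Pi.sub_apply]
  rw [Finset.sum_range_sub (fun t => iter op t s lattice n)]
  simp [iter]

lemma exists_limit (hop : Contracting op) :
    ∃ z : (ℕ → ℤ → Bool) → ℤ → ℝ, Measurable z ∧
      ∀ᵐ s ∂palmPath, Tendsto (fun t => iter op t s lattice) atTop (𝓝 (z s)) :=
  measurable_limit_of_tendsto_metrizable_ae
    (fun t => (measurable_iter_lattice hop t).aemeasurable) (ae_tendsto_iter hop)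

lemma ae_tendsto_iter_of_diffusive (hop : Contracting op) {ρ : Measure (ℤ → ℝ)}
    [IsProbabilityMeasure ρ] {C : ℝ} (hρ : Diffusive ρ (fun y => y - lattice) C)
    (h0 : ∀ᵐ y ∂ρ, y 0 = 0) {z : (ℕ → ℤ → Bool) → ℤ → ℝ}
    (hz : ∀ᵐ s ∂palmPath, Tendsto (fun t => iter op t s lattice) atTop (𝓝 (z s))) :
    ∀ᵐ p ∂(palmPath.prod ρ), Tendsto (fun t => iter op t p.1 p.2) atTop (𝓝 (z p.1)) := by
  have hD := diffusive_iter_sub_iter hop hρ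
  have hC0 : 0 ≤ C := hρ.nonneg
  -- At time 0 the difference vanishes at the origin only almost surely. Subtracting its value there
  -- makes this exact, as `Diffusive.sq_le` requires.
  have h : ∀ n : ℤ, ∀ᵐ p ∂(palmPath.prod ρ), Summable fun t =>
      (iter op t p.1 p.2 - iter op t p.1 lattice) n - (iter op t p.1 p.2 - iter op t p.1 lattice) 0 :=
    fun n => by
    have hm : ∀ t i, Measurable fun p : (ℕ → ℤ → Bool) × (ℤ → ℝ) =>
        (iter op t p.1 p.2 - iter op t p.1 lattice) i :=
      fun t i => (measurable_pi_apply i).comp (hD t).measurable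
    refine ae_summable_of_sq_le (K := C * |(n : ℝ)|)
      (fun t => (hm t n).sub (hm t 0)) (by positivity) fun t => ?_
    rw [← mul_assoc]
    refine Diffusive.sq_le (Φ := fun (p : (ℕ → ℤ → Bool) × (ℤ → ℝ)) i => (iter op t p.1 p.2 - iter op t p.1 lattice) i -
      (iter op t p.1 p.2 - iter op t p.1 lattice) 0)
      ⟨measurable_pi_lambda _ fun i => (hm t i).sub (hm t 0), (hD t).nonneg, fun i j hij => ?_⟩
      (fun p => by simp) n
    simpa using (hD t).bound i j hij
  have hz' : ∀ᵐ p ∂(palmPath.prod ρ), Tendsto (fun t => iter op t p.1 lattice) atTop (𝓝 (z p.1)) :=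
    Measure.quasiMeasurePreserving_fst.ae hz
  have h0' : ∀ᵐ p ∂(palmPath.prod ρ), p.2 0 = 0 := Measure.quasiMeasurePreserving_snd.ae h0
  filter_upwards [ae_all_iff.2 h, hz', h0'] with p hp hzp hp0
  rw [tendsto_pi_nhds] at hzp ⊢
  intro n
  have h1 := ((hp n).tendsto_atTop_zero).add (hzp n)
  rw [zero_add] at h1
  refine h1.congr fun t => ?_
  have e0 : iter op t p.1 p.2 0 = 0 := by
    cases t with
    | zero => exact hp0
    | succ t => exact hop.zero _ _
  simp [iter_zero_apply hop, e0]

end Convergence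

/-! ### The two operators -/

lemma ae_palmRow_occ : ∀ᵐ b ∂palmRow, Occ b 0 :=
  Measure.ae_smul_measure (ae_restrict_mem measurableSet_occ_zero) _

lemma lintegral_palmRow_sq_occIdx_sub {i j : ℤ} (hij : i ≤ j) :
    ∫⁻ b, ENNReal.ofReal (((occIdx b j - occIdx b i : ℤ) - 4 / 3 * ((j : ℝ) - i)) ^ 2) ∂palmRow ≤
      ENNReal.ofReal (4 / 9 * ((j : ℝ) - i)) := by
  obtain ⟨n, rfl⟩ := Int.le.dest hij
  have hm : Measurable fun b => ENNReal.ofReal (((occIdx b n - occIdx b 0 : ℤ) - 4 / 3 * (n : ℝ)) ^ 2) :=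
    ENNReal.measurable_ofReal.comp (((measurable_from_top.comp
      ((measurable_occIdx measurable_id n).sub (measurable_occIdx measurable_id 0))).sub_const
        _).pow_const 2)
  have h := lintegral_palmRow_shift i hm
  simp only [occIdx_shift] at h
  have e : ((i + n : ℤ) : ℝ) - i = n := by push_cast; ring
  rw [e]
  have e2 : ∀ b, occIdx b (i + n) - occIdx b i - (occIdx b (i + 0) - occIdx b i) =
      occIdx b (i + n) - occIdx b i := fun b => by simp
  simp only [e2] at h
  rw [h]
  refine le_trans (le_of_eq ?_) (lintegral_palmRow_sq_occIdx n)
  refine lintegral_congr_ae ?_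
  filter_upwards [ae_palmRow_occ] with b hb
  rw [occIdx_zero hb, sub_zero]

/-- For fixed coins, merging only selects indices; 9/16 is the square of the mass factor. -/
lemma lintegral_merge_sq_le {X : Type*} [MeasurableSpace X] {P : Measure X} {Φ : X → ℤ → ℝ}
    {C : ℝ} (hΦ : Diffusive P Φ C) (b : ℤ → Bool) {i j : ℤ} (hij : i ≤ j) :
    ∫⁻ x, ENNReal.ofReal ((3 / 4 * merge b (Φ x) j - 3 / 4 * merge b (Φ x) i) ^ 2) ∂P ≤
      ENNReal.ofReal (9 / 16 * C) *
        ENNReal.ofReal ((firstPt b (occIdx b j) - firstPt b (occIdx b i) : ℤ) : ℝ) := by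
  have hm := hΦ.measurable
  have h := hΦ.bound _ _ ((firstPt_occIdx_strictMono b).monotone hij)
  have hC := hΦ.nonneg
  have e : ∀ x, (3 / 4 * merge b (Φ x) j - 3 / 4 * merge b (Φ x) i) ^ 2 =
      9 / 16 * (Φ x (firstPt b (occIdx b j)) - Φ x (firstPt b (occIdx b i))) ^ 2 := fun x => by
    simp only [merge]; ring
  simp only [e]
  calc _ = ENNReal.ofReal (9 / 16) * ∫⁻ x, ENNReal.ofReal
        ((Φ x (firstPt b (occIdx b j)) - Φ x (firstPt b (occIdx b i))) ^ 2) ∂P := by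
        rw [← lintegral_const_mul _ (by fun_prop)]
        exact lintegral_congr fun x => ENNReal.ofReal_mul (by norm_num)
    _ ≤ ENNReal.ofReal (9 / 16) * ENNReal.ofReal
        (C * ((firstPt b (occIdx b j) : ℝ) - firstPt b (occIdx b i))) := by gcongr
    _ = _ := by
        rw [← ENNReal.ofReal_mul (by norm_num), ← ENNReal.ofReal_mul (by positivity)]
        push_cast
        rw [mul_assoc]

/-- The squared distance of two midpoints is at most the mean of the four squared distances between
the ends of the two gaps. The corresponding index distances average to exactly that of the gaps, so
midpoints cost nothing. -/
lemma lintegral_thin_sq_le {X : Type*} [MeasurableSpace X] {P : Measure X} {Φ : X → ℤ → ℝ}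
    {C : ℝ} (hΦ : Diffusive P Φ C) (b : ℤ → Bool) {i j : ℤ} (hij : i ≤ j) :
    ∫⁻ x, ENNReal.ofReal ((thin b (Φ x) j - thin b (Φ x) i) ^ 2) ∂P ≤
      ENNReal.ofReal (9 / 16 * C) *
        ENNReal.ofReal ((occIdx b j - occIdx b i : ℤ) : ℝ) := by
  -- For `i < j` the right end of the left gap does not lie beyond the left end of the right gap, so
  -- the diffusive bound applies to all four pairs.
  rcases hij.eq_or_lt with rfl | hlt
  · simp
  have hm := hΦ.measurable
  have hC := hΦ.nonneg
  have hlt' := occIdx_strictMono b hlt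
  simp only [thin]
  generalize occIdx b j = J at *
  generalize occIdx b i = I at *
  have e : ∀ x, ENNReal.ofReal ((3 / 4 * ((Φ x J + Φ x (J + 1)) / 2 -
        (Φ x (occIdx b 0) + Φ x (occIdx b 0 + 1)) / 2) -
      3 / 4 * ((Φ x I + Φ x (I + 1)) / 2 -
        (Φ x (occIdx b 0) + Φ x (occIdx b 0 + 1)) / 2)) ^ 2) ≤
      ENNReal.ofReal (9 / 64) * (((ENNReal.ofReal ((Φ x (J + 1) - Φ x I) ^ 2) +
        ENNReal.ofReal ((Φ x (J + 1) - Φ x (I + 1)) ^ 2)) +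
        ENNReal.ofReal ((Φ x J - Φ x I) ^ 2)) + ENNReal.ofReal ((Φ x J - Φ x (I + 1)) ^ 2)) :=
      fun x => by
    rw [← ENNReal.ofReal_add (by positivity) (by positivity),
      ← ENNReal.ofReal_add (by positivity) (by positivity),
      ← ENNReal.ofReal_add (by positivity) (by positivity), ← ENNReal.ofReal_mul (by norm_num)]
    refine ENNReal.ofReal_le_ofReal ?_
    nlinarith [sq_nonneg (Φ x (J + 1) - Φ x J), sq_nonneg (Φ x (I + 1) - Φ x I)]
  refine (lintegral_mono e).trans ?_
  rw [lintegral_const_mul _ (by fun_prop), lintegral_add_left (by fun_prop),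
    lintegral_add_left (by fun_prop), lintegral_add_left (by fun_prop)]
  have hIJ : (I : ℝ) + 1 ≤ J := by exact_mod_cast hlt'
  calc _ ≤ ENNReal.ofReal (9 / 64) *
        (((ENNReal.ofReal (C * (((J + 1 : ℤ) : ℝ) - I)) +
          ENNReal.ofReal (C * (((J + 1 : ℤ) : ℝ) - (I + 1 : ℤ)))) +
          ENNReal.ofReal (C * ((J : ℝ) - I))) + ENNReal.ofReal (C * ((J : ℝ) - (I + 1 : ℤ)))) := by
        gcongr
        · exact hΦ.bound _ _ (by omega)
        · exact hΦ.bound _ _ (by omega)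
        · exact hΦ.bound _ _ (by omega)
        · exact hΦ.bound _ _ (by omega)
    _ = _ := by
        push_cast
        have h1 : 0 ≤ C * ((J : ℝ) + 1 - I) := mul_nonneg hC (by linarith)
        have h2 : 0 ≤ C * ((J : ℝ) + 1 - (I + 1)) := mul_nonneg hC (by linarith)
        have h3 : 0 ≤ C * ((J : ℝ) - I) := mul_nonneg hC (by linarith)
        have h4 : 0 ≤ C * ((J : ℝ) - (I + 1)) := mul_nonneg hC (by linarith)
        rw [← ENNReal.ofReal_add h1 h2, ← ENNReal.ofReal_add (by linarith) h3,
          ← ENNReal.ofReal_add (by linarith) h4, ← ENNReal.ofReal_mul (by norm_num),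
          ← ENNReal.ofReal_mul (by positivity)]
        congr 1
        ring

/-- The two contraction estimates have the same averages. -/
lemma lintegral_palmRow_contract {D : (ℤ → Bool) → ℝ} {C d : ℝ} (hC : 0 ≤ C)
    (hD : ∫⁻ b, ENNReal.ofReal (D b) ∂palmRow = ENNReal.ofReal (4 / 3 * d)) :
    ∫⁻ b, ENNReal.ofReal (9 / 16 * C) * ENNReal.ofReal (D b) ∂palmRow =
      ENNReal.ofReal (3 / 4 * C * d) := by
  rw [lintegral_const_mul' _ _ ENNReal.ofReal_ne_top, hD, ← ENNReal.ofReal_mul (by positivity)]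
  congr 1
  ring

/-- Merging of clusters, with mass multiplied by `3 / 4`. -/
def mergeMass (b : ℤ → Bool) (l : ℤ → ℝ) (j : ℤ) : ℝ := 3 / 4 * merge b l j

lemma measurable_mergeMass :
    Measurable fun p : (ℤ → Bool) × (ℤ → ℝ) => mergeMass p.1 p.2 := by
  refine measurable_pi_lambda _ fun j => ?_
  exact ((measurable_pi_apply j).comp (measurable_merge measurable_fst measurable_snd)).const_mul _

lemma thin_lattice_sub (b : ℤ → Bool) (i j : ℤ) :
    thin b lattice j - thin b lattice i = 3 / 4 * ((occIdx b j - occIdx b i : ℤ) : ℝ) := by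
  simp only [thin, lattice]; push_cast; ring

/-- The factor is 3/4 = 9/16 · 4/3: the squared scale times the mean number of old gaps per new one.
The image of the lattice is 3/4 of the occupied indices, so `start` has the constant 9/16 · 4/9 =
1/4. -/
lemma contracting_thin : Contracting thin where
  measurable := measurable_thin measurable_fst measurable_snd
  sub b y z := by ext j; simp only [thin, Pi.sub_apply]; ring
  zero b y := thin_zero y
  contract P _ Φ C hΦ i j hij :=
    (lintegral_mono fun b => lintegral_thin_sq_le hΦ b hij).trans_eq
      (lintegral_palmRow_contract hΦ.nonneg (lintegral_palmRow_occIdx hij))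
  start := by
    refine ⟨1 / 4, (measurable_thin measurable_id measurable_const).sub_const _, by norm_num,
      fun i j hij => ?_⟩
    have e : ∀ b, ENNReal.ofReal (((thin b lattice - lattice) j - (thin b lattice - lattice) i) ^ 2)
        = ENNReal.ofReal (9 / 16) *
          ENNReal.ofReal (((occIdx b j - occIdx b i : ℤ) - 4 / 3 * ((j : ℝ) - i)) ^ 2) := fun b => by
      rw [← ENNReal.ofReal_mul (by norm_num)]
      congr 1
      have := thin_lattice_sub b i j
      simp only [Pi.sub_apply]
      rw [show thin b lattice j - lattice j - (thin b lattice i - lattice i) =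
        (thin b lattice j - thin b lattice i) - (lattice j - lattice i) by ring, this]
      simp only [lattice]
      ring
    simp only [e]
    rw [lintegral_const_mul' _ _ ENNReal.ofReal_ne_top]
    calc _ ≤ ENNReal.ofReal (9 / 16) * ENNReal.ofReal (4 / 9 * ((j : ℝ) - i)) := by
          gcongr; exact lintegral_palmRow_sq_occIdx_sub hij
      _ = _ := by rw [← ENNReal.ofReal_mul (by norm_num)]; congr 1; ring

/-- Fluctuations of the number of old points in consecutive clusters. -/
lemma lintegral_palmRow_sq_firstPt_sub {i j : ℤ} (hij : i ≤ j) :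
    ∫⁻ b, ENNReal.ofReal (((firstPt b (occIdx b j) - firstPt b (occIdx b i) : ℤ) -
      4 / 3 * ((j : ℝ) - i)) ^ 2) ∂palmRow ≤ ENNReal.ofReal (3 * ((j : ℝ) - i)) := by
  rcases hij.eq_or_lt with rfl | hlt
  · simp
  have hlt' : (i : ℝ) + 1 ≤ j := by exact_mod_cast hlt
  have hm : Measurable fun b => ENNReal.ofReal
      (((occIdx b j - occIdx b i : ℤ) - 4 / 3 * ((j : ℝ) - i)) ^ 2) :=
    ENNReal.measurable_ofReal.comp (((measurable_from_top.comp
      ((measurable_occIdx measurable_id j).sub (measurable_occIdx measurable_id i))).sub_const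
        _).pow_const 2)
  -- Replacing `occIdx` by `firstPt` changes the count by some d with |d| ≤ 1. Then (x + d)² ≤ 2x² +
  -- 2, and 2 · 4/9 + 2 ≤ 3 suffices since `j - i` is at least one.
  calc _ ≤ ∫⁻ b, (ENNReal.ofReal 2 * ENNReal.ofReal
          (((occIdx b j - occIdx b i : ℤ) - 4 / 3 * ((j : ℝ) - i)) ^ 2) + ENNReal.ofReal 2)
          ∂palmRow := by
        refine lintegral_mono fun b => ?_
        rw [← ENNReal.ofReal_mul (by norm_num), ← ENNReal.ofReal_add (by positivity) (by norm_num)]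
        refine ENNReal.ofReal_le_ofReal ?_
        have h1 : (occIdx b j : ℝ) ≤ firstPt b (occIdx b j) := by exact_mod_cast le_firstPt _
        have h2 : (firstPt b (occIdx b j) : ℝ) ≤ occIdx b j + 1 := by exact_mod_cast firstPt_le _
        have h3 : (occIdx b i : ℝ) ≤ firstPt b (occIdx b i) := by exact_mod_cast le_firstPt _
        have h4 : (firstPt b (occIdx b i) : ℝ) ≤ occIdx b i + 1 := by exact_mod_cast firstPt_le _
        push_cast
        set x : ℝ := (occIdx b j : ℝ) - occIdx b i - 4 / 3 * ((j : ℝ) - i)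
        set d : ℝ := (firstPt b (occIdx b j) - occIdx b j : ℝ) - (firstPt b (occIdx b i) - occIdx b i)
        have hd : d ^ 2 ≤ 1 := by
          rw [sq_le_one_iff_abs_le_one, abs_le]; constructor <;> simp only [d] <;> linarith
        rw [show (firstPt b (occIdx b j) : ℝ) - firstPt b (occIdx b i) - 4 / 3 * ((j : ℝ) - i) =
          x + d by simp only [x, d]; ring]
        nlinarith [sq_nonneg (x - d)]
    _ ≤ ENNReal.ofReal 2 * ENNReal.ofReal (4 / 9 * ((j : ℝ) - i)) + ENNReal.ofReal 2 := by
        rw [lintegral_add_left (hm.const_mul _), lintegral_const_mul _ hm, lintegral_const,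
          measure_univ, mul_one]
        gcongr
        exact lintegral_palmRow_sq_occIdx_sub hij
    _ ≤ _ := by
        rw [← ENNReal.ofReal_mul (by norm_num), ← ENNReal.ofReal_add (by nlinarith) (by norm_num)]
        exact ENNReal.ofReal_le_ofReal (by linarith)

lemma contracting_mergeMass : Contracting mergeMass where
  measurable := measurable_mergeMass
  sub b y z := by ext j; simp only [mergeMass, merge, Pi.sub_apply]; ring
  zero b y := by simp [mergeMass, merge]
  contract P _ Φ C hΦ i j hij :=
    (lintegral_mono fun b => lintegral_merge_sq_le hΦ b hij).trans_eq
      (lintegral_palmRow_contract hΦ.nonneg (lintegral_palmRow_firstPt hij))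
  start := by
    refine ⟨27 / 16, (measurable_mergeMass.comp measurable_prodMk_right).sub_const _,
      by norm_num, fun i j hij => ?_⟩
    have e : ∀ b, ENNReal.ofReal
        (((mergeMass b lattice - lattice) j - (mergeMass b lattice - lattice) i) ^ 2)
        = ENNReal.ofReal (9 / 16) *
          ENNReal.ofReal (((firstPt b (occIdx b j) - firstPt b (occIdx b i) : ℤ) -
            4 / 3 * ((j : ℝ) - i)) ^ 2) := fun b => by
      rw [← ENNReal.ofReal_mul (by norm_num)]
      congr 1
      simp only [Pi.sub_apply, mergeMass, merge, lattice]
      push_cast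
      ring
    simp only [e]
    rw [lintegral_const_mul' _ _ ENNReal.ofReal_ne_top]
    calc _ ≤ ENNReal.ofReal (9 / 16) * ENNReal.ofReal (3 * ((j : ℝ) - i)) := by
          gcongr; exact lintegral_palmRow_sq_firstPt_sub hij
      _ = _ := by rw [← ENNReal.ofReal_mul (by norm_num)]; congr 1; ring

/-! ### Higher moments of the cluster sizes -/

/-- Second-order bound for powers. -/
lemma add_pow_le_taylor (p : ℕ) : ∃ C : ℝ, 0 ≤ C ∧ ∀ n m r : ℝ, 0 ≤ n → 0 ≤ m → m ≤ 2 * n →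
    |r| ≤ n → 0 ≤ m + r →
    (m + r) ^ (p + 2) ≤ m ^ (p + 2) + (p + 2) * m ^ (p + 1) * r + C * n ^ p * r ^ 2 := by
  induction p with
  | zero => exact ⟨1, by norm_num, fun n m r _ _ _ _ _ => by push_cast; nlinarith⟩
  | succ p ih =>
    obtain ⟨C, hC, h⟩ := ih
    -- The bound for `p` is multiplied by m + r ≤ 3n. The additional quadratic term (p + 2) m^(p+1)
    -- r² is controlled by m ≤ 2n.
    refine ⟨3 * C + (p + 2) * 2 ^ (p + 1), by positivity, fun n m r hn hm hmn hr hs => ?_⟩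
    have h1 := h n m r hn hm hmn hr hs
    obtain ⟨hr1, hr2⟩ := abs_le.1 hr
    have h2 := mul_le_mul_of_nonneg_right h1 hs
    have hmp : m ^ (p + 1) ≤ (2 * n) ^ (p + 1) := pow_le_pow_left₀ hm hmn _
    have h4 : C * n ^ p * r ^ 2 * (m + r) ≤ C * n ^ p * r ^ 2 * (3 * n) := by
      gcongr; linarith
    calc (m + r) ^ (p + 1 + 2) = (m + r) ^ (p + 2) * (m + r) := by ring
      _ ≤ _ := h2
      _ = m ^ (p + 3) + (p + 3) * m ^ (p + 2) * r + (p + 2) * m ^ (p + 1) * r ^ 2 +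
          C * n ^ p * r ^ 2 * (m + r) := by ring
      _ ≤ m ^ (p + 3) + (p + 3) * m ^ (p + 2) * r + (p + 2) * (2 * n) ^ (p + 1) * r ^ 2 +
          C * n ^ p * r ^ 2 * (3 * n) := by gcongr
      _ = _ := by push_cast; ring

/-- The number of old points in the clusters `i, …, j - 1`. -/
def oldPts (i j : ℤ) (b : ℤ → Bool) : ℝ :=
  ((firstPt b (occIdx b j) - firstPt b (occIdx b i) : ℤ) : ℝ)

lemma measurable_oldPts (i j : ℤ) : Measurable (oldPts i j) :=
  measurable_from_top.comp ((measurable_firstPt_occIdx j).sub (measurable_firstPt_occIdx i))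

lemma oldPts_bounds {i j : ℤ} (hij : i ≤ j) (b : ℤ → Bool) :
    (j : ℝ) - i ≤ oldPts i j b ∧ oldPts i j b ≤ 2 * ((j : ℝ) - i) := by
  have key : j - i ≤ firstPt b (occIdx b j) - firstPt b (occIdx b i) ∧
      firstPt b (occIdx b j) - firstPt b (occIdx b i) ≤ 2 * (j - i) := by
    obtain ⟨n, rfl⟩ := Int.le.dest hij
    induction n with
    | zero => simp
    | succ n ih =>
      have h1 := ih (by omega)
      have h2 := firstPt_occIdx_lt (b := b) (i + n)
      have h3 := occIdx_succ (b := b) (i + n)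
      have h4 := le_firstPt (b := b) (occIdx b (i + n))
      have h5 := firstPt_nextOcc (b := b) (occIdx b (i + n))
      rw [← h3] at h5
      have h6 : firstPt b (occIdx b (i + n + 1)) ≤ occIdx b (i + n) + 2 := by
        rw [h5]; split_ifs <;> omega
      push_cast
      rw [← add_assoc]
      omega
  unfold oldPts
  exact ⟨by exact_mod_cast key.1, by exact_mod_cast key.2⟩

lemma integrable_oldPts_comp {i j : ℤ} (hij : i ≤ j) {f : ℝ → ℝ} (hf : Continuous f) :
    Integrable (fun b => f (oldPts i j b)) palmRow := by
  obtain ⟨C, hC⟩ := (isCompact_Icc (a := (j : ℝ) - i) (b := 2 * ((j : ℝ) - i))).exists_bound_of_continuousOn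
    hf.continuousOn
  exact Integrable.of_bound (hf.measurable.comp (measurable_oldPts i j)).aestronglyMeasurable C
    (ae_of_all _ fun b => hC _ (oldPts_bounds hij b))

lemma integral_oldPts {i j : ℤ} (hij : i ≤ j) :
    ∫ b, oldPts i j b ∂palmRow = 4 / 3 * ((j : ℝ) - i) := by
  have h0 : (0 : ℝ) ≤ (j : ℝ) - i := by simpa using (Int.cast_le (R := ℝ)).2 hij
  rw [integral_eq_lintegral_of_nonneg_ae
    (ae_of_all _ fun b => h0.trans (oldPts_bounds hij b).1)
    (measurable_oldPts i j).aestronglyMeasurable]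
  unfold oldPts
  rw [lintegral_palmRow_firstPt hij, ENNReal.toReal_ofReal (by positivity)]

lemma integral_oldPts_sub_sq_le {i j : ℤ} (hij : i ≤ j) :
    ∫ b, (oldPts i j b - 4 / 3 * ((j : ℝ) - i)) ^ 2 ∂palmRow ≤ 3 * ((j : ℝ) - i) := by
  have h0 : (0 : ℝ) ≤ (j : ℝ) - i := by simpa using (Int.cast_le (R := ℝ)).2 hij
  rw [integral_eq_lintegral_of_nonneg_ae (ae_of_all _ fun b => sq_nonneg _)
    (((measurable_oldPts i j).sub_const _).pow_const 2).aestronglyMeasurable]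
  exact ENNReal.toReal_le_of_le_ofReal (by positivity) (lintegral_palmRow_sq_firstPt_sub hij)

/-- Expansion around the mean 4n/3: the linear term averages to zero and the quadratic one to at
most a multiple of n^p · 3n. The leading coefficient is one because 3/4 · 4/3 = 1. -/
lemma exists_lintegral_oldPts_pow_le (p : ℕ) : ∃ C : ℝ, 0 ≤ C ∧ ∀ i j : ℤ, i ≤ j →
    ∫⁻ b, ENNReal.ofReal ((3 / 4 * oldPts i j b) ^ (p + 2)) ∂palmRow ≤
      ENNReal.ofReal (((j : ℝ) - i) ^ (p + 2) + C * ((j : ℝ) - i) ^ (p + 1)) := by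
  obtain ⟨C, hC, h⟩ := add_pow_le_taylor p
  refine ⟨3 * C, by positivity, fun i j hij => ?_⟩
  have h0 : (0 : ℝ) ≤ (j : ℝ) - i := by simpa using (Int.cast_le (R := ℝ)).2 hij
  have hb := oldPts_bounds hij
  have hpos : ∀ b, 0 ≤ oldPts i j b := fun b => h0.trans (hb b).1
  rw [← ofReal_integral_eq_lintegral_ofReal
    (integrable_oldPts_comp hij (f := fun x => (3 / 4 * x) ^ (p + 2)) (by fun_prop))
    (ae_of_all _ fun b => pow_nonneg (mul_nonneg (by norm_num) (hpos b)) _)]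
  refine ENNReal.ofReal_le_ofReal ?_
  set n : ℝ := (j : ℝ) - i with hn
  have hle : ∀ b, (3 / 4 * oldPts i j b) ^ (p + 2) ≤
      (3 / 4) ^ (p + 2) * ((4 / 3 * n) ^ (p + 2) + (p + 2) * (4 / 3 * n) ^ (p + 1) *
        (oldPts i j b - 4 / 3 * n) + C * n ^ p * (oldPts i j b - 4 / 3 * n) ^ 2) := fun b => by
    have h1 := h n (4 / 3 * n) (oldPts i j b - 4 / 3 * n) h0 (by positivity) (by linarith)
      (abs_le.2 ⟨by linarith [(hb b).1], by linarith [(hb b).2]⟩)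
      (by rw [add_sub_cancel]; exact hpos b)
    rw [add_sub_cancel] at h1
    rw [mul_pow]
    gcongr
  have I1 : Integrable (fun b => oldPts i j b - 4 / 3 * n) palmRow :=
    integrable_oldPts_comp hij (f := fun x => x - 4 / 3 * n) (by fun_prop)
  have I2 : Integrable (fun b => (oldPts i j b - 4 / 3 * n) ^ 2) palmRow :=
    integrable_oldPts_comp hij (f := fun x => (x - 4 / 3 * n) ^ 2) (by fun_prop)
  have I3 : Integrable (fun b => (p + 2) * (4 / 3 * n) ^ (p + 1) * (oldPts i j b - 4 / 3 * n))
      palmRow := I1.const_mul _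
  have I4 : Integrable (fun b => C * n ^ p * (oldPts i j b - 4 / 3 * n) ^ 2) palmRow :=
    I2.const_mul _
  have I5 : Integrable (fun b => (4 / 3 * n) ^ (p + 2) +
      (p + 2) * (4 / 3 * n) ^ (p + 1) * (oldPts i j b - 4 / 3 * n)) palmRow :=
    (integrable_const _).add I3
  have hmean : ∫ b, (oldPts i j b - 4 / 3 * n) ∂palmRow = 0 := by
    rw [integral_sub (integrable_oldPts_comp hij (f := fun x => x) continuous_id)
      (integrable_const _), integral_oldPts hij]
    simp [hn]
  calc ∫ b, (3 / 4 * oldPts i j b) ^ (p + 2) ∂palmRow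
      ≤ ∫ b, (3 / 4) ^ (p + 2) * ((4 / 3 * n) ^ (p + 2) + (p + 2) * (4 / 3 * n) ^ (p + 1) *
        (oldPts i j b - 4 / 3 * n) + C * n ^ p * (oldPts i j b - 4 / 3 * n) ^ 2) ∂palmRow :=
        integral_mono (integrable_oldPts_comp hij (f := fun x => (3 / 4 * x) ^ (p + 2))
          (by fun_prop)) ((I5.add I4).const_mul _) hle
    _ = (3 / 4) ^ (p + 2) * ((4 / 3 * n) ^ (p + 2) +
        C * n ^ p * ∫ b, (oldPts i j b - 4 / 3 * n) ^ 2 ∂palmRow) := by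
        rw [integral_const_mul, integral_add I5 I4, integral_add (integrable_const _) I3,
          integral_const_mul, integral_const_mul, hmean]
        simp
    _ ≤ (3 / 4) ^ (p + 2) * ((4 / 3 * n) ^ (p + 2) + C * n ^ p * (3 * n)) := by
        gcongr; exact integral_oldPts_sub_sq_le hij
    _ = n ^ (p + 2) + (3 / 4) ^ (p + 2) * (3 * C * n ^ (p + 1)) := by
        rw [mul_add, ← mul_pow, ← mul_assoc]; norm_num; ring
    _ ≤ n ^ (p + 2) + 1 * (3 * C * n ^ (p + 1)) := by
        gcongr; exact pow_le_one₀ (by norm_num) (by norm_num)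
    _ = _ := by ring

/-- A Lyapunov function for the moments of order `p + 1`. -/
lemma exists_lyapunov (p : ℕ) : ∃ v : ℝ → ℝ, Continuous v ∧ (∀ x, 0 ≤ x → x ^ (p + 1) ≤ v x) ∧
    ∀ i j : ℤ, i ≤ j → ∫⁻ b, ENNReal.ofReal ((3 / 4) ^ (p + 1) * v (oldPts i j b)) ∂palmRow ≤
      ENNReal.ofReal (v ((j : ℝ) - i)) := by
  induction p with
  | zero =>
    refine ⟨id, continuous_id, by simp, fun i j hij => ?_⟩
    have e : ∀ b, ENNReal.ofReal ((3 / 4) ^ (0 + 1) * id (oldPts i j b)) =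
        ENNReal.ofReal (3 / 4) * ENNReal.ofReal (oldPts i j b) := fun b => by
      rw [← ENNReal.ofReal_mul (by norm_num)]; simp
    simp only [e]
    rw [lintegral_const_mul' _ _ ENNReal.ofReal_ne_top]
    unfold oldPts
    rw [lintegral_palmRow_firstPt hij, ← ENNReal.ofReal_mul (by norm_num)]
    exact ENNReal.ofReal_le_ofReal (le_of_eq (by simp; ring))
  | succ p ih =>
    obtain ⟨v, hv, hpv, hvint⟩ := ih
    obtain ⟨C, hC, hK⟩ := exists_lintegral_oldPts_pow_le p
    have hv0 : ∀ x, 0 ≤ x → 0 ≤ v x := fun x hx => (pow_nonneg hx _).trans (hpv x hx)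
    -- The additional factor 3/4 at the higher order turns 4Cv into 3Cv. The difference Cv absorbs
    -- the error C n^(p+1), as v(n) ≥ n^(p+1).
    refine ⟨fun x => x ^ (p + 2) + 4 * C * v x, by fun_prop, fun x hx => ?_, fun i j hij => ?_⟩
    · have := hv0 x hx
      exact le_add_of_nonneg_right (by positivity)
    · have h0 : (0 : ℝ) ≤ (j : ℝ) - i := by simpa using (Int.cast_le (R := ℝ)).2 hij
      have hpos : ∀ b, 0 ≤ oldPts i j b := fun b => h0.trans (oldPts_bounds hij b).1
      have e : ∀ b, ENNReal.ofReal ((3 / 4) ^ (p + 1 + 1) *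
            (oldPts i j b ^ (p + 2) + 4 * C * v (oldPts i j b))) =
          ENNReal.ofReal ((3 / 4 * oldPts i j b) ^ (p + 2)) + ENNReal.ofReal (3 * C) *
            ENNReal.ofReal ((3 / 4) ^ (p + 1) * v (oldPts i j b)) := fun b => by
        have h1 := hpos b
        have h2 := hv0 _ h1
        rw [← ENNReal.ofReal_mul (by positivity), ← ENNReal.ofReal_add (by positivity)
          (by positivity)]
        congr 1
        ring
      simp only [e]
      have hm := measurable_oldPts i j
      rw [lintegral_add_left (by fun_prop), lintegral_const_mul' _ _ ENNReal.ofReal_ne_top]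
      have hvn := hpv _ h0
      have hvn0 := hv0 _ h0
      calc _ ≤ ENNReal.ofReal (((j : ℝ) - i) ^ (p + 2) + C * ((j : ℝ) - i) ^ (p + 1)) +
            ENNReal.ofReal (3 * C) * ENNReal.ofReal (v ((j : ℝ) - i)) := by
            gcongr
            · exact hK i j hij
            · exact hvint i j hij
        _ ≤ _ := by
            rw [← ENNReal.ofReal_mul (by positivity), ← ENNReal.ofReal_add (by positivity)
              (by positivity)]
            refine ENNReal.ofReal_le_ofReal ?_
            nlinarith [mul_le_mul_of_nonneg_left hvn hC]

/-- Given the outermost row, an increment of the new sequence is 3/4 times an increment of the inner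
one between fixed indices, `oldPts` apart. The bound by the Lyapunov function thus reproduces itself
for all pairs of indices at once. -/
lemma exists_moment_bound (p : ℕ) : ∃ M : ℝ, ∀ t,
    ∫⁻ s, ENNReal.ofReal ((iter mergeMass t s lattice 1) ^ (p + 1)) ∂palmPath ≤
      ENNReal.ofReal M := by
  obtain ⟨v, hv, hpv, hvint⟩ := exists_lyapunov p
  have key : ∀ t, ∀ i j : ℤ, i ≤ j → ∫⁻ s, ENNReal.ofReal
      ((iter mergeMass t s lattice j - iter mergeMass t s lattice i) ^ (p + 1)) ∂palmPath ≤
      ENNReal.ofReal (v ((j : ℝ) - i)) := fun t => by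
    induction t with
    | zero =>
      intro i j hij
      have h0 : (0 : ℝ) ≤ (j : ℝ) - i := by simpa using (Int.cast_le (R := ℝ)).2 hij
      simp only [iter, lattice, lintegral_const, measure_univ, mul_one]
      exact ENNReal.ofReal_le_ofReal (hpv _ h0)
    | succ t ih =>
      intro i j hij
      have hm := measurable_iter_lattice contracting_mergeMass t
      have hm1 : Measurable fun q : (ℤ → Bool) × (ℕ → ℤ → Bool) =>
          mergeMass q.1 (iter mergeMass t q.2 lattice) :=
        measurable_mergeMass.comp (measurable_fst.prodMk (hm.comp measurable_snd))
      have hm2 : ∀ k, Measurable fun q : (ℤ → Bool) × (ℕ → ℤ → Bool) =>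
          mergeMass q.1 (iter mergeMass t q.2 lattice) k := fun k =>
        (measurable_pi_apply k).comp hm1
      have h := lintegral_headTail measurePreserving_palmPath
        (f := fun b s => ENNReal.ofReal ((mergeMass b (iter mergeMass t s lattice) j -
          mergeMass b (iter mergeMass t s lattice) i) ^ (p + 1)))
        (ENNReal.measurable_ofReal.comp (((hm2 j).sub (hm2 i)).pow_const _))
      refine (le_of_eq h).trans ((lintegral_mono fun b => ?_).trans (hvint i j hij))
      have e : ∀ s, ENNReal.ofReal ((mergeMass b (iter mergeMass t s lattice) j -
          mergeMass b (iter mergeMass t s lattice) i) ^ (p + 1)) =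
          ENNReal.ofReal ((3 / 4) ^ (p + 1)) * ENNReal.ofReal
            ((iter mergeMass t s lattice (firstPt b (occIdx b j)) -
              iter mergeMass t s lattice (firstPt b (occIdx b i))) ^ (p + 1)) := fun s => by
        rw [← ENNReal.ofReal_mul (by positivity), ← mul_pow]
        simp only [mergeMass, merge]
        congr 2
        ring
      simp only [e]
      rw [lintegral_const_mul' _ _ ENNReal.ofReal_ne_top, ENNReal.ofReal_mul (by positivity)]
      gcongr
      refine (ih _ _ ((firstPt_occIdx_strictMono b).monotone hij)).trans (le_of_eq ?_)
      simp [oldPts]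
  refine ⟨v 1, fun t => ?_⟩
  have h := key t 0 1 (by norm_num)
  simpa [iter_zero_apply contracting_mergeMass] using h

/-! ### The limiting gap process -/

/-- The sequence lists, in increasing order, a configuration that is locally finite and unbounded
in both directions. -/
def Proper (y : ℤ → ℝ) : Prop :=
  StrictMono y ∧ Tendsto y atTop atTop ∧ Tendsto y atBot atBot

/-- A form with countably many conditions, for measurability. -/
lemma proper_iff {y : ℤ → ℝ} : Proper y ↔ (∀ i, y i < y (i + 1)) ∧ (∀ M : ℕ, ∃ n, (M : ℝ) ≤ y n) ∧
    ∀ M : ℕ, ∃ n, y n ≤ -(M : ℝ) := by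
  constructor
  · rintro ⟨h1, h2, h3⟩
    exact ⟨fun i => h1 (by omega), fun M => (h2.eventually_ge_atTop _).exists,
      fun M => (h3.eventually_le_atBot _).exists⟩
  · rintro ⟨h1, h2, h3⟩
    have h := strictMono_int_of_lt_succ h1
    refine ⟨h, tendsto_atTop_atTop.2 fun M => ?_, tendsto_atBot_atBot.2 fun M => ?_⟩
    · obtain ⟨N, hN⟩ := exists_nat_ge M
      obtain ⟨n, hn⟩ := h2 N
      exact ⟨n, fun k hk => (hN.trans hn).trans (h.monotone hk)⟩
    · obtain ⟨N, hN⟩ := exists_nat_ge (-M)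
      obtain ⟨n, hn⟩ := h3 N
      exact ⟨n, fun k hk => (h.monotone hk).trans (by linarith)⟩

lemma measurableSet_proper : MeasurableSet {y : ℤ → ℝ | Proper y} := by
  have e : {y : ℤ → ℝ | Proper y} = (⋂ i, {y | y i < y (i + 1)}) ∩
      ((⋂ M : ℕ, ⋃ n : ℤ, {y | (M : ℝ) ≤ y n}) ∩ ⋂ M : ℕ, ⋃ n : ℤ, {y | y n ≤ -(M : ℝ)}) := by
    ext y; simp [proper_iff]
  rw [e]
  refine MeasurableSet.inter (MeasurableSet.iInter fun i => ?_)
    (MeasurableSet.inter (MeasurableSet.iInter fun M => MeasurableSet.iUnion fun n => ?_)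
      (MeasurableSet.iInter fun M => MeasurableSet.iUnion fun n => ?_))
  · exact measurableSet_lt (measurable_pi_apply i) (measurable_pi_apply (i + 1))
  · exact measurableSet_le measurable_const (measurable_pi_apply n)
  · exact measurableSet_le (measurable_pi_apply n) measurable_const

/-- The law of a stationary gap process with mean gap one: a strictly increasing two-sided sequence
that vanishes at the index `0` and whose law does not depend on the index it is seen from. -/
structure IsGapLaw (m : Measure (ℤ → ℝ)) : Prop where
  isProb : IsProbabilityMeasure m
  proper : ∀ᵐ y ∂m, Proper y
  zero : ∀ᵐ y ∂m, y 0 = 0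
  invariant : ∀ n : ℤ, m.map (recenter n) = m
  mean : ∫⁻ y, ENNReal.ofReal (-y (-1)) ∂m = 1

lemma continuous_recenter (n : ℤ) : Continuous (recenter n : (ℤ → ℝ) → ℤ → ℝ) :=
  continuous_pi fun i => (continuous_apply (n + i)).sub (continuous_apply n)

lemma measurable_recenter_const (n : ℤ) : Measurable (recenter n : (ℤ → ℝ) → ℤ → ℝ) :=
  (continuous_recenter n).measurable

lemma continuous_thin (b : ℤ → Bool) : Continuous (thin b) := by
  unfold thin
  fun_prop

lemma recenter_lattice (n : ℤ) : recenter n lattice = lattice := by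
  ext i; simp [recenter, lattice]

/-- Limits of variables with equal laws have equal laws. -/
lemma map_eq_map_of_ae_tendsto {X E : Type*} [MeasurableSpace X] {P : Measure X}
    [IsProbabilityMeasure P] [TopologicalSpace E] [MeasurableSpace E] [BorelSpace E]
    [HasOuterApproxClosed E] {u v : ℕ → X → E} {U V : X → E}
    (hu : ∀ t, AEMeasurable (u t) P) (hv : ∀ t, AEMeasurable (v t) P)
    (hU : AEMeasurable U P) (hV : AEMeasurable V P)
    (huU : ∀ᵐ x ∂P, Tendsto (fun t => u t x) atTop (𝓝 (U x)))
    (hvV : ∀ᵐ x ∂P, Tendsto (fun t => v t x) atTop (𝓝 (V x)))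
    (h : ∀ t, P.map (u t) = P.map (v t)) : P.map U = P.map V := by
  have h1 := (tendstoInDistribution_of_ae_tendsto hu hU huU).tendsto
  have h2 := (tendstoInDistribution_of_ae_tendsto hv hV hvV).tendsto
  have e : (fun t => (⟨P.map (u t), Measure.isProbabilityMeasure_map (hu t)⟩ :
      ProbabilityMeasure E)) =
      fun t => ⟨P.map (v t), Measure.isProbabilityMeasure_map (hv t)⟩ :=
    funext fun t => Subtype.ext (h t)
  rw [e] at h1
  exact congrArg Subtype.val (tendsto_nhds_unique (X := ProbabilityMeasure E) h1 h2)

/-- For a fixed outer row the inner recentring index is a constant, and the induction hypothesis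
removes it. The shift of the outer row is then removed by `lintegral_palmRow_shift`. -/
lemma map_recenter_iter (n : ℤ) (t : ℕ) :
    palmPath.map (fun s => recenter n (iter thin t s lattice)) =
      palmPath.map (fun s => iter thin t s lattice) := by
  have hmt := fun t => measurable_iter_lattice contracting_thin t
  have key : ∀ (n : ℤ) (f : (ℤ → ℝ) → ℝ≥0∞), Measurable f →
      ∫⁻ s, f (recenter n (iter thin t s lattice)) ∂palmPath =
        ∫⁻ s, f (iter thin t s lattice) ∂palmPath := by
    induction t with
    | zero => intro n f _; simp [iter, recenter_lattice]
    | succ t ih =>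
      intro n f hf
      have hm1 : Measurable fun q : (ℤ → Bool) × (ℕ → ℤ → Bool) =>
          thin q.1 (iter thin t q.2 lattice) :=
        measurable_thin measurable_fst ((hmt t).comp measurable_snd)
      have hm2 : Measurable fun q : (ℤ → Bool) × (ℕ → ℤ → Bool) =>
          f (recenter n (thin q.1 (iter thin t q.2 lattice))) :=
        hf.comp ((measurable_recenter_const n).comp hm1)
      have h1 := lintegral_headTail measurePreserving_palmPath
        (f := fun b s => f (recenter n (thin b (iter thin t s lattice)))) hm2
      have h2 := lintegral_headTail measurePreserving_palmPath
        (f := fun b s => f (thin b (iter thin t s lattice))) (hf.comp hm1)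
      refine h1.trans (Eq.trans ?_ h2.symm)
      simp only [recenter_thin]
      have h3 : ∀ b, ∫⁻ s, f (thin (shift (occIdx b n) b)
          (recenter (occIdx b n) (iter thin t s lattice))) ∂palmPath =
          ∫⁻ s, f (thin (shift (occIdx b n) b) (iter thin t s lattice)) ∂palmPath := fun b =>
        ih (occIdx b n) (fun y => f (thin (shift (occIdx b n) b) y))
          (hf.comp (continuous_thin _).measurable)
      simp only [h3]
      exact lintegral_palmRow_shift n
        (f := fun b => ∫⁻ s, f (thin b (iter thin t s lattice)) ∂palmPath)
        (hf.comp hm1).lintegral_prod_right'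
  have hmr : Measurable fun s => recenter n (iter thin t s lattice) :=
    (measurable_recenter_const n).comp (hmt t)
  ext S hS
  rw [← lintegral_indicator_one hS, ← lintegral_indicator_one hS,
    lintegral_map (measurable_one.indicator hS) hmr,
    lintegral_map (measurable_one.indicator hS) (hmt t)]
  exact key n _ (measurable_one.indicator hS)

/-- Fatou's lemma for second moments. -/
lemma lintegral_sq_le_of_ae_tendsto {X : Type*} [MeasurableSpace X] {P : Measure X}
    {u : ℕ → X → ℝ} {U : X → ℝ} (hu : ∀ t, Measurable (u t))
    (h : ∀ᵐ x ∂P, Tendsto (fun t => u t x) atTop (𝓝 (U x))) {K : ℝ≥0∞}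
    (hK : ∀ t, ∫⁻ x, ENNReal.ofReal (u t x ^ 2) ∂P ≤ K) :
    ∫⁻ x, ENNReal.ofReal (U x ^ 2) ∂P ≤ K := by
  calc ∫⁻ x, ENNReal.ofReal (U x ^ 2) ∂P
      = ∫⁻ x, liminf (fun t => ENNReal.ofReal (u t x ^ 2)) atTop ∂P := by
        refine lintegral_congr_ae ?_
        filter_upwards [h] with x hx
        exact (ENNReal.tendsto_ofReal (hx.pow 2)).liminf_eq.symm
    _ ≤ liminf (fun t => ∫⁻ x, ENNReal.ofReal (u t x ^ 2) ∂P) atTop :=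
        lintegral_liminf_le fun t => ENNReal.measurable_ofReal.comp ((hu t).pow_const 2)
    _ ≤ liminf (fun _ : ℕ => K) atTop := liminf_le_liminf (Eventually.of_forall hK)
    _ = K := liminf_const K

/-! ### Properties of the limiting sequence -/

section Limit

variable {z : (ℕ → ℤ → Bool) → ℤ → ℝ}

/-- Fatou's lemma carries the uniform bound of the iterates over to the limit. -/
lemma diffusive_limit (hzm : Measurable z)
    (hz : ∀ᵐ s ∂palmPath, Tendsto (fun t => iter thin t s lattice) atTop (𝓝 (z s))) :
    ∃ C, Diffusive palmPath (fun s => z s - lattice) C := by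
  obtain ⟨C, hC⟩ := diffusive_iter_sub_lattice contracting_thin
  refine ⟨C, hzm.sub_const _, (hC 0).nonneg, fun i j hij => ?_⟩
  refine lintegral_sq_le_of_ae_tendsto
    (u := fun t s => (iter thin t s lattice - lattice) j - (iter thin t s lattice - lattice) i)
    (fun t => ?_) ?_ fun t => (hC t).bound i j hij
  · exact ((measurable_pi_apply j).comp (hC t).measurable).sub
      ((measurable_pi_apply i).comp (hC t).measurable)
  · filter_upwards [hz] with s hs
    rw [tendsto_pi_nhds] at hs
    exact ((hs j).sub_const _).sub ((hs i).sub_const _)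

lemma iter_thin_strictMono (t : ℕ) (s : ℕ → ℤ → Bool) {y : ℤ → ℝ} (hy : StrictMono y) :
    StrictMono (iter thin t s y) := by
  induction t generalizing s with
  | zero => exact hy
  | succ t ih => exact thin_strictMono (ih _)

lemma lattice_strictMono : StrictMono lattice := fun i j h => by
  simpa [lattice] using h

lemma ae_limit_monotone
    (hz : ∀ᵐ s ∂palmPath, Tendsto (fun t => iter thin t s lattice) atTop (𝓝 (z s))) :
    ∀ᵐ s ∂palmPath, Monotone (z s) := by
  filter_upwards [hz] with s hs i j hij
  rw [tendsto_pi_nhds] at hs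
  exact le_of_tendsto_of_tendsto' (hs i) (hs j) fun t =>
    (iter_thin_strictMono t s lattice_strictMono).monotone hij

lemma ae_limit_zero
    (hz : ∀ᵐ s ∂palmPath, Tendsto (fun t => iter thin t s lattice) atTop (𝓝 (z s))) :
    ∀ᵐ s ∂palmPath, z s 0 = 0 := by
  filter_upwards [hz] with s hs
  rw [tendsto_pi_nhds] at hs
  have h := hs 0
  simp only [iter_zero_apply contracting_thin] at h
  exact tendsto_nhds_unique h tendsto_const_nhds |>.symm ▸ rfl

lemma measurePreserving_tail : MeasurePreserving tail palmPath palmPath :=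
  measurePreserving_snd.comp measurePreserving_palmPath

/-- Fixed-point equation: along the iterates the outermost row does not change, and `thin` is
continuous for fixed coins. -/
lemma ae_limit_eq_thin
    (hz : ∀ᵐ s ∂palmPath, Tendsto (fun t => iter thin t s lattice) atTop (𝓝 (z s))) :
    ∀ᵐ s ∂palmPath, z s = thin (s 0) (z (tail s)) := by
  filter_upwards [hz, measurePreserving_tail.quasiMeasurePreserving.ae hz] with s hs hs'
  have h1 := ((continuous_thin (s 0)).tendsto _).comp hs'
  have h2 := hs.comp (tendsto_add_atTop_nat 1)
  exact tendsto_nhds_unique h2 h1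

/-- Put k = `occIdx b n` ≥ n. Equal midpoints of the gaps 0 and k mean y k + y (k + 1) = y 1, and y
k ≥ y 1 leaves y (k + 1) ≤ 0. Monotonicity gives the claim up to n + 1 ≤ k + 1. -/
lemma eq_zero_of_thin_eq_zero {b : ℤ → Bool} {y : ℤ → ℝ} (hb : Occ b 0) (hy : Monotone y)
    (h0 : y 0 = 0) {n : ℤ} (hn : 1 ≤ n) (h : thin b y n = 0) : y (n + 1) = 0 := by
  simp only [thin, occIdx_zero hb, zero_add, h0] at h
  have h1 := sub_le_occIdx_sub (b := b) (show (0 : ℤ) ≤ n by omega)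
  rw [occIdx_zero hb] at h1
  have h2 := hy (show (0 : ℤ) ≤ 1 by norm_num)
  have h3 := hy (show (1 : ℤ) ≤ occIdx b n by omega)
  have h4 := hy (show n + 1 ≤ occIdx b n + 1 by omega)
  have h5 := hy (show (1 : ℤ) ≤ n + 1 by omega)
  have h6 := hy (show occIdx b n ≤ occIdx b n + 1 by omega)
  linarith

/-- A coincidence of the points 0 and n forces one of the points 0 and n + 1 in the inner limit,
which has the same law. So the probability of a coincidence of 0 and 1 is at most that of 0 and n
for every n, and the latter is at most C/n by the variance bound. -/
lemma measure_limit_eq_zero (hzm : Measurable z)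
    (hz : ∀ᵐ s ∂palmPath, Tendsto (fun t => iter thin t s lattice) atTop (𝓝 (z s))) :
    palmPath {s | z s 1 = 0} = 0 := by
  have hS : ∀ n : ℤ, MeasurableSet {s | z s n = 0} := fun n =>
    (measurable_pi_apply n).comp hzm (measurableSet_singleton 0)
  have hstep : ∀ n : ℕ, palmPath {s | z s (n + 1 : ℕ) = 0} ≤
      palmPath {s | z s (n + 1 + 1 : ℕ) = 0} := fun n => by
    rw [← measurePreserving_tail.measure_preimage (hS (n + 1 + 1 : ℕ)).nullMeasurableSet]
    have hocc : ∀ᵐ s ∂palmPath, Occ (s 0) 0 :=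
      (measurePreserving_eval_infinitePi (fun _ : ℕ => palmRow) 0).quasiMeasurePreserving.ae
        ae_palmRow_occ
    refine measure_mono_ae ?_
    filter_upwards [ae_limit_eq_thin hz, hocc,
      measurePreserving_tail.quasiMeasurePreserving.ae (ae_limit_monotone hz),
      measurePreserving_tail.quasiMeasurePreserving.ae (ae_limit_zero hz)] with s h1 h2 h3 h4 h5
    change z s (n + 1 : ℕ) = 0 at h5
    change z (tail s) (n + 1 + 1 : ℕ) = 0
    rw [h1] at h5
    exact eq_zero_of_thin_eq_zero h2 h3 h4 (by push_cast; omega) h5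
  have hmono : ∀ n : ℕ, palmPath {s | z s 1 = 0} ≤ palmPath {s | z s (n + 1 : ℕ) = 0} := fun n => by
    induction n with
    | zero => simp
    | succ n ih => exact ih.trans (hstep n)
  obtain ⟨C, hC⟩ := diffusive_limit hzm hz
  have hbound : ∀ n : ℕ, palmPath {s | z s 1 = 0} ≤ ENNReal.ofReal (C * (1 / ((n : ℝ) + 1))) :=
    fun n => by
    refine (hmono n).trans ?_
    have h1 := hC.bound 0 (n + 1 : ℕ) (by omega)
    have hpos : (0 : ℝ) < ((n + 1 : ℕ) : ℝ) ^ 2 := by positivity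
    have h2 : ENNReal.ofReal (((n + 1 : ℕ) : ℝ) ^ 2) * palmPath {s | z s (n + 1 : ℕ) = 0} ≤
        ENNReal.ofReal (C * (n + 1 : ℕ)) := by
      refine le_trans ?_ (h1.trans (by simp))
      rw [← setLIntegral_const, ← lintegral_indicator (hS _)]
      refine lintegral_mono_ae ?_
      filter_upwards [ae_limit_zero hz] with s hs0
      by_cases hs : z s (n + 1 : ℕ) = 0
      · rw [indicator_of_mem (by exact hs)]
        refine ENNReal.ofReal_le_ofReal (le_of_eq ?_)
        simp only [Pi.sub_apply, hs, hs0, lattice]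
        push_cast; ring
      · rw [indicator_of_notMem (by exact hs)]
        exact zero_le
    rw [mul_comm, ← ENNReal.le_div_iff_mul_le (by left; simpa using hpos.ne')
      (by left; simp), ← ENNReal.ofReal_div_of_pos hpos] at h2
    refine h2.trans (ENNReal.ofReal_le_ofReal (le_of_eq ?_))
    push_cast
    field_simp
  have hlim : Tendsto (fun n : ℕ => ENNReal.ofReal (C * (1 / ((n : ℝ) + 1)))) atTop (𝓝 0) := by
    have := ENNReal.tendsto_ofReal ((tendsto_one_div_add_atTop_nhds_zero_nat (𝕜 := ℝ)).const_mul C)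
    simpa using this
  exact le_antisymm (ge_of_tendsto' hlim hbound) zero_le

lemma map_recenter_limit (hzm : Measurable z)
    (hz : ∀ᵐ s ∂palmPath, Tendsto (fun t => iter thin t s lattice) atTop (𝓝 (z s))) (n : ℤ) :
    (palmPath.map z).map (recenter n) = palmPath.map z := by
  rw [Measure.map_map (measurable_recenter_const n) hzm]
  refine map_eq_map_of_ae_tendsto (u := fun t s => recenter n (iter thin t s lattice))
    (v := fun t s => iter thin t s lattice)
    (fun t => ((measurable_recenter_const n).comp
      (measurable_iter_lattice contracting_thin t)).aemeasurable)
    (fun t => (measurable_iter_lattice contracting_thin t).aemeasurable)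
    ((measurable_recenter_const n).comp hzm).aemeasurable hzm.aemeasurable ?_ hz
    (map_recenter_iter n)
  filter_upwards [hz] with s hs
  exact ((continuous_recenter n).tendsto _).comp hs

lemma ae_limit_strictMono (hzm : Measurable z)
    (hz : ∀ᵐ s ∂palmPath, Tendsto (fun t => iter thin t s lattice) atTop (𝓝 (z s))) :
    ∀ᵐ s ∂palmPath, StrictMono (z s) := by
  have h1 : ∀ k : ℤ, ∀ᵐ s ∂palmPath, recenter k (z s) 1 ≠ 0 := fun k => by
    have hS : MeasurableSet {y : ℤ → ℝ | y 1 = 0} :=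
      measurable_pi_apply (X := fun _ : ℤ => ℝ) 1 (measurableSet_singleton 0)
    have h2 := congrArg (fun m => m {y : ℤ → ℝ | y 1 = 0}) (map_recenter_limit hzm hz k)
    beta_reduce at h2
    rw [Measure.map_apply (measurable_recenter_const k) hS,
      Measure.map_apply hzm (measurable_recenter_const k hS), Measure.map_apply hzm hS] at h2
    have h3 := measure_limit_eq_zero hzm hz
    rw [ae_iff]
    simp only [not_not]
    exact h2.trans h3
  filter_upwards [ae_limit_monotone hz, ae_all_iff.2 h1] with s h2 h3
  refine strictMono_int_of_lt_succ fun k => lt_of_le_of_ne (h2 (by omega)) fun h => h3 k ?_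
  simp [recenter, h]

/-- A law of large numbers along powers of two, where the variances C 2^k / 4^k are summable. Both
signs of `ε` together give unboundedness in both directions. -/
lemma ae_limit_tendsto (hzm : Measurable z)
    (hz : ∀ᵐ s ∂palmPath, Tendsto (fun t => iter thin t s lattice) atTop (𝓝 (z s))) (ε : ℤ)
    (hε : |(ε : ℝ)| = 1) :
    ∀ᵐ s ∂palmPath, Tendsto (fun k : ℕ => z s (ε * 2 ^ k) / 2 ^ k) atTop (𝓝 ε) := by
  obtain ⟨C, hC⟩ := diffusive_limit hzm hz
  have hC0 := hC.nonneg
  have h : ∀ᵐ s ∂palmPath, Summable fun k : ℕ =>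
      ((z s (ε * 2 ^ k) - z s 0) - ε * 2 ^ k) / 2 ^ k := by
    refine ae_summable_of_sq_le (fun k => ?_) hC0 fun k => ?_
    · exact ((((measurable_pi_apply _).comp hzm).sub ((measurable_pi_apply _).comp hzm)).sub_const
        _).div_const _
    · have e : ∀ s, ENNReal.ofReal ((((z s (ε * 2 ^ k) - z s 0) - ε * 2 ^ k) / 2 ^ k) ^ 2) =
          ENNReal.ofReal (1 / 4 ^ k) * ENNReal.ofReal ((((z s - lattice) (ε * 2 ^ k)) -
            (z s - lattice) 0) ^ 2) := fun s => by
        rw [← ENNReal.ofReal_mul (by positivity)]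
        congr 1
        simp only [Pi.sub_apply, lattice]
        rw [div_pow, ← pow_mul, mul_comm k 2, pow_mul]
        push_cast
        norm_num
        field_simp
        ring
      simp only [e]
      rw [lintegral_const_mul' _ _ ENNReal.ofReal_ne_top]
      have h2 := Diffusive.sq_le (P := palmPath) (C := C)
        (Φ := fun s n => (z s - lattice) n - (z s - lattice) 0)
        ⟨by have := hC.measurable; fun_prop, hC0, fun i j hij => by simpa using hC.bound i j hij⟩
        (fun s => by simp) (ε * 2 ^ k)
      calc _ ≤ ENNReal.ofReal (1 / 4 ^ k) * ENNReal.ofReal (C * |((ε * 2 ^ k : ℤ) : ℝ)|) := by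
            gcongr
        _ ≤ _ := by
            rw [← ENNReal.ofReal_mul (by positivity)]
            refine ENNReal.ofReal_le_ofReal ?_
            push_cast
            rw [abs_mul, hε, one_mul, abs_of_pos (by positivity)]
            have e4 : (4 : ℝ) ^ k = 2 ^ k * 2 ^ k := by rw [← mul_pow]; norm_num
            have h5 : (1 / 2 : ℝ) ^ k ≤ (3 / 4) ^ k :=
              pow_le_pow_left₀ (by norm_num) (by norm_num) k
            calc 1 / (4 : ℝ) ^ k * (C * 2 ^ k) = (1 / 2) ^ k * C := by
                  rw [e4, div_pow]; field_simp; simp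
              _ ≤ _ := by gcongr
  filter_upwards [h, ae_limit_zero hz] with s hs hs0
  have h1 := hs.tendsto_atTop_zero.add_const (ε : ℝ)
  rw [zero_add] at h1
  refine h1.congr fun k => ?_
  rw [hs0]
  field_simp
  ring

/-- By stationarity z n has mean n a, where a is the mean of z 1. Since variances are nonnegative,
n² (a - 1)² ≤ C n for all n, which forces a = 1. -/
lemma lintegral_limit_one (hzm : Measurable z)
    (hz : ∀ᵐ s ∂palmPath, Tendsto (fun t => iter thin t s lattice) atTop (𝓝 (z s))) :
    ∫⁻ s, ENNReal.ofReal (z s 1) ∂palmPath = 1 := by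
  obtain ⟨C, hC⟩ := diffusive_limit hzm hz
  have hC0 := hC.nonneg
  have hm : ∀ n : ℤ, Measurable fun s => z s n := fun n => (measurable_pi_apply n).comp hzm
  have hsq : ∀ n : ℕ, ∫⁻ s, ENNReal.ofReal ((z s n - n) ^ 2) ∂palmPath ≤
      ENNReal.ofReal (C * n) := fun n => by
    have h1 := hC.bound 0 n (by omega)
    refine le_trans (le_of_eq ?_) (h1.trans (by simp))
    refine lintegral_congr_ae ?_
    filter_upwards [ae_limit_zero hz] with s hs
    simp [hs, lattice]
  have hint2 : ∀ n : ℕ, Integrable (fun s => (z s n - n) ^ 2) palmPath := fun n =>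
    ⟨(((hm n).sub_const _).pow_const 2).aestronglyMeasurable, by
      rw [hasFiniteIntegral_iff_ofReal (ae_of_all _ fun s => sq_nonneg _)]
      exact (hsq n).trans_lt ENNReal.ofReal_lt_top⟩
  have hL2 : ∀ n : ℕ, MemLp (fun s => z s n - n) 2 palmPath := fun n =>
    (memLp_two_iff_integrable_sq ((hm n).sub_const _).aestronglyMeasurable).2 (hint2 n)
  have hint : ∀ n : ℕ, Integrable (fun s => z s n) palmPath := fun n => by
    refine (((hL2 n).integrable (by norm_num)).add (integrable_const (n : ℝ))).congr
      (ae_of_all _ fun s => ?_)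
    simp
  have hmean : ∀ n : ℕ, ∫ s, z s n ∂palmPath = n * ∫ s, z s 1 ∂palmPath := fun n => by
    induction n with
    | zero =>
      have : (fun s => z s (0 : ℕ)) =ᵐ[palmPath] fun _ => 0 := ae_limit_zero hz
      rw [integral_congr_ae this]; simp
    | succ n ih =>
      have h2 : ∫ s, recenter n (z s) 1 ∂palmPath = ∫ s, z s 1 ∂palmPath := by
        have h3 := congrArg (fun m => ∫ y : ℤ → ℝ, y 1 ∂m) (map_recenter_limit hzm hz n)
        beta_reduce at h3
        rw [Measure.map_map (measurable_recenter_const n) hzm,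
          integral_map ((measurable_recenter_const n).comp hzm).aemeasurable
            (measurable_pi_apply 1).aestronglyMeasurable,
          integral_map hzm.aemeasurable (measurable_pi_apply 1).aestronglyMeasurable] at h3
        exact h3
      have h4 : ∀ s, z s (n + 1 : ℕ) = z s n + recenter n (z s) 1 := fun s => by simp [recenter]
      have h5 : Integrable (fun s => recenter n (z s) 1) palmPath := by
        have := (hint (n + 1)).sub (hint n)
        refine this.congr (ae_of_all _ fun s => ?_)
        simp [recenter]
      simp only [h4]
      rw [integral_add (hint n) h5, ih, h2]
      push_cast; ring
  set a := ∫ s, z s 1 ∂palmPath with ha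
  have hvar : ∀ n : ℕ, (n * (a - 1)) ^ 2 ≤ C * n := fun n => by
    have h1 := variance_nonneg (fun s => z s n - n) palmPath
    rw [variance_eq_sub (hL2 n)] at h1
    have h2 : ∫ s, (z s n - n) ∂palmPath = n * (a - 1) := by
      rw [integral_sub (hint n) (integrable_const _), hmean n]
      simp; ring
    have h3 : ∫ s, (z s n - n) ^ 2 ∂palmPath ≤ C * n := by
      rw [integral_eq_lintegral_of_nonneg_ae (ae_of_all _ fun s => sq_nonneg _)
        (((hm n).sub_const _).pow_const 2).aestronglyMeasurable]
      exact ENNReal.toReal_le_of_le_ofReal (by positivity) (hsq n)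
    rw [h2] at h1
    have h4 : palmPath[(fun s => z s n - n) ^ 2] = ∫ s, (z s n - n) ^ 2 ∂palmPath := rfl
    rw [h4] at h1
    linarith
  have ha1 : a = 1 := by
    by_contra hne
    have hpos : 0 < (a - 1) ^ 2 := by positivity [sub_ne_zero.2 hne]
    obtain ⟨n, hn⟩ := exists_nat_gt (C / (a - 1) ^ 2)
    have hn0 : (0 : ℝ) < n := lt_of_le_of_lt (by positivity) hn
    rw [div_lt_iff₀ hpos] at hn
    have := hvar n
    nlinarith
  have hnn : 0 ≤ᵐ[palmPath] fun s => z s 1 := by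
    filter_upwards [ae_limit_monotone hz, ae_limit_zero hz] with s h1 h2
    have := h1 (show (0 : ℤ) ≤ 1 by norm_num)
    simpa [h2] using this
  rw [← ofReal_integral_eq_lintegral_ofReal (by simpa using hint 1) hnn, ← ha, ha1]
  simp

lemma ae_limit_proper (hzm : Measurable z)
    (hz : ∀ᵐ s ∂palmPath, Tendsto (fun t => iter thin t s lattice) atTop (𝓝 (z s))) :
    ∀ᵐ s ∂palmPath, Proper (z s) := by
  filter_upwards [ae_limit_strictMono hzm hz, ae_limit_tendsto hzm hz 1 (by simp),
    ae_limit_tendsto hzm hz (-1) (by simp)] with s h1 h2 h3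
  have hpow : Tendsto (fun k : ℕ => (2 : ℝ) ^ k) atTop atTop :=
    tendsto_pow_atTop_atTop_of_one_lt (by norm_num)
  refine proper_iff.2 ⟨fun i => h1 (by omega), fun M => ?_, fun M => ?_⟩
  · have h4 := h2.pos_mul_atTop (by simp) hpow
    obtain ⟨k, hk⟩ := (h4.eventually_ge_atTop (M : ℝ)).exists
    exact ⟨1 * 2 ^ k, by simpa using hk⟩
  · have h4 := h3.neg_mul_atTop (by simp) hpow
    obtain ⟨k, hk⟩ := (h4.eventually_le_atBot (-M : ℝ)).exists
    exact ⟨-1 * 2 ^ k, by simpa using hk⟩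

lemma isGapLaw_limit (hzm : Measurable z)
    (hz : ∀ᵐ s ∂palmPath, Tendsto (fun t => iter thin t s lattice) atTop (𝓝 (z s))) :
    IsGapLaw (palmPath.map z) where
  isProb := Measure.isProbabilityMeasure_map hzm.aemeasurable
  proper := (ae_map_iff hzm.aemeasurable measurableSet_proper).2 (ae_limit_proper hzm hz)
  zero := (ae_map_iff hzm.aemeasurable
    (measurable_pi_apply (X := fun _ : ℤ => ℝ) 0 (measurableSet_singleton 0))).2 (ae_limit_zero hz)
  invariant := map_recenter_limit hzm hz
  mean := by
    have hm : Measurable fun y : ℤ → ℝ => ENNReal.ofReal (y 1) := by fun_prop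
    have hm' : Measurable fun y : ℤ → ℝ => ENNReal.ofReal (-y (-1)) := by fun_prop
    -- Recentring at the index -1 turns the gap before the origin into the gap after it.
    have h := congrArg (fun m => ∫⁻ y : ℤ → ℝ, ENNReal.ofReal (y 1) ∂m)
      (map_recenter_limit hzm hz (-1))
    beta_reduce at h
    have hm2 : Measurable fun y : ℤ → ℝ => ENNReal.ofReal (recenter (-1) y 1) :=
      hm.comp (measurable_recenter_const _)
    rw [lintegral_map hm (measurable_recenter_const _), lintegral_map hm2 hzm, lintegral_map hm hzm,
      lintegral_limit_one hzm hz] at h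
    rw [lintegral_map hm' hzm, ← h]
    refine lintegral_congr_ae ?_
    filter_upwards [ae_limit_zero hz] with s hs
    simp [recenter, hs]

end Limit

/-! ### Enumerations of configurations -/

/-- The sequence is numbered such that its first nonnegative term has the index `0`. -/
def Anchored (x : ℤ → ℝ) : Prop := x (-1) < 0 ∧ 0 ≤ x 0

lemma measurableSet_anchored : MeasurableSet {x : ℤ → ℝ | Anchored x} :=
  (measurableSet_lt (measurable_pi_apply (X := fun _ : ℤ => ℝ) (-1)) measurable_const).inter
    (measurableSet_le measurable_const (measurable_pi_apply (X := fun _ : ℤ => ℝ) 0))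

/-- A translated sequence. -/
def translate (s : ℝ) (x : ℤ → ℝ) : ℤ → ℝ := fun i => x i + s

/-! ### Proper sequences, anchoring and renumbering -/

section Proper

variable {x : ℤ → ℝ}

lemma Proper.translate (hx : Proper x) (s : ℝ) : Proper (translate s x) := by
  refine ⟨fun i j h => by simpa [Clustering.translate] using hx.1 h, ?_, ?_⟩
  · exact tendsto_atTop_add_const_right _ _ hx.2.1
  · exact tendsto_atBot_add_const_right _ _ hx.2.2

lemma recenter_eq (k : ℤ) (x : ℤ → ℝ) : recenter k x = translate (-x k) (shift k x) := by
  ext i; simp [recenter, translate, shift, sub_eq_add_neg]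

lemma anchored_shift {k : ℤ} : Anchored (shift k x) ↔ x (k - 1) < 0 ∧ 0 ≤ x k := by
  simp [Anchored, shift, sub_eq_add_neg]

lemma Proper.exists_anchor (hx : Proper x) : ∃ k, Anchored (Clustering.shift k x) := by
  obtain ⟨k, hk, hmin⟩ := Int.exists_least_of_bdd (P := fun k => 0 ≤ x k)
    (by
      obtain ⟨n, hn⟩ := (hx.2.2.eventually_lt_atBot 0).exists
      refine ⟨n, fun z hz => ?_⟩
      by_contra! h
      exact absurd (hx.1.monotone h.le) (by linarith))
    (hx.2.1.eventually_ge_atTop 0).exists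
  refine ⟨k, anchored_shift.2 ⟨?_, hk⟩⟩
  by_contra! h
  have := hmin _ h
  omega

lemma Proper.anchor_unique (hx : Proper x) {k l : ℤ} (hk : Anchored (Clustering.shift k x))
    (hl : Anchored (Clustering.shift l x)) : k = l := by
  rw [anchored_shift] at hk hl
  have h1 : k - 1 < l := hx.1.lt_iff_lt.1 (hk.1.trans_le hl.2)
  have h2 : l - 1 < k := hx.1.lt_iff_lt.1 (hl.1.trans_le hk.2)
  omega

open Classical in
/-- The index of the first nonnegative term. -/
def anchor (x : ℤ → ℝ) : ℤ := if h : Proper x then h.exists_anchor.choose else 0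

lemma Proper.anchored (hx : Proper x) : Anchored (Clustering.shift (anchor x) x) := by
  simp only [anchor, hx, dif_pos]
  exact hx.exists_anchor.choose_spec

lemma Proper.anchor_eq (hx : Proper x) {k : ℤ} (hk : Anchored (Clustering.shift k x)) :
    anchor x = k := hx.anchor_unique hx.anchored hk

lemma measurable_anchor : Measurable anchor := by
  refine measurable_to_countable' fun k => ?_
  have e : anchor ⁻¹' {k} = ({x | Proper x} ∩ {x | Anchored (shift k x)}) ∪
      ({x | Proper x}ᶜ ∩ {_x | k = 0}) := by
    ext x
    by_cases hx : Proper x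
    · simp only [mem_preimage, mem_singleton_iff, mem_union, mem_inter_iff, mem_compl_iff,
        mem_ofPred_eq, hx, true_and, not_true, false_and, or_false]
      exact ⟨fun h => h ▸ hx.anchored, hx.anchor_eq⟩
    · simp [hx, anchor, eq_comm]
  rw [e]
  exact (measurableSet_proper.inter
    ((measurable_shift measurable_id measurable_const) measurableSet_anchored)).union
    (measurableSet_proper.compl.inter (MeasurableSet.const _))

/-- The sequence renumbered such that its first nonnegative term has the index `0`. -/
def renumber (x : ℤ → ℝ) : ℤ → ℝ := shift (anchor x) x

lemma measurable_renumber : Measurable renumber := measurable_shift measurable_id measurable_anchor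

lemma Proper.nextPt_range (hx : Proper x) (i : ℤ) : nextPt (range x) (x i) = x (i + 1) := by
  refine IsLeast.csInf_eq ⟨⟨⟨i + 1, rfl⟩, hx.1 (by omega)⟩, ?_⟩
  rintro _ ⟨⟨j, rfl⟩, hj⟩
  have := hx.1.lt_iff_lt.1 hj
  exact hx.1.monotone (by omega)

lemma Proper.prevPt_range (hx : Proper x) (i : ℤ) : prevPt (range x) (x i) = x (i - 1) := by
  refine IsGreatest.csSup_eq ⟨⟨⟨i - 1, rfl⟩, hx.1 (by omega)⟩, ?_⟩
  rintro _ ⟨⟨j, rfl⟩, hj⟩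
  have := hx.1.lt_iff_lt.1 hj
  exact hx.1.monotone (by omega)

/-- In a proper sequence the infima and suprema that define neighbours are attained, so `enum`
follows the indices. -/
lemma Proper.enum_range (hx : Proper x) : enum (range x) = renumber x := by
  set k := anchor x with hk
  have ha := anchored_shift.1 hx.anchored
  rw [← hk] at ha
  have h0 : sInf (range x ∩ Ici 0) = x k := by
    refine IsLeast.csInf_eq ⟨⟨⟨k, rfl⟩, ha.2⟩, ?_⟩
    rintro _ ⟨⟨j, rfl⟩, hj⟩
    have := hx.1.lt_iff_lt.1 (ha.1.trans_le hj)
    exact hx.1.monotone (by omega)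
  have h1 : ∀ n : ℕ, (nextPt (range x))^[n] (x k) = x (k + n) := fun n => by
    induction n with
    | zero => simp
    | succ n ih =>
      rw [Function.iterate_succ_apply', ih, hx.nextPt_range]
      push_cast; rw [add_assoc]
  have h2 : ∀ n : ℕ, (prevPt (range x))^[n] (x k) = x (k - n) := fun n => by
    induction n with
    | zero => simp
    | succ n ih =>
      rw [Function.iterate_succ_apply', ih, hx.prevPt_range]
      push_cast; rw [sub_sub]
  ext i
  rcases i with n | n
  · exact (congrArg _ h0).trans (h1 n)
  · refine (congrArg _ h0).trans ((h2 (n + 1)).trans ?_)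
    simp only [renumber, Clustering.shift, Int.negSucc_eq]
    rw [← hk]
    push_cast
    ring_nf

lemma image_sub_range (x : ℤ → ℝ) (s : ℝ) :
    (fun y => y - s) '' range x = range (translate (-s) x) := by
  rw [← range_comp]; rfl

lemma Proper.seenFrom_range (hx : Proper x) (s : ℝ) :
    seenFrom (range x) s = renumber (Clustering.translate (-s) x) := by
  rw [seenFrom, image_sub_range, (hx.translate _).enum_range]

lemma Proper.seenFrom_apply (hx : Proper x) (k : ℤ) :
    seenFrom (range x) (x k) = Clustering.recenter k x := by
  rw [hx.seenFrom_range, renumber, (hx.translate _).anchor_eq (k := k), recenter_eq]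
  · rfl
  · rw [anchored_shift]
    simp only [Clustering.translate, add_neg_cancel, le_refl, and_true]
    have := hx.1 (show k - 1 < k by omega)
    linarith

lemma Proper.renumber_eq (hx : Proper x) (ha : Anchored x) : renumber x = x := by
  rw [renumber, hx.anchor_eq (k := 0) (by simpa using ha), shift_zero]

open Classical in
/-- Exactly one renumbering of a sequence is anchored. -/
lemma Proper.tsum_anchored (hx : Proper x) (f : ℤ → ℝ≥0∞) :
    ∑' k, (if Anchored (Clustering.shift k x) then f k else 0) = f (anchor x) := by
  rw [tsum_eq_single (anchor x) fun k hk => if_neg fun h => hk (hx.anchor_eq h).symm,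
    if_pos hx.anchored]

end Proper

/-! ### Inversion of the Palm distribution -/

lemma measurable_translate {α : Type*} [MeasurableSpace α] {s : α → ℝ} {x : α → ℤ → ℝ}
    (hs : Measurable s) (hx : Measurable x) : Measurable fun a => translate (s a) (x a) :=
  measurable_pi_lambda _ fun i => ((measurable_pi_apply i).comp hx).add hs

/-- Integration over all translates of a random sequence. -/
def configMeasure (m : Measure (ℤ → ℝ)) : Measure (ℤ → ℝ) :=
  (m.prod volume).map fun p => translate p.2 p.1

/-- The stationary point process with a given Palm distribution. -/
def stationaryLaw (m : Measure (ℤ → ℝ)) : Measure (ℤ → ℝ) :=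
  (configMeasure m).restrict {x | Anchored x}

lemma measurable_translate_prod :
    Measurable fun p : (ℤ → ℝ) × ℝ => translate p.2 p.1 :=
  measurable_translate measurable_snd measurable_fst

lemma lintegral_configMeasure (m : Measure (ℤ → ℝ)) [SFinite m] {f : (ℤ → ℝ) → ℝ≥0∞}
    (hf : Measurable f) :
    ∫⁻ x, f x ∂(configMeasure m) = ∫⁻ y, ∫⁻ u, f (translate u y) ∂volume ∂m := by
  have hf' : Measurable fun p : (ℤ → ℝ) × ℝ => f (translate p.2 p.1) :=
    hf.comp measurable_translate_prod
  rw [configMeasure, lintegral_map hf measurable_translate_prod, lintegral_prod _ hf'.aemeasurable]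

lemma lintegral_configMeasure_translate (m : Measure (ℤ → ℝ)) [SFinite m] {f : (ℤ → ℝ) → ℝ≥0∞}
    (hf : Measurable f) (s : ℝ) :
    ∫⁻ x, f (translate s x) ∂(configMeasure m) = ∫⁻ x, f x ∂(configMeasure m) := by
  rw [lintegral_configMeasure m hf, lintegral_configMeasure m
    (f := fun x => f (translate s x)) (hf.comp (measurable_translate measurable_const measurable_id))]
  refine lintegral_congr fun y => ?_
  have e : ∀ u, translate s (translate u y) = translate (u + s) y := fun u => by
    ext i; simp [translate, add_assoc]
  simp only [e]
  exact lintegral_add_right_eq_self (fun u => f (translate u y)) s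

lemma lintegral_stationaryLaw (m : Measure (ℤ → ℝ)) (f : (ℤ → ℝ) → ℝ≥0∞) :
    ∫⁻ x, f x ∂(stationaryLaw m) =
      ∫⁻ x, {x | Anchored x}.indicator f x ∂(configMeasure m) := by
  rw [stationaryLaw, lintegral_indicator measurableSet_anchored]

/-! ### Invariance, total mass and Campbell's formula of the inverted law -/

section GapLaw

variable {m : Measure (ℤ → ℝ)}

/-- Renumbering from `k` recentres the gap sequence, which preserves `m`, and displaces it by `y k`,
which Lebesgue measure does not see. -/
lemma lintegral_configMeasure_shift (hm : IsGapLaw m) {f : (ℤ → ℝ) → ℝ≥0∞}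
    (hf : Measurable f) (k : ℤ) :
    ∫⁻ x, f (shift k x) ∂(configMeasure m) = ∫⁻ x, f x ∂(configMeasure m) := by
  have := hm.isProb
  have hf' : Measurable fun y : ℤ → ℝ => ∫⁻ u, f (translate u y) :=
    (hf.comp measurable_translate_prod).lintegral_prod_right'
  rw [lintegral_configMeasure m hf, lintegral_configMeasure m
    (f := fun x => f (shift k x)) (hf.comp (measurable_shift measurable_id measurable_const))]
  conv_rhs => rw [← hm.invariant k]
  rw [lintegral_map hf' (measurable_recenter_const k)]
  refine lintegral_congr fun y => ?_
  have e : ∀ u, shift k (translate u y) = translate (u + y k) (recenter k y) := fun u => by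
    ext i; simp [translate, shift, recenter]
  simp only [e]
  exact lintegral_add_right_eq_self (fun u => f (translate u (recenter k y))) (y k)

lemma ae_configMeasure_proper (hm : IsGapLaw m) : ∀ᵐ x ∂(configMeasure m), Proper x := by
  have := hm.isProb
  refine (ae_map_iff measurable_translate_prod.aemeasurable measurableSet_proper).2 ?_
  have h : ∀ᵐ p ∂(m.prod (volume : Measure ℝ)), Proper p.1 :=
    Measure.quasiMeasurePreserving_fst.ae hm.proper
  filter_upwards [h] with p hp
  exact hp.translate _

/-- The translate by u is anchored exactly for u in [0, -y (-1)), so the total mass is the mean gap.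
-/
lemma isProbabilityMeasure_stationaryLaw (hm : IsGapLaw m) :
    IsProbabilityMeasure (stationaryLaw m) := by
  have := hm.isProb
  constructor
  have h := lintegral_stationaryLaw m (fun _ => 1)
  rw [lintegral_one] at h
  rw [h, lintegral_configMeasure m (measurable_const.indicator measurableSet_anchored)]
  refine Eq.trans ?_ hm.mean
  refine lintegral_congr_ae ?_
  filter_upwards [hm.zero] with y hy
  have e : ∀ u, ({x | Anchored x} : Set (ℤ → ℝ)).indicator (fun _ => (1 : ℝ≥0∞)) (translate u y) =
      (Ico 0 (-y (-1))).indicator (fun _ => 1) u := fun u => by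
    have : translate u y ∈ {x | Anchored x} ↔ u ∈ Ico 0 (-y (-1)) := by
      simp only [mem_ofPred_eq, Anchored, translate, hy, zero_add, mem_Ico]
      constructor
      · rintro ⟨h1, h2⟩; exact ⟨h2, by linarith⟩
      · rintro ⟨h1, h2⟩; exact ⟨by linarith, h1⟩
    by_cases h : u ∈ Ico 0 (-y (-1))
    · rw [indicator_of_mem h, indicator_of_mem (this.2 h)]
    · rw [indicator_of_notMem h, indicator_of_notMem fun h' => h (this.1 h')]
  refine (lintegral_congr e).trans ?_
  rw [lintegral_indicator measurableSet_Ico]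
  simp

lemma ae_stationaryLaw (hm : IsGapLaw m) :
    ∀ᵐ x ∂(stationaryLaw m), Proper x ∧ Anchored x := by
  filter_upwards [ae_restrict_of_ae (ae_configMeasure_proper hm),
    ae_restrict_mem measurableSet_anchored] with x h1 h2
  exact ⟨h1, h2⟩

/-- Mass transport: both sides are sums over pairs of an anchored numbering of the sequence and one
of its translate. The invariance of `configMeasure` under translations and renumberings matches the
terms, and each sequence has exactly one anchored numbering. -/
lemma lintegral_stationaryLaw_seenFrom (hm : IsGapLaw m) (s : ℝ) {f : (ℤ → ℝ) → ℝ≥0∞}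
    (hf : Measurable f) :
    ∫⁻ x, f (renumber (translate s x)) ∂(stationaryLaw m) = ∫⁻ x, f x ∂(stationaryLaw m) := by
  classical
  have := hm.isProb
  have hA := measurableSet_anchored
  have hfA : Measurable ({x | Anchored x}.indicator f) := hf.indicator hA
  have ht : ∀ s : ℝ, Measurable (translate s) := fun s =>
    measurable_translate measurable_const measurable_id
  have hsh : ∀ k : ℤ, Measurable (shift k : (ℤ → ℝ) → ℤ → ℝ) := fun k =>
    measurable_shift measurable_id measurable_const
  have hone : Measurable ({x : ℤ → ℝ | Anchored x}.indicator fun _ => (1 : ℝ≥0∞)) :=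
    measurable_const.indicator hA
  let g : ℤ → (ℤ → ℝ) → ℝ≥0∞ := fun k x =>
    {x : ℤ → ℝ | Anchored x}.indicator (fun _ => (1 : ℝ≥0∞)) (translate (-s) x) *
      {x | Anchored x}.indicator f (shift k x)
  have hg : ∀ k, Measurable (g k) := fun k =>
    (hone.comp (ht _)).mul (hfA.comp (hsh k))
  let g' : ℤ → (ℤ → ℝ) → ℝ≥0∞ := fun k x =>
    {x : ℤ → ℝ | Anchored x}.indicator (fun _ => (1 : ℝ≥0∞)) (shift (-k) (translate (-s) x)) *
      {x | Anchored x}.indicator f x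
  have hg' : ∀ k, Measurable (g' k) := fun k =>
    (hone.comp ((hsh _).comp (ht _))).mul hfA
  have h1 : ∫⁻ x, f (renumber (translate s x)) ∂(stationaryLaw m) =
      ∫⁻ x, ∑' k, g k (translate s x) ∂(configMeasure m) := by
    rw [lintegral_stationaryLaw]
    refine lintegral_congr_ae ?_
    filter_upwards [ae_configMeasure_proper hm] with x hx
    have e0 : translate (-s) (translate s x) = x := by ext i; simp [translate]
    simp only [g, e0]
    rw [ENNReal.tsum_mul_left]
    have e1 : ∑' k, {x | Anchored x}.indicator f (shift k (translate s x)) =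
        f (renumber (translate s x)) := by
      have := (hx.translate s).tsum_anchored fun k => f (shift k (translate s x))
      rw [renumber, ← this]
      exact tsum_congr fun k => by simp [indicator]
    rw [e1]
    by_cases ha : Anchored x <;> simp [indicator, ha]
  have h2 : ∫⁻ x, f x ∂(stationaryLaw m) = ∫⁻ x, ∑' k, g' k x ∂(configMeasure m) := by
    rw [lintegral_stationaryLaw]
    refine lintegral_congr_ae ?_
    filter_upwards [ae_configMeasure_proper hm] with x hx
    simp only [g']
    rw [ENNReal.tsum_mul_right]
    have e1 : ∑' k : ℤ, {x : ℤ → ℝ | Anchored x}.indicator (fun _ => (1 : ℝ≥0∞))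
        (shift (-k) (translate (-s) x)) = 1 := by
      rw [← (Equiv.neg ℤ).tsum_eq]
      have := (hx.translate (-s)).tsum_anchored fun k => 1
      refine Eq.trans ?_ this
      exact tsum_congr fun k => by simp [indicator]
    rw [e1, one_mul]
  rw [h1, h2, lintegral_tsum fun k => by have := (hg k).comp (ht s); exact this.aemeasurable,
    lintegral_tsum fun k => (hg' k).aemeasurable]
  refine tsum_congr fun k => ?_
  rw [lintegral_configMeasure_translate m (hg k), ← lintegral_configMeasure_shift hm (hg' k) k]
  refine lintegral_congr fun x => ?_
  have e : shift (-k) (translate (-s) (shift k x)) = translate (-s) x := by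
    ext i; simp [shift, translate]
  simp only [g, g', e]

/-- Points in the unit interval: the refined Campbell formula for the stationary process. -/
lemma tsum_lintegral_stationaryLaw (hm : IsGapLaw m) {f : (ℤ → ℝ) → ℝ≥0∞} (hf : Measurable f) :
    ∑' i : ℤ, ∫⁻ x, (Ico (0 : ℝ) 1).indicator (fun _ => f (recenter i x)) (x i)
      ∂(stationaryLaw m) = ∫⁻ y, f y ∂m := by
  classical
  have := hm.isProb
  have hA := measurableSet_anchored
  have hone : Measurable ({x : ℤ → ℝ | Anchored x}.indicator fun _ => (1 : ℝ≥0∞)) :=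
    measurable_const.indicator hA
  have hsh : ∀ k : ℤ, Measurable (shift k : (ℤ → ℝ) → ℤ → ℝ) := fun k =>
    measurable_shift measurable_id measurable_const
  let F : (ℤ → ℝ) → ℝ≥0∞ := fun x => (Ico (0 : ℝ) 1).indicator (fun _ => f (recenter 0 x)) (x 0)
  have hF : Measurable F := by
    have e : F = ((fun x : ℤ → ℝ => x 0) ⁻¹' Ico (0 : ℝ) 1).indicator
        fun x => f (recenter 0 x) := by
      ext x; simp [F, indicator]
    rw [e]
    exact (hf.comp (measurable_recenter_const 0)).indicator
      (measurable_pi_apply (X := fun _ : ℤ => ℝ) 0 measurableSet_Ico)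
  -- The point `i` is renumbered as point 0. Anchoring becomes a condition on the shift by `-i`,
  -- which holds for exactly one `i`, so the anchoring factor sums to one.
  let g : ℤ → (ℤ → ℝ) → ℝ≥0∞ := fun i x =>
    {x : ℤ → ℝ | Anchored x}.indicator (fun _ => (1 : ℝ≥0∞)) (shift (-i) x) * F x
  have hg : ∀ i, Measurable (g i) := fun i => (hone.comp (hsh _)).mul hF
  have h1 : ∀ i : ℤ, ∫⁻ x, (Ico (0 : ℝ) 1).indicator (fun _ => f (recenter i x)) (x i)
      ∂(stationaryLaw m) = ∫⁻ x, g i x ∂(configMeasure m) := fun i => by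
    rw [lintegral_stationaryLaw, ← lintegral_configMeasure_shift hm (hg i) i]
    refine lintegral_congr fun x => ?_
    have e1 : shift (-i) (shift i x) = x := by rw [shift_shift]; simp
    have e2 : F (shift i x) = (Ico (0 : ℝ) 1).indicator (fun _ => f (recenter i x)) (x i) := by
      have e3 : recenter 0 (shift i x) = recenter i x := by ext j; simp [recenter, shift]
      have e4 : shift i x 0 = x i := by simp [shift]
      simp only [F, e3, e4]
    simp only [g, e1, e2]
    by_cases ha : Anchored x <;> simp [indicator, ha]
  simp only [h1]
  rw [← lintegral_tsum fun i => (hg i).aemeasurable]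
  have h2 : ∫⁻ x, ∑' i, g i x ∂(configMeasure m) = ∫⁻ x, F x ∂(configMeasure m) := by
    refine lintegral_congr_ae ?_
    filter_upwards [ae_configMeasure_proper hm] with x hx
    simp only [g]
    rw [ENNReal.tsum_mul_right]
    have e1 : ∑' k : ℤ, {x : ℤ → ℝ | Anchored x}.indicator (fun _ => (1 : ℝ≥0∞))
        (shift (-k) x) = 1 := by
      rw [← (Equiv.neg ℤ).tsum_eq]
      have := hx.tsum_anchored fun k => 1
      refine Eq.trans ?_ this
      exact tsum_congr fun k => by simp [indicator]
    rw [e1, one_mul]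
  rw [h2, lintegral_configMeasure m hF]
  refine lintegral_congr_ae ?_
  filter_upwards [hm.zero] with y hy
  have e : ∀ u, F (translate u y) = (Ico (0 : ℝ) 1).indicator (fun _ => f y) u := fun u => by
    have e1 : recenter 0 (translate u y) = y := by ext i; simp [recenter, translate, hy]
    have e2 : translate u y 0 = u := by simp [translate, hy]
    simp only [F, e1, e2]
  simp only [e]
  rw [lintegral_indicator measurableSet_Ico]
  simp

end GapLaw

/-! ### Palm distributions and laws of enumerations -/

lemma enum_range_ae {Ω : Type*} [MeasurableSpace Ω] {μ : Measure Ω} {Y : Ω → ℤ → ℝ}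
    (hYp : ∀ᵐ ω ∂μ, Proper (Y ω)) :
    (fun ω => enum (range (Y ω))) =ᵐ[μ] fun ω => renumber (Y ω) := by
  filter_upwards [hYp] with ω hω
  exact hω.enum_range

/-- The Palm distribution as a sum over all points, for any numbering of the points. -/
lemma lintegral_palm {Ω β : Type*} [MeasurableSpace Ω] [MeasurableSpace β] {μ : Measure Ω}
    {S : Ω → Set ℝ} {F : Ω → ℝ → β} {Y : Ω → ℤ → ℝ} {G : ℤ → Ω → β} (hY : Measurable Y)
    (hG : ∀ k, Measurable (G k))
    (h : ∀ᵐ ω ∂μ, Proper (Y ω) ∧ S ω = range (Y ω) ∧ ∀ k, F ω (Y ω k) = G k ω)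
    {f : β → ℝ≥0∞} (hf : Measurable f) :
    ∫⁻ x, f x ∂(palm μ S F) =
      ∑' k : ℤ, ∫⁻ ω, (Ico (0 : ℝ) 1).indicator (fun _ => f (G k ω)) (Y ω k) ∂μ := by
  have hZ : Measurable fun ω => renumber (Y ω) := measurable_renumber.comp hY
  have hG' : Measurable fun p : Ω × ℤ => G p.2 p.1 := measurable_from_prod_countable_left hG
  have hH : ∀ i : ℤ, Measurable fun ω => G (anchor (Y ω) + i) ω := fun i =>
    hG'.comp (measurable_id.prodMk ((measurable_anchor.comp hY).add_const i))
  have henum : ∀ᵐ ω ∂μ, enum (S ω) = renumber (Y ω) := by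
    filter_upwards [h] with ω hω
    rw [hω.2.1, hω.1.enum_range]
  have hset : ∀ i : ℤ, MeasurableSet {ω | renumber (Y ω) i ∈ Ico (0 : ℝ) 1} := fun i =>
    ((measurable_pi_apply i).comp hZ) measurableSet_Ico
  have hF : ∀ i : ℤ, (fun ω => F ω (enum (S ω) i)) =ᵐ[μ] fun ω => G (anchor (Y ω) + i) ω :=
    fun i => by
    filter_upwards [h, henum] with ω hω he
    rw [he]
    exact hω.2.2 _
  have h1 : ∀ i : ℤ, ∫⁻ x, f x ∂((μ.restrict {ω | enum (S ω) i ∈ Ico (0 : ℝ) 1}).map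
      fun ω => F ω (enum (S ω) i)) = ∫⁻ ω, (Ico (0 : ℝ) 1).indicator
        (fun _ => f (G (anchor (Y ω) + i) ω)) (Y ω (anchor (Y ω) + i)) ∂μ := fun i => by
    have hs : {ω | enum (S ω) i ∈ Ico (0 : ℝ) 1} =ᵐ[μ] {ω | renumber (Y ω) i ∈ Ico (0 : ℝ) 1} := by
      filter_upwards [henum] with ω he
      exact propext (show enum (S ω) i ∈ Ico (0 : ℝ) 1 ↔ renumber (Y ω) i ∈ Ico (0 : ℝ) 1 by rw [he])
    rw [Measure.restrict_congr_set hs, Measure.map_congr (ae_restrict_of_ae (hF i)),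
      lintegral_map hf (hH i), ← lintegral_indicator (hset i)]
    refine lintegral_congr fun ω => ?_
    simp only [indicator, mem_ofPred_eq]
    rfl
  have hT : ∀ k : ℤ, Measurable fun ω =>
      (Ico (0 : ℝ) 1).indicator (fun _ => f (G k ω)) (Y ω k) := fun k => by
    have e : (fun ω => (Ico (0 : ℝ) 1).indicator (fun _ => f (G k ω)) (Y ω k)) =
        {ω | Y ω k ∈ Ico (0 : ℝ) 1}.indicator fun ω => f (G k ω) := by
      ext ω; simp [indicator]
    rw [e]
    exact (hf.comp (hG k)).indicator (((measurable_pi_apply k).comp hY) measurableSet_Ico)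
  have hT' : Measurable fun p : Ω × ℤ =>
      (Ico (0 : ℝ) 1).indicator (fun _ => f (G p.2 p.1)) (Y p.1 p.2) :=
    measurable_from_prod_countable_left hT
  have hT2 : ∀ i : ℤ, Measurable fun ω => (Ico (0 : ℝ) 1).indicator
      (fun _ => f (G (anchor (Y ω) + i) ω)) (Y ω (anchor (Y ω) + i)) := fun i =>
    hT'.comp (measurable_id.prodMk ((measurable_anchor.comp hY).add_const i))
  rw [palm, lintegral_sum_measure]
  simp only [h1]
  rw [← lintegral_tsum fun i => (hT2 i).aemeasurable, ← lintegral_tsum fun k => (hT k).aemeasurable]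
  refine lintegral_congr fun ω => ?_
  -- `enum` starts counting at `anchor`; a sum over all points does not see this offset.
  exact (Equiv.addLeft (anchor (Y ω))).tsum_eq fun k =>
    (Ico (0 : ℝ) 1).indicator (fun _ => f (G k ω)) (Y ω k)

lemma measure_ext_lintegral {β : Type*} [MeasurableSpace β] {μ ν : Measure β}
    (h : ∀ f : β → ℝ≥0∞, Measurable f → ∫⁻ x, f x ∂μ = ∫⁻ x, f x ∂ν) : μ = ν :=
  (Measure.ext_of_lintegral _ fun f hf => (h f hf).symm).symm

lemma palm_stationaryLaw {m : Measure (ℤ → ℝ)} (hm : IsGapLaw m) :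
    palm (stationaryLaw m) (fun x => range x) (fun x z => seenFrom (range x) z) = m := by
  refine measure_ext_lintegral fun f hf => ?_
  rw [lintegral_palm (Y := id) (G := fun k x => recenter k x) measurable_id
    measurable_recenter_const ?_ hf]
  · exact tsum_lintegral_stationaryLaw hm hf
  · filter_upwards [ae_stationaryLaw hm] with x hx
    exact ⟨hx.1, rfl, hx.1.seenFrom_apply⟩

lemma isUnitStationary_stationaryLaw {m : Measure (ℤ → ℝ)} (hm : IsGapLaw m) :
    IsUnitStationary (stationaryLaw m) id where
  measurable := measurable_id
  strictMono := by filter_upwards [ae_stationaryLaw hm] with x hx using hx.1.1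
  tendsto_atTop := by filter_upwards [ae_stationaryLaw hm] with x hx using hx.1.2.1
  tendsto_atBot := by filter_upwards [ae_stationaryLaw hm] with x hx using hx.1.2.2
  stationary s := by
    have h1 : (fun x : ℤ → ℝ => seenFrom (range (id x)) s) =ᵐ[stationaryLaw m]
        fun x => renumber (translate (-s) x) := by
      filter_upwards [ae_stationaryLaw hm] with x hx
      exact hx.1.seenFrom_range s
    have h2 : (fun x : ℤ → ℝ => enum (range (id x))) =ᵐ[stationaryLaw m] id := by
      filter_upwards [ae_stationaryLaw hm] with x hx
      exact hx.1.enum_range.trans (hx.1.renumber_eq hx.2)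
    rw [Measure.map_congr h1, Measure.map_congr h2, Measure.map_id]
    refine measure_ext_lintegral fun f hf => ?_
    have hmm : Measurable fun x => renumber (translate (-s) x) :=
      measurable_renumber.comp (measurable_translate measurable_const measurable_id)
    rw [lintegral_map hf hmm]
    exact lintegral_stationaryLaw_seenFrom hm (-s) hf
  intensity := by
    have := hm.isProb
    have h := tsum_lintegral_stationaryLaw hm (f := fun _ => 1) measurable_const
    rw [lintegral_one, measure_univ] at h
    rw [← h, ← lintegral_tsum fun i => by
      have : Measurable fun x : ℤ → ℝ => (Ico (0 : ℝ) 1).indicator (fun _ => (1 : ℝ≥0∞)) (x i) :=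
        (measurable_const.indicator measurableSet_Ico).comp (measurable_pi_apply i)
      exact this.aemeasurable]
    refine lintegral_congr_ae ?_
    filter_upwards [ae_stationaryLaw hm] with x hx
    have e : range (id x) ∩ Ico (0 : ℝ) 1 = x '' {i | x i ∈ Ico (0 : ℝ) 1} := by
      ext y
      constructor
      · rintro ⟨⟨i, rfl⟩, hy⟩; exact ⟨i, hy, rfl⟩
      · rintro ⟨i, hi, rfl⟩; exact ⟨⟨i, rfl⟩, hi⟩
    rw [e, hx.1.1.injective.encard_image, ← ENNReal.tsum_set_one,
      tsum_subtype {i | x i ∈ Ico (0 : ℝ) 1} fun _ => (1 : ℝ≥0∞)]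
    exact tsum_congr fun i => by simp [indicator]

/-- The law of a point process is determined by its Palm distribution. -/
lemma map_renumber_eq_stationaryLaw {Ω : Type*} [MeasurableSpace Ω] {μ : Measure Ω}
    {m : Measure (ℤ → ℝ)} [SFinite m] {Y : Ω → ℤ → ℝ} (hY : Measurable Y)
    (hYp : ∀ᵐ ω ∂μ, Proper (Y ω))
    (hC : ∀ h : (ℤ → ℝ) → ℝ≥0∞, Measurable h →
      ∑' k : ℤ, ∫⁻ ω, h (shift k (Y ω)) ∂μ = ∫⁻ x, h x ∂(configMeasure m)) :
    μ.map (fun ω => renumber (Y ω)) = stationaryLaw m := by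
  classical
  refine measure_ext_lintegral fun f hf => ?_
  have hfA := hf.indicator measurableSet_anchored
  have hmm : Measurable fun ω => renumber (Y ω) := measurable_renumber.comp hY
  rw [lintegral_map hf hmm, lintegral_stationaryLaw, ← hC _ hfA,
    ← lintegral_tsum fun k => by
      have : Measurable fun ω => {x | Anchored x}.indicator f (shift k (Y ω)) :=
        hfA.comp (measurable_shift hY measurable_const)
      exact this.aemeasurable]
  refine lintegral_congr_ae ?_
  filter_upwards [hYp] with ω hω
  have := hω.tsum_anchored fun k => f (shift k (Y ω))
  refine Eq.trans this.symm ?_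
  exact tsum_congr fun k => by simp [indicator]

lemma continuous_translate (u : ℝ) : Continuous (translate u) :=
  continuous_pi fun i => (continuous_apply i).add continuous_const

/-- Being anchored is not an open condition, so `0 ≤ x 0` is replaced by `0 < x 0`. The loss is null
for the limit because translations have Lebesgue law. Fatou's lemma is applied once over
translations and once over `P`. -/
lemma measure_stationaryLaw_le_liminf {X : Type*} [MeasurableSpace X] {P : Measure X}
    [IsProbabilityMeasure P] {u : ℕ → X → ℤ → ℝ} {U : X → ℤ → ℝ} (hu : ∀ t, Measurable (u t))
    (hU : Measurable U) (h : ∀ᵐ x ∂P, Tendsto (fun t => u t x) atTop (𝓝 (U x)))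
    {G : Set (ℤ → ℝ)} (hG : IsOpen G) :
    stationaryLaw (P.map U) G ≤ liminf (fun t => stationaryLaw (P.map (u t)) G) atTop := by
  have hPU : IsProbabilityMeasure (P.map U) := Measure.isProbabilityMeasure_map hU.aemeasurable
  have hPu : ∀ t, IsProbabilityMeasure (P.map (u t)) := fun t =>
    Measure.isProbabilityMeasure_map (hu t).aemeasurable
  set A : Set (ℤ → ℝ) := {x | x (-1) < 0 ∧ 0 < x 0} ∩ G with hA
  have hAo : IsOpen A := by
    refine IsOpen.inter ?_ hG
    exact (isOpen_lt (continuous_apply _) continuous_const).inter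
      (isOpen_lt continuous_const (continuous_apply _))
  have hAm : MeasurableSet A := hAo.measurableSet
  have hval : ∀ v : X → ℤ → ℝ, Measurable v → IsProbabilityMeasure (P.map v) →
      configMeasure (P.map v) A =
        ∫⁻ x, ∫⁻ r, A.indicator (fun _ => 1) (translate r (v x)) ∂volume ∂P := fun v hv _ => by
    have hone : Measurable (A.indicator fun _ => (1 : ℝ≥0∞)) := measurable_const.indicator hAm
    rw [← lintegral_indicator_one hAm]
    refine (lintegral_configMeasure (P.map v) hone).trans ?_
    rw [lintegral_map (f := fun y => ∫⁻ r, A.indicator (fun _ => 1) (translate r y) ∂volume)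
      (hone.comp measurable_translate_prod).lintegral_prod_right' hv]
  have hlow : ∀ t, configMeasure (P.map (u t)) A ≤ stationaryLaw (P.map (u t)) G := fun t => by
    rw [stationaryLaw, Measure.restrict_apply hG.measurableSet]
    exact measure_mono fun x hx => ⟨hx.2, hx.1.1, hx.1.2.le⟩
  have hup : stationaryLaw (P.map U) G ≤ configMeasure (P.map U) A := by
    rw [stationaryLaw, Measure.restrict_apply hG.measurableSet]
    have hnull : configMeasure (P.map U) {x | x 0 = 0} = 0 := by
      have hS : MeasurableSet {x : ℤ → ℝ | x 0 = 0} :=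
        measurable_pi_apply (X := fun _ : ℤ => ℝ) 0 (measurableSet_singleton 0)
      rw [← lintegral_indicator_one hS]
      refine (lintegral_configMeasure (P.map U) (measurable_one.indicator hS)).trans ?_
      refine (lintegral_congr fun y => ?_).trans lintegral_zero
      have e : ∀ r : ℝ, {x : ℤ → ℝ | x 0 = 0}.indicator (1 : (ℤ → ℝ) → ℝ≥0∞) (translate r y) =
          ({-y 0} : Set ℝ).indicator 1 r := fun r => by
        have : translate r y ∈ {x : ℤ → ℝ | x 0 = 0} ↔ r ∈ ({-y 0} : Set ℝ) := by
          simp only [mem_ofPred_eq, translate, mem_singleton_iff]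
          constructor <;> intro h <;> linarith
        by_cases hr : r ∈ ({-y 0} : Set ℝ)
        · rw [indicator_of_mem hr, indicator_of_mem (this.2 hr)]; rfl
        · rw [indicator_of_notMem hr, indicator_of_notMem fun h' => hr (this.1 h')]
      simp only [e]
      rw [lintegral_indicator_one (measurableSet_singleton _)]
      simp
    refine (measure_mono (t := A ∪ {x | x 0 = 0}) ?_).trans
      ((measure_union_le _ _).trans (by rw [hnull, add_zero]))
    rintro x ⟨hx, h1, h2⟩
    rcases h2.eq_or_lt with h3 | h3
    · exact Or.inr h3.symm
    · exact Or.inl ⟨⟨h1, h3⟩, hx⟩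
  refine hup.trans (le_trans ?_ (liminf_le_liminf (Eventually.of_forall hlow)))
  simp only [hval _ hU hPU, fun t => hval _ (hu t) (hPu t)]
  have hone : Measurable (A.indicator fun _ => (1 : ℝ≥0∞)) := measurable_const.indicator hAm
  have hm : ∀ t, Measurable fun x : X × ℝ =>
      A.indicator (fun _ => (1 : ℝ≥0∞)) (translate x.2 (u t x.1)) := fun t =>
    hone.comp (measurable_translate measurable_snd ((hu t).comp measurable_fst))
  calc ∫⁻ x, ∫⁻ r, A.indicator (fun _ => 1) (translate r (U x)) ∂volume ∂P
      ≤ ∫⁻ x, ∫⁻ r, liminf (fun t => A.indicator (fun _ => 1) (translate r (u t x))) atTop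
          ∂volume ∂P := by
        refine lintegral_mono_ae ?_
        filter_upwards [h] with x hx
        refine lintegral_mono fun r => ?_
        by_cases hr : translate r (U x) ∈ A
        · have h1 : ∀ᶠ t in atTop, translate r (u t x) ∈ A :=
            (((continuous_translate r).tendsto _).comp hx).eventually (hAo.mem_nhds hr)
          refine le_liminf_of_le (by isBoundedDefault) ?_
          filter_upwards [h1] with t ht
          rw [indicator_of_mem hr, indicator_of_mem ht]
        · rw [indicator_of_notMem hr]; exact zero_le
    _ ≤ ∫⁻ x, liminf (fun t => ∫⁻ r, A.indicator (fun _ => 1) (translate r (u t x)) ∂volume)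
          atTop ∂P :=
        lintegral_mono fun x => lintegral_liminf_le fun t => (hm t).comp measurable_prodMk_left
    _ ≤ _ := lintegral_liminf_le fun t => (hm t).lintegral_prod_right'

/-! ### Dynamics in terms of merged points -/

/-- The positions after one step, from the positions before it. -/
def advance (b : ℤ → Bool) (y : ℤ → ℝ) (j : ℤ) : ℝ :=
  3 / 4 * ((y (occIdx b j) + y (occIdx b j + 1)) / 2)

/-- The first labels of the merged points after one step. -/
def relabel (b : ℤ → Bool) (l : ℤ → ℤ) (j : ℤ) : ℤ := l (firstPt b (occIdx b j))

/-- The first labels of the merged points at time `t`. -/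
def labels (c : ℕ → ℤ → Bool) : ℕ → ℤ → ℤ
  | 0 => id
  | t + 1 => relabel (fun k => c t (labels c t k)) (labels c t)

/-- The positions of the merged points at time `t`. -/
def positions (x : ℤ → ℝ) (c : ℕ → ℤ → Bool) : ℕ → ℤ → ℝ
  | 0 => x
  | t + 1 => advance (fun k => c t (labels c t k)) (positions x c t)

lemma recenter_advance (b : ℤ → Bool) (n : ℤ) (y : ℤ → ℝ) :
    recenter n (advance b y) = thin (shift (occIdx b n) b) (recenter (occIdx b n) y) := by
  rw [← recenter_thin]
  ext j
  simp only [recenter, thin, advance]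
  ring

lemma recenter_relabel (b : ℤ → Bool) (n : ℤ) (l : ℤ → ℤ) :
    recenter n (relabel b l) = merge (shift (occIdx b n) b) (recenter (occIdx b n) l) := by
  rw [← recenter_merge]
  ext j
  simp only [recenter, merge, relabel]
  ring

lemma occIdx_tendsto_atTop (b : ℤ → Bool) : Tendsto (occIdx b) atTop atTop := by
  refine (occIdx_strictMono b).monotone.tendsto_atTop_atTop fun k => ?_
  obtain ⟨j, -, h⟩ := exists_bracket (occIdx_strictMono b) k
  exact ⟨j + 1, h.le⟩

lemma occIdx_tendsto_atBot (b : ℤ → Bool) : Tendsto (occIdx b) atBot atBot := by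
  refine (occIdx_strictMono b).monotone.tendsto_atBot_atBot fun k => ?_
  obtain ⟨j, h, -⟩ := exists_bracket (occIdx_strictMono b) k
  exact ⟨j, h⟩

lemma Proper.advance {y : ℤ → ℝ} (hy : Proper y) (b : ℤ → Bool) : Proper (advance b y) := by
  refine ⟨fun i j h => ?_, ?_, ?_⟩
  · have h1 := hy.1 (occIdx_strictMono b h)
    have h2 := hy.1 (add_lt_add_left (occIdx_strictMono b h) 1)
    simp only [Clustering.advance]
    linarith
  · refine Tendsto.const_mul_atTop (by norm_num) (Tendsto.atTop_div_const (by norm_num) ?_)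
    exact (hy.2.1.comp (occIdx_tendsto_atTop b)).atTop_add_atTop
      (hy.2.1.comp (tendsto_atTop_add_const_right _ 1 (occIdx_tendsto_atTop b)))
  · refine Tendsto.const_mul_atBot (by norm_num) (Tendsto.atBot_div_const (by norm_num) ?_)
    exact (hy.2.2.comp (occIdx_tendsto_atBot b)).atBot_add_atBot
      (hy.2.2.comp (tendsto_atBot_add_const_right _ 1 (occIdx_tendsto_atBot b)))

lemma labels_strictMono (c : ℕ → ℤ → Bool) (t : ℕ) : StrictMono (labels c t) := by
  induction t with
  | zero => exact strictMono_id
  | succ t ih => exact ih.comp (firstPt_occIdx_strictMono _)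

lemma Proper.positions {x : ℤ → ℝ} (hx : Proper x) (c : ℕ → ℤ → Bool) (t : ℕ) :
    Proper (positions x c t) := by
  induction t with
  | zero => exact hx
  | succ t ih => exact ih.advance _

/-! ### Clusters as blocks of consecutive labels -/

section Clusters

variable {x y : ℤ → ℝ} {l : ℤ → ℤ}

lemma eq_position_iff (hy : StrictMono y) (hl : StrictMono l)
    (hx : ∀ i k, l k ≤ i → i < l (k + 1) → x i = y k) {i k : ℤ} :
    x i = y k ↔ l k ≤ i ∧ i < l (k + 1) := by
  refine ⟨fun h => ?_, fun h => hx i k h.1 h.2⟩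
  obtain ⟨j, hj⟩ := exists_bracket hl i
  rw [hx i j hj.1 hj.2] at h
  rwa [← hy.injective h]

lemma range_eq_of_clusters (hl : StrictMono l)
    (hx : ∀ i k, l k ≤ i → i < l (k + 1) → x i = y k) : range x = range y := by
  ext z
  constructor
  · rintro ⟨i, rfl⟩
    obtain ⟨j, hj⟩ := exists_bracket hl i
    exact ⟨j, (hx i j hj.1 hj.2).symm⟩
  · rintro ⟨k, rfl⟩
    exact ⟨l k, hx _ k le_rfl (hl (lt_add_one k))⟩

lemma leader_eq (hy : StrictMono y) (hl : StrictMono l)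
    (hx : ∀ i k, l k ≤ i → i < l (k + 1) → x i = y k) {i k : ℤ} (hi : l k ≤ i ∧ i < l (k + 1)) :
    leader x i = l k := by
  have e : {j | x j = x i} = Ico (l k) (l (k + 1)) := by
    ext j
    rw [hx i k hi.1 hi.2]
    exact eq_position_iff hy hl hx
  rw [leader, e]
  exact csInf_Ico (hl (lt_add_one k))

end Clusters

/-- The labels of the `k`-th merged point are those from `labels c t k` on to the next one. -/
lemma location_eq_positions {x : ℤ → ℝ} (hx : Proper x) (c : ℕ → ℤ → Bool) (t : ℕ) :
    ∀ i k, labels c t k ≤ i → i < labels c t (k + 1) → location x c t i = positions x c t k := by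
  induction t with
  | zero =>
    intro i k h1 h2
    have : i = k := by simp only [labels, id] at h1 h2; omega
    rw [this]; rfl
  | succ t ih =>
    intro i j h1 h2
    have hl := labels_strictMono c t
    have hy := hx.positions c t
    obtain ⟨k, hk⟩ := exists_bracket hl i
    set b : ℤ → Bool := fun k => c t (labels c t k) with hb
    -- The new cluster `j` is a block of old clusters delimited by `firstPt`. The coin of the old
    -- cluster `k` is that of its leader, the first label, so `mem_cluster_iff` tells which way it
    -- moves.
    have hcl : firstPt b (occIdx b j) ≤ k ∧ k < firstPt b (occIdx b (j + 1)) := by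
      have h3 := hl.lt_iff_lt.1 (h1.trans_lt hk.2)
      have h4 := hl.lt_iff_lt.1 (hk.1.trans_lt h2)
      exact ⟨Int.lt_add_one_iff.1 h3, h4⟩
    rw [mem_cluster_iff] at hcl
    change step (c t) (location x c t) i = advance b (positions x c t) j
    rw [step, leader_eq hy.1 hl ih hk, range_eq_of_clusters hl ih, ih i k hk.1 hk.2,
      hy.nextPt_range, hy.prevPt_range, advance, ← hcl]
    by_cases h : b k = true
    · rw [if_pos h, if_pos (show c t (labels c t k) = true from h)]
    · rw [if_neg h, if_neg (show ¬ c t (labels c t k) = true from h), sub_add_cancel, add_comm]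

lemma config_eq {x : ℤ → ℝ} (hx : Proper x) (c : ℕ → ℤ → Bool) (t : ℕ) :
    config x c t = range (positions x c t) :=
  range_eq_of_clusters (labels_strictMono c t) (location_eq_positions hx c t)

lemma clusterSize_eq {x : ℤ → ℝ} (hx : Proper x) (c : ℕ → ℤ → Bool) (t : ℕ) (k : ℤ) :
    (clusterSize x c t (positions x c t k) : ℝ) =
      ((labels c t (k + 1) - labels c t k : ℤ) : ℝ) := by
  have hl := labels_strictMono c t
  have e : {i | location x c t i = positions x c t k} =
      (Finset.Ico (labels c t k) (labels c t (k + 1)) : Set ℤ) := by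
    ext i
    rw [Finset.coe_Ico]
    exact eq_position_iff (hx.positions c t).1 hl (location_eq_positions hx c t)
  rw [clusterSize, e, ncard_coe_finset, Int.card_Ico]
  have h := hl (lt_add_one k)
  rw [← Int.cast_natCast, Int.toNat_of_nonneg (by omega)]

lemma measurable_labels (t : ℕ) : Measurable fun c : ℕ → ℤ → Bool => labels c t := by
  induction t with
  | zero => exact measurable_const
  | succ t ih =>
    have hb : Measurable fun (c : ℕ → ℤ → Bool) k => c t (labels c t k) :=
      measurable_pi_lambda _ fun k =>
        measurable_apply_int (measurable_pi_apply t) ((measurable_pi_apply k).comp ih)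
    refine measurable_pi_lambda _ fun j => ?_
    have h := measurable_apply_int ih (measurable_firstPt hb (measurable_occIdx hb j))
    exact h

lemma measurable_positions (t : ℕ) :
    Measurable fun p : (ℤ → ℝ) × (ℕ → ℤ → Bool) => positions p.1 p.2 t := by
  induction t with
  | zero => exact measurable_fst
  | succ t ih =>
    have hb : Measurable fun (p : (ℤ → ℝ) × (ℕ → ℤ → Bool)) k => p.2 t (labels p.2 t k) :=
      measurable_pi_lambda _ fun k =>
        measurable_apply_int ((measurable_pi_apply t).comp measurable_snd)
          ((measurable_pi_apply k).comp ((measurable_labels t).comp measurable_snd))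
    refine measurable_pi_lambda _ fun j => ?_
    have h1 := measurable_apply_int ih (measurable_occIdx hb j)
    have h2 := measurable_apply_int ih ((measurable_occIdx hb j).add_const 1)
    exact ((h1.add h2).div_const 2).const_mul (3 / 4)

/-! ### Stationary renewal processes -/

section Invariant

variable {E : Type*} [MeasurableSpace E]

/-- A translation invariant measure on a product with the real line is a product measure. -/
lemma eq_volume_prod {M : Measure (ℝ × E)} {Q : Measure E} [IsProbabilityMeasure Q]
    (hinv : ∀ s : ℝ, M.map (fun p => (s + p.1, p.2)) = M)
    (h1 : ∀ A, MeasurableSet A → M (Ico (0 : ℝ) 1 ×ˢ A) = Q A) : M = volume.prod Q := by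
  refine (Measure.prod_eq fun B A hB hA => ?_).symm
  -- For fixed `A` this is a translation invariant, locally finite measure on the line, hence a
  -- multiple of Lebesgue measure; the unit interval determines the factor.
  set N : Measure ℝ := (M.restrict (univ ×ˢ A)).map Prod.fst with hN
  have hNB : ∀ B, MeasurableSet B → N B = M (B ×ˢ A) := fun B hB => by
    rw [hN, Measure.map_apply measurable_fst hB, Measure.restrict_apply (measurable_fst hB)]
    congr 1
    ext p
    simp
  have hadd : N.IsAddLeftInvariant := ⟨fun s => by
    ext B hB
    have hm : Measurable fun x : ℝ => s + x := measurable_const_add s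
    have hm2 : Measurable fun p : ℝ × E => (s + p.1, p.2) :=
      (measurable_fst.const_add s).prodMk measurable_snd
    rw [Measure.map_apply hm hB, hNB _ (hm hB), hNB _ hB]
    conv_rhs => rw [← hinv s]
    rw [Measure.map_apply hm2 (hB.prod hA)]
    rfl⟩
  have h01 : N (Ico 0 1) = Q A := by rw [hNB _ measurableSet_Ico, h1 A hA]
  have hfin : IsLocallyFiniteMeasure N := ⟨fun x => by
    refine ⟨Ico (x - 1 / 2) (x + 1 / 2), Ico_mem_nhds (by linarith) (by linarith), ?_⟩
    have h := measure_preimage_add N (x - 1 / 2) (Ico (x - 1 / 2) (x + 1 / 2))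
    rw [preimage_const_add_Ico] at h
    have e1 : x - 1 / 2 - (x - 1 / 2) = 0 := by ring
    have e2 : x + 1 / 2 - (x - 1 / 2) = 1 := by ring
    rw [e1, e2, h01] at h
    rw [← h]
    exact measure_lt_top Q A⟩
  have h2 := Measure.isAddLeftInvariant_eq_smul N volume
  have h3 : N (Ico 0 1) = N.addHaarScalarFactor volume := by
    conv_lhs => rw [h2]
    simp [Measure.smul_apply]
  rw [← hNB B hB, h2, Measure.smul_apply, ← h01, h3, mul_comm]
  rfl

end Invariant

/-- The sequence with given increments that vanishes at `0`. -/
def cumul (g : ℤ → ℝ) (n : ℤ) : ℝ := ∑ i ∈ Finset.Ico 0 n, g i - ∑ i ∈ Finset.Ico n 0, g i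

@[simp] lemma cumul_zero (g : ℤ → ℝ) : cumul g 0 = 0 := by simp [cumul]

lemma cumul_succ (g : ℤ → ℝ) (n : ℤ) : cumul g (n + 1) = cumul g n + g n := by
  unfold cumul
  rcases le_or_gt 0 n with h | h
  · rw [Finset.Ico_eq_empty_of_le (show (0 : ℤ) ≤ n + 1 by omega), Finset.Ico_eq_empty_of_le h,
      Finset.sum_empty, sub_zero, sub_zero, ← Finset.insert_Ico_right_eq_Ico_add_one h,
      Finset.sum_insert (by simp)]
    ring
  · rw [Finset.Ico_eq_empty_of_le (show n + 1 ≤ 0 by omega), Finset.Ico_eq_empty_of_le h.le,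
      Finset.sum_empty, ← Finset.insert_Ico_add_one_left_eq_Ico h, Finset.sum_insert (by simp)]
    ring

lemma cumul_gaps (y : ℤ → ℝ) (n : ℤ) : cumul (gaps y) n = y n - y 0 := by
  induction n using Int.induction_on with
  | zero => simp
  | succ n ih => rw [cumul_succ, ih, gaps]; ring
  | pred n ih =>
    have h := cumul_succ (gaps y) (-n - 1)
    rw [sub_add_cancel, ih, gaps, sub_add_cancel] at h
    linarith

lemma cumul_sub (g : ℤ → ℝ) {i j : ℤ} (h : i ≤ j) :
    cumul g j - cumul g i = ∑ k ∈ Finset.Ico i j, g k := by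
  induction j, h using Int.leInduction with
  | base => simp
  | succ j h ih =>
    rw [cumul_succ, ← Finset.insert_Ico_right_eq_Ico_add_one h, Finset.sum_insert (by simp), ← ih]
    ring

lemma measurable_cumul : Measurable cumul := by
  refine measurable_pi_lambda _ fun n => ?_
  exact (Finset.measurable_sum _ fun i _ => measurable_pi_apply i).sub
    (Finset.measurable_sum _ fun i _ => measurable_pi_apply i)

lemma measurable_gaps : Measurable gaps :=
  measurable_pi_lambda _ fun i => (measurable_pi_apply (i + 1)).sub (measurable_pi_apply i)

lemma recenter_eq_cumul (k : ℤ) (y : ℤ → ℝ) : recenter k y = cumul (gaps (shift k y)) := by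
  ext i
  rw [cumul_gaps]
  simp [recenter, shift]

lemma gaps_recenter (k : ℤ) (y : ℤ → ℝ) : gaps (recenter k y) = gaps (shift k y) := by
  ext i; simp [gaps, recenter, shift]

lemma gaps_translate (s : ℝ) (y : ℤ → ℝ) : gaps (translate s y) = gaps y := by
  ext i; simp [gaps, translate]

lemma measurable_shift_const {β : Type*} [MeasurableSpace β] (k : ℤ) :
    Measurable (shift k : (ℤ → β) → ℤ → β) :=
  measurable_shift measurable_id measurable_const

/-! ### Intensity measure of a stationary process -/

section Stationary

variable {Ω : Type*} [MeasurableSpace Ω] {μ : Measure Ω} {X : Ω → ℤ → ℝ}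

lemma IsUnitStationary.proper (hX : IsUnitStationary μ X) : ∀ᵐ ω ∂μ, Proper (X ω) := by
  filter_upwards [hX.strictMono, hX.tendsto_atTop, hX.tendsto_atBot] with ω h1 h2 h3
  exact ⟨h1, h2, h3⟩

lemma tsum_shift_shift {α : Type*} (f : (ℤ → α) → ℝ≥0∞) (j : ℤ) (x : ℤ → α) :
    ∑' k, f (shift k (shift j x)) = ∑' k, f (shift k x) := by
  simp only [shift_shift]
  exact (Equiv.addLeft j).tsum_eq fun k => f (shift k x)

/-- Sums over all points are invariant under translations. -/
lemma IsUnitStationary.tsum_translate (hX : IsUnitStationary μ X) (s : ℝ)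
    {f : (ℤ → ℝ) → ℝ≥0∞} (hf : Measurable f) :
    ∑' k : ℤ, ∫⁻ ω, f (shift k (translate s (X ω))) ∂μ =
      ∑' k : ℤ, ∫⁻ ω, f (shift k (X ω)) ∂μ := by
  have hXm := hX.measurable
  have hT : Measurable fun ω => translate s (X ω) := measurable_translate measurable_const hXm
  have hsh : ∀ {Y : Ω → ℤ → ℝ}, Measurable Y → ∀ k : ℤ, Measurable fun ω => f (shift k (Y ω)) :=
    fun hY k => hf.comp ((measurable_shift_const k).comp hY)
  rw [← lintegral_tsum fun k => (hsh hT k).aemeasurable,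
    ← lintegral_tsum fun k => (hsh hXm k).aemeasurable]
  have hF : Measurable fun x : ℤ → ℝ => ∑' k : ℤ, f (shift k x) :=
    Measurable.tsum fun k => hf.comp (measurable_shift_const k)
  have h1 : (fun ω => seenFrom (range (X ω)) (-s)) =ᵐ[μ] fun ω => renumber (translate s (X ω)) := by
    filter_upwards [hX.proper] with ω hω
    rw [hω.seenFrom_range, neg_neg]
  have h2 : (fun ω => enum (range (X ω))) =ᵐ[μ] fun ω => renumber (X ω) :=
    enum_range_ae hX.proper
  have h := hX.stationary (-s)
  rw [Measure.map_congr h1, Measure.map_congr h2] at h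
  have hr1 : Measurable fun ω => renumber (translate s (X ω)) := measurable_renumber.comp hT
  have hr2 : Measurable fun ω => renumber (X ω) := measurable_renumber.comp hXm
  have h3 := congrArg (fun m => ∫⁻ x, ∑' k : ℤ, f (shift k x) ∂m) h
  beta_reduce at h3
  rw [lintegral_map hF hr1, lintegral_map hF hr2] at h3
  simpa only [renumber, tsum_shift_shift] using h3

/-- The intensity measure of the points together with the gaps seen from them. -/
def gapMeasure (μ : Measure Ω) (X : Ω → ℤ → ℝ) : Measure (ℝ × (ℤ → ℝ)) :=
  Measure.sum fun k : ℤ => μ.map fun ω => (X ω k, gaps (shift k (X ω)))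

lemma measurable_point_gaps (hX : Measurable X) (k : ℤ) :
    Measurable fun ω => (X ω k, gaps (shift k (X ω))) :=
  ((measurable_pi_apply k).comp hX).prodMk
    (measurable_gaps.comp ((measurable_shift_const k).comp hX))

lemma lintegral_gapMeasure (hX : Measurable X) {f : ℝ × (ℤ → ℝ) → ℝ≥0∞} (hf : Measurable f) :
    ∫⁻ p, f p ∂(gapMeasure μ X) = ∑' k : ℤ, ∫⁻ ω, f (X ω k, gaps (shift k (X ω))) ∂μ := by
  rw [gapMeasure, lintegral_sum_measure]
  exact tsum_congr fun k => lintegral_map hf (measurable_point_gaps hX k)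

/-- The Palm distribution records only the points in [0, 1). Stationarity makes the intensity
measure translation invariant, so this determines it on the whole line. -/
lemma gapMeasure_eq (hX : IsUnitStationary μ X) {Q : Measure (ℤ → ℝ)} [IsProbabilityMeasure Q]
    (hQ : palm μ (fun ω => range (X ω)) (fun ω z => gaps (seenFrom (range (X ω)) z)) = Q) :
    gapMeasure μ X = volume.prod Q := by
  have hXm := hX.measurable
  refine eq_volume_prod (fun s => ?_) fun A hA => ?_
  · refine measure_ext_lintegral fun f hf => ?_
    have hm : Measurable fun p : ℝ × (ℤ → ℝ) => (s + p.1, p.2) :=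
      (measurable_fst.const_add s).prodMk measurable_snd
    have hfm : Measurable fun p : ℝ × (ℤ → ℝ) => f (s + p.1, p.2) := hf.comp hm
    have hg : Measurable fun x : ℤ → ℝ => f (x 0, gaps x) :=
      hf.comp ((measurable_pi_apply 0).prodMk measurable_gaps)
    rw [lintegral_map hf hm, lintegral_gapMeasure hXm hfm, lintegral_gapMeasure hXm hf]
    have h := hX.tsum_translate s hg
    have e1 : ∀ (k : ℤ) (x : ℤ → ℝ), shift k (translate s x) = translate s (shift k x) :=
      fun k x => rfl
    simp only [e1, gaps_translate] at h
    simpa [translate, shift, add_comm] using h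
  · rw [← hQ, ← lintegral_indicator_one hA, ← lintegral_indicator_one (measurableSet_Ico.prod hA),
      lintegral_gapMeasure hXm (measurable_one.indicator (measurableSet_Ico.prod hA)),
      lintegral_palm (Y := X) (G := fun k ω => gaps (shift k (X ω))) hXm
        (fun k => measurable_gaps.comp ((measurable_shift_const k).comp hXm)) ?_
        (measurable_one.indicator hA)]
    · refine tsum_congr fun k => lintegral_congr fun ω => ?_
      simp only [indicator, mem_prod, Pi.one_apply]
      split_ifs <;> simp_all
    · filter_upwards [hX.proper] with ω hω
      refine ⟨hω, rfl, fun k => ?_⟩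
      rw [hω.seenFrom_apply, gaps_recenter]

end Stationary

/-! ### Renewal gaps: mean, positivity and variance -/

section Renewal

variable {Ω : Type*} [MeasurableSpace Ω] {μ : Measure Ω} {X : Ω → ℤ → ℝ} {ν : Measure ℝ}
  [IsProbabilityMeasure ν]

/-- The law of a two-sided random walk with step law `ν`. -/
def walkLaw (ν : Measure ℝ) [IsProbabilityMeasure ν] : Measure (ℤ → ℝ) :=
  (Measure.infinitePi fun _ : ℤ => ν).map cumul

instance : IsProbabilityMeasure (walkLaw ν) :=
  Measure.isProbabilityMeasure_map measurable_cumul.aemeasurable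

lemma walkLaw_zero : ∀ᵐ y ∂(walkLaw ν), y 0 = 0 :=
  (ae_map_iff measurable_cumul.aemeasurable
    (measurable_pi_apply (X := fun _ : ℤ => ℝ) 0 (measurableSet_singleton 0))).2
    (ae_of_all _ cumul_zero)

lemma tsum_lintegral_renewal (hX : Measurable X)
    (h : gapMeasure μ X = volume.prod (Measure.infinitePi fun _ : ℤ => ν))
    {f : ℝ → (ℤ → ℝ) → ℝ≥0∞} (hf : Measurable fun p : ℝ × (ℤ → ℝ) => f p.1 p.2) :
    ∑' k : ℤ, ∫⁻ ω, f (X ω k) (recenter k (X ω)) ∂μ =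
      ∫⁻ y, ∫⁻ x, f x y ∂volume ∂(walkLaw ν) := by
  have hm : Measurable fun p : ℝ × (ℤ → ℝ) => f p.1 (cumul p.2) :=
    hf.comp (measurable_fst.prodMk (measurable_cumul.comp measurable_snd))
  have h1 := lintegral_gapMeasure (μ := μ) hX hm
  rw [h, lintegral_prod_symm _ hm.aemeasurable] at h1
  simp only [recenter_eq_cumul]
  refine h1.symm.trans ?_
  rw [walkLaw, lintegral_map (f := fun y => ∫⁻ x, f x y ∂volume) hf.lintegral_prod_left'
    measurable_cumul]

lemma measurePreserving_eval (k : ℤ) :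
    MeasurePreserving (fun g : ℤ → ℝ => g k) (Measure.infinitePi fun _ : ℤ => ν) ν :=
  measurePreserving_eval_infinitePi (fun _ : ℤ => ν) k

/-- Counts the points that are the first one at or after the origin. There is exactly one in each
configuration, while the product formula yields the mean length of the preceding gap. -/
lemma lintegral_gap_eq_one [IsProbabilityMeasure μ] (hX : IsUnitStationary μ X)
    (h : gapMeasure μ X = volume.prod (Measure.infinitePi fun _ : ℤ => ν)) :
    ∫⁻ x, ENNReal.ofReal x ∂ν = 1 := by
  classical
  have hXm := hX.measurable
  set S : Set (ℝ × (ℤ → ℝ)) := {p | p.1 - p.2 (-1) < 0 ∧ 0 ≤ p.1} with hS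
  have hg : Measurable fun p : ℝ × (ℤ → ℝ) => p.2 (-1) :=
    (measurable_pi_apply (-1)).comp measurable_snd
  have hSm : MeasurableSet S :=
    (measurableSet_lt (measurable_fst.sub hg) measurable_const).inter
      (measurableSet_le measurable_const measurable_fst)
  have h1 := lintegral_gapMeasure (μ := μ) hXm (measurable_one.indicator hSm (f := 1))
  have hm : Measurable (S.indicator (1 : ℝ × (ℤ → ℝ) → ℝ≥0∞)) := measurable_one.indicator hSm
  rw [h, lintegral_prod_symm _ hm.aemeasurable] at h1
  have h2 : ∀ g : ℤ → ℝ, ∫⁻ x, S.indicator (1 : ℝ × (ℤ → ℝ) → ℝ≥0∞) (x, g) ∂volume =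
      ENNReal.ofReal (g (-1)) := fun g => by
    have e : ∀ x : ℝ, S.indicator (1 : ℝ × (ℤ → ℝ) → ℝ≥0∞) (x, g) =
        (Ico 0 (g (-1))).indicator 1 x := fun x => by
      have : (x, g) ∈ S ↔ x ∈ Ico 0 (g (-1)) := by
        simp only [hS, mem_ofPred_eq, mem_Ico, sub_neg]
        exact and_comm
      by_cases hx : x ∈ Ico 0 (g (-1))
      · rw [indicator_of_mem hx, indicator_of_mem (this.2 hx)]; rfl
      · rw [indicator_of_notMem hx, indicator_of_notMem fun h' => hx (this.1 h')]
    simp only [e]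
    rw [lintegral_indicator_one measurableSet_Ico, Real.volume_Ico, sub_zero]
  simp only [h2] at h1
  have h3 : ∑' k : ℤ, ∫⁻ ω, S.indicator (1 : ℝ × (ℤ → ℝ) → ℝ≥0∞)
      (X ω k, gaps (shift k (X ω))) ∂μ = 1 := by
    rw [← lintegral_tsum fun k => by
      have : Measurable fun ω => S.indicator (1 : ℝ × (ℤ → ℝ) → ℝ≥0∞)
        (X ω k, gaps (shift k (X ω))) := hm.comp (measurable_point_gaps hXm k)
      exact this.aemeasurable]
    have h4 : ∀ᵐ ω ∂μ, ∑' k : ℤ, S.indicator (1 : ℝ × (ℤ → ℝ) → ℝ≥0∞)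
        (X ω k, gaps (shift k (X ω))) = 1 := by
      filter_upwards [hX.proper] with ω hω
      refine Eq.trans (tsum_congr fun k => ?_) (hω.tsum_anchored fun _ => 1)
      have : (X ω k, gaps (shift k (X ω))) ∈ S ↔ Anchored (shift k (X ω)) := by
        simp [hS, anchored_shift, gaps, shift, sub_eq_add_neg]
      simp only [indicator, this, Pi.one_apply]
    rw [lintegral_congr_ae h4]
    simp
  have hof : Measurable ENNReal.ofReal := ENNReal.measurable_ofReal
  rw [← (measurePreserving_eval (ν := ν) (-1)).lintegral_comp hof]
  exact h1.trans h3

lemma ae_gap_pos (hX : IsUnitStationary μ X)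
    (h : gapMeasure μ X = volume.prod (Measure.infinitePi fun _ : ℤ => ν)) :
    ∀ᵐ x ∂ν, 0 < x := by
  have hXm := hX.measurable
  have hS : MeasurableSet {x : ℝ | 0 < x}ᶜ := measurableSet_Ioi.compl
  have hA : MeasurableSet {g : ℤ → ℝ | g 0 ∈ {x : ℝ | 0 < x}ᶜ} := measurable_pi_apply 0 hS
  have hm := measurable_one.indicator ((measurableSet_Ico (a := (0 : ℝ)) (b := 1)).prod hA)
    (f := (1 : ℝ × (ℤ → ℝ) → ℝ≥0∞))
  have h1 := lintegral_gapMeasure (μ := μ) hXm hm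
  rw [h, lintegral_indicator_one (measurableSet_Ico.prod hA), Measure.prod_prod, Real.volume_Ico,
    sub_zero, ENNReal.ofReal_one, one_mul] at h1
  have h2 : ∀ k : ℤ, ∫⁻ ω, (Ico (0 : ℝ) 1 ×ˢ {g : ℤ → ℝ | g 0 ∈ {x : ℝ | 0 < x}ᶜ}).indicator
      (1 : ℝ × (ℤ → ℝ) → ℝ≥0∞) (X ω k, gaps (shift k (X ω))) ∂μ = 0 := fun k => by
    refine (lintegral_congr_ae ?_).trans lintegral_zero
    filter_upwards [hX.proper] with ω hω
    refine indicator_of_notMem (fun hh => hh.2 ?_) _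
    have := hω.1 (lt_add_one k)
    simpa [gaps, shift] using this
  simp only [h2, tsum_zero] at h1
  rw [ae_iff]
  exact ((measurePreserving_eval (ν := ν) 0).measure_preimage hS.nullMeasurableSet).symm.trans h1

/-- The variance of a random walk grows linearly. -/
lemma diffusive_walkLaw (h2 : MemLp id 2 ν) (h1 : ∫ x, x ∂ν = 1) :
    Diffusive (walkLaw ν) (fun y => y - lattice) Var[id; ν] where
  measurable := measurable_id.sub_const _
  nonneg := variance_nonneg _ _
  bound i j hij := by
    set P : Measure (ℤ → ℝ) := Measure.infinitePi fun _ : ℤ => ν with hP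
    have hm : Measurable fun y : ℤ → ℝ =>
        ENNReal.ofReal (((y - lattice) j - (y - lattice) i) ^ 2) :=
      ENNReal.measurable_ofReal.comp ((((measurable_pi_apply j).sub_const _).sub
        ((measurable_pi_apply i).sub_const _)).pow_const 2)
    rw [walkLaw, lintegral_map hm measurable_cumul]
    have hL : ∀ k : ℤ, MemLp (fun g : ℤ → ℝ => g k) 2 P := fun k =>
      h2.comp_measurePreserving (measurePreserving_eval k)
    have hI : iIndepFun (fun (k : ℤ) (g : ℤ → ℝ) => g k) P :=
      iIndepFun_infinitePi (P := fun _ : ℤ => ν) (X := fun _ x => x) fun _ => measurable_id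
    set Z : (ℤ → ℝ) → ℝ := ∑ k ∈ Finset.Ico i j, fun g : ℤ → ℝ => g k with hZ
    have hZapp : ∀ g, Z g = ∑ k ∈ Finset.Ico i j, g k := fun g => by simp [hZ]
    have hZL : MemLp Z 2 P := memLp_finsetSum' _ fun k _ => hL k
    have hv : ∀ k : ℤ, Var[fun g : ℤ → ℝ => g k; P] = Var[id; ν] := fun k => by
      have he := measurePreserving_eval (ν := ν) k
      conv_rhs => rw [← he.map_eq]
      exact (variance_map measurable_id.aemeasurable he.measurable.aemeasurable).symm
    have hvar : Var[Z; P] = ((j : ℝ) - i) * Var[id; ν] := by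
      rw [hZ, IndepFun.variance_sum (fun k _ => hL k) fun k _ l _ hkl => hI.indepFun hkl]
      simp only [hv, Finset.sum_const, Int.card_Ico, nsmul_eq_mul]
      congr 1
      rw [← Int.cast_natCast, Int.toNat_of_nonneg (by omega)]
      push_cast; ring
    have hmean : ∫ g, Z g ∂P = (j : ℝ) - i := by
      simp only [hZapp]
      rw [integral_finsetSum _ fun k _ => (hL k).integrable (by norm_num)]
      have : ∀ k : ℤ, ∫ g, g k ∂P = 1 := fun k => by
        rw [← h1]
        have he := measurePreserving_eval (ν := ν) k
        conv_rhs => rw [← he.map_eq]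
        exact (integral_map he.measurable.aemeasurable aestronglyMeasurable_id).symm
      simp only [this, Finset.sum_const, Int.card_Ico, nsmul_eq_mul, mul_one]
      rw [← Int.cast_natCast, Int.toNat_of_nonneg (by omega)]
      push_cast; ring
    have h3 := hZL.ofReal_variance_eq
    rw [evariance_eq_lintegral_ofReal, hmean, hvar] at h3
    rw [mul_comm, h3]
    refine (lintegral_congr fun g => ?_).le
    rw [hZapp, ← cumul_sub g hij]
    simp only [Pi.sub_apply, lattice]
    ring_nf

end Renewal

/-! ### The law of the merged points seen from a typical point -/

/-- The law of independent rows of fair coins. -/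
def fairPath : Measure (ℕ → ℤ → Bool) := Measure.infinitePi fun _ => fairRow

instance : IsProbabilityMeasure fairPath := by unfold fairPath; infer_instance

lemma lintegral_fairPath_shift (k : ℤ) {f : (ℕ → ℤ → Bool) → ℝ≥0∞} (hf : Measurable f) :
    ∫⁻ d, f (fun n => shift k (d n)) ∂fairPath = ∫⁻ d, f d ∂fairPath := by
  have hm : Measurable fun (d : ℕ → ℤ → Bool) n => shift k (d n) :=
    measurable_pi_lambda _ fun n => (measurable_shift_const k).comp (measurable_pi_apply n)
  have h := Measure.infinitePi_map_pi (fun _ : ℕ => fairRow) (f := fun _ => shift k)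
    fun _ => measurable_shift_const k
  have h1 : fairRow.map (shift k) = fairRow := fairRow_map_comp (add_right_injective k)
  rw [h1] at h
  conv_rhs => rw [fairPath, ← h, ← fairPath]
  rw [lintegral_map hf hm]

lemma map_eq_fairPath {Ω : Type*} [MeasurableSpace Ω] {μ : Measure Ω} [IsProbabilityMeasure μ]
    {c : Ω → ℕ → ℤ → Bool} (hc : IsFairCoins μ c) : μ.map c = fairPath := by
  have hm : ∀ k : ℕ × ℤ, Measurable fun ω => c ω k.1 k.2 := fun k =>
    (measurable_pi_apply k.2).comp ((measurable_pi_apply k.1).comp hc.measurable)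
  have h1 := (iIndepFun_iff_map_fun_eq_infinitePi_map hm).1 hc.indep
  have h2 : ∀ k : ℕ × ℤ, μ.map (fun ω => c ω k.1 k.2) = fairCoin := fun k => by
    have : IsProbabilityMeasure (μ.map fun ω => c ω k.1 k.2) :=
      Measure.isProbabilityMeasure_map (hm k).aemeasurable
    have ht : (μ.map fun ω => c ω k.1 k.2) {true} = fairCoin {true} := by
      rw [Measure.map_apply (hm k) (measurableSet_singleton _)]
      refine (hc.fair k.1 k.2).trans ?_
      simp [fairCoin]
    have hf : ({false} : Set Bool) = {true}ᶜ := by ext b; cases b <;> simp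
    refine Measure.ext_of_singleton fun b => ?_
    cases b
    · rw [hf, prob_compl_eq_one_sub (measurableSet_singleton _),
        prob_compl_eq_one_sub (measurableSet_singleton _), ht]
    · exact ht
  simp only [h2] at h1
  -- The coins are independent over pairs of a time and a label; currying groups them into
  -- independent rows.
  have h3 := Measure.infinitePi_map_curry (ι := ℕ) (κ := ℤ) fun _ _ => fairCoin
  rw [← h1, Measure.map_map (MeasurableEquiv.measurable _) (measurable_pi_lambda _ hm)] at h3
  exact h3

/-- One step of the positions and of the first labels, seen from a typical point. -/
def pairStep (b : ℤ → Bool) (p : (ℤ → ℝ) × (ℤ → ℤ)) : (ℤ → ℝ) × (ℤ → ℤ) :=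
  (thin b p.1, merge b p.2)

lemma measurable_pairStep :
    Measurable fun q : (ℤ → Bool) × ((ℤ → ℝ) × (ℤ → ℤ)) => pairStep q.1 q.2 :=
  (measurable_thin measurable_fst (measurable_fst.comp measurable_snd)).prodMk
    (measurable_merge measurable_fst (measurable_snd.comp measurable_snd))

lemma iter_pairStep (t : ℕ) (s : ℕ → ℤ → Bool) (p : (ℤ → ℝ) × (ℤ → ℤ)) :
    iter pairStep t s p = (iter thin t s p.1, iter merge t s p.2) := by
  induction t generalizing s with
  | zero => rfl
  | succ t ih => simp only [iter, ih]; rfl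

lemma iter_merge_strictMono (t : ℕ) (s : ℕ → ℤ → Bool) {l : ℤ → ℤ} (hl : StrictMono l) :
    StrictMono (iter merge t s l) := by
  induction t generalizing s with
  | zero => exact hl
  | succ t ih => exact merge_strictMono (ih _)

/-- The positions and the first labels at time `t`, seen from a typical point. -/
def palmState (t : ℕ) (q : (ℕ → ℤ → Bool) × (ℤ → ℝ)) : (ℤ → ℝ) × (ℤ → ℤ) :=
  iter pairStep t q.1 (q.2, id)

lemma measurable_palmState (t : ℕ) : Measurable (palmState t) :=
  (measurable_iter measurable_pairStep t).comp
    (measurable_fst.prodMk (measurable_snd.prodMk measurable_const))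

lemma palmState_snd_strictMono (t : ℕ) (q : (ℕ → ℤ → Bool) × (ℤ → ℝ)) :
    StrictMono (palmState t q).2 := by
  rw [palmState, iter_pairStep]
  exact iter_merge_strictMono t _ strictMono_id

/-- The outermost row belongs to the latest step, so in law one more step of time is one fresh
`pairStep` applied to the state at time `t`. -/
lemma lintegral_palmState_succ (ρ : Measure (ℤ → ℝ)) [IsProbabilityMeasure ρ] (t : ℕ)
    {f : (ℤ → ℝ) × (ℤ → ℤ) → ℝ≥0∞} (hf : Measurable f) :
    ∫⁻ q, f (palmState (t + 1) q) ∂(palmPath.prod ρ) =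
      ∫⁻ q, ∫⁻ b, f (pairStep b (palmState t q)) ∂palmRow ∂(palmPath.prod ρ) := by
  have hm : Measurable fun r : (ℤ → Bool) × ((ℕ → ℤ → Bool) × (ℤ → ℝ)) =>
      f (pairStep r.1 (palmState t r.2)) :=
    hf.comp (measurable_pairStep.comp
      (measurable_fst.prodMk ((measurable_palmState t).comp measurable_snd)))
  have h := lintegral_headTail (measurePreserving_palmPath_prod ρ)
    (f := fun b q => f (pairStep b (palmState t q))) hm
  refine Eq.trans h (lintegral_lintegral_swap hm.aemeasurable)

/-- The coins used by the points, seen from a point with first label `l`. -/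
def coinsFrom (c : ℕ → ℤ → Bool) (t : ℕ) (l : ℤ) : ℕ → ℤ → Bool := fun n => shift l (c (t + n))

lemma measurable_coinsFrom {α : Type*} [MeasurableSpace α] {c : α → ℕ → ℤ → Bool} {l : α → ℤ}
    (hc : Measurable c) (t : ℕ) (hl : Measurable l) :
    Measurable fun a => coinsFrom (c a) t (l a) :=
  measurable_pi_lambda _ fun n => measurable_shift ((measurable_pi_apply (t + n)).comp hc) hl

/-- The observable of the next step, as an observable of the present. -/
def pullback (h : ℝ → (ℤ → ℝ) × (ℤ → ℤ) → (ℕ → ℤ → Bool) → ℝ≥0∞) (x : ℝ)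
    (p : (ℤ → ℝ) × (ℤ → ℤ)) (d : ℕ → ℤ → Bool) : ℝ≥0∞ :=
  if Occ (fun k => d 0 (p.2 k)) 0 then
    -- `x` stands for the left end of the gap and `p.1` for the positions seen from it, so the
    -- bracket is the midpoint. The later coins are seen from the first label of the new cluster.
    h (3 / 4 * (x + p.1 1 / 2)) (pairStep (fun k => d 0 (p.2 k)) p)
      (fun n => shift (p.2 (firstPt (fun k => d 0 (p.2 k)) 0)) (d (n + 1)))
  else 0

/-! ### One step of the Campbell formula -/

section Pullback

variable {h : ℝ → (ℤ → ℝ) × (ℤ → ℤ) → (ℕ → ℤ → Bool) → ℝ≥0∞}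

lemma measurable_pullback
    (hh : Measurable fun q : ℝ × ((ℤ → ℝ) × (ℤ → ℤ)) × (ℕ → ℤ → Bool) => h q.1 q.2.1 q.2.2) :
    Measurable fun q : ℝ × ((ℤ → ℝ) × (ℤ → ℤ)) × (ℕ → ℤ → Bool) =>
      pullback h q.1 q.2.1 q.2.2 := by
  have hl : Measurable fun q : ℝ × ((ℤ → ℝ) × (ℤ → ℤ)) × (ℕ → ℤ → Bool) => q.2.1.2 :=
    measurable_snd.comp (measurable_fst.comp measurable_snd)
  have hd : ∀ n, Measurable fun q : ℝ × ((ℤ → ℝ) × (ℤ → ℤ)) × (ℕ → ℤ → Bool) => q.2.2 n :=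
    fun n => (measurable_pi_apply n).comp (measurable_snd.comp measurable_snd)
  have hb : Measurable fun (q : ℝ × ((ℤ → ℝ) × (ℤ → ℤ)) × (ℕ → ℤ → Bool)) k =>
      q.2.2 0 (q.2.1.2 k) :=
    measurable_pi_lambda _ fun k => measurable_apply_int (hd 0) ((measurable_pi_apply k).comp hl)
  have hv : Measurable fun q : ℝ × ((ℤ → ℝ) × (ℤ → ℤ)) × (ℕ → ℤ → Bool) =>
      q.2.1.2 (firstPt (fun k => q.2.2 0 (q.2.1.2 k)) 0) :=
    measurable_apply_int hl (measurable_firstPt hb measurable_const)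
  have h1 : Measurable fun q : ℝ × ((ℤ → ℝ) × (ℤ → ℤ)) × (ℕ → ℤ → Bool) =>
      3 / 4 * (q.1 + q.2.1.1 1 / 2) := by
    have hy : Measurable fun q : ℝ × ((ℤ → ℝ) × (ℤ → ℤ)) × (ℕ → ℤ → Bool) => q.2.1.1 1 :=
      (measurable_pi_apply 1).comp (measurable_fst.comp (measurable_fst.comp measurable_snd))
    exact (measurable_fst.add (hy.div_const 2)).const_mul _
  have h2 : Measurable fun q : ℝ × ((ℤ → ℝ) × (ℤ → ℤ)) × (ℕ → ℤ → Bool) =>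
      pairStep (fun k => q.2.2 0 (q.2.1.2 k)) q.2.1 :=
    measurable_pairStep.comp (hb.prodMk (measurable_fst.comp measurable_snd))
  have h3 : Measurable fun (q : ℝ × ((ℤ → ℝ) × (ℤ → ℤ)) × (ℕ → ℤ → Bool)) n =>
      shift (q.2.1.2 (firstPt (fun k => q.2.2 0 (q.2.1.2 k)) 0)) (q.2.2 (n + 1)) :=
    measurable_pi_lambda _ fun n => measurable_shift (hd (n + 1)) hv
  exact Measurable.ite (measurableSet_occ hb measurable_const)
    (hh.comp (h1.prodMk (h2.prodMk h3))) measurable_const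

lemma pullback_of_occ {y : ℤ → ℝ} {l : ℤ → ℤ} {c : ℕ → ℤ → Bool} {t : ℕ} (j : ℤ) :
    pullback h (y (occIdx (fun k => c t (l k)) j))
      (recenter (occIdx (fun k => c t (l k)) j) y, recenter (occIdx (fun k => c t (l k)) j) l)
      (coinsFrom c t (l (occIdx (fun k => c t (l k)) j))) =
    h (advance (fun k => c t (l k)) y j)
      (recenter j (advance (fun k => c t (l k)) y), recenter j (relabel (fun k => c t (l k)) l))
      (coinsFrom c (t + 1) (relabel (fun k => c t (l k)) l j)) := by
  set b : ℤ → Bool := fun k => c t (l k) with hb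
  set e := occIdx b j with he
  have hrow : (fun k => coinsFrom c t (l e) 0 (recenter e l k)) = shift e b := by
    ext k
    simp [coinsFrom, shift, recenter, hb]
  have h0 : Occ (shift e b) 0 := by rw [occ_shift, add_zero]; exact occ_occIdx j
  simp only [pullback, hrow, h0, if_true]
  congr 1
  · simp only [advance, recenter, ← he]; ring
  · rw [recenter_advance, recenter_relabel]; rfl
  · ext n i
    simp only [coinsFrom, shift, recenter, relabel, firstPt_shift, add_zero, add_sub_cancel, ← he]
    congr 1
    · rw [add_assoc t 1 n, add_comm 1 n]
    · ring

lemma pullback_of_not_occ {x : ℝ} {y : ℤ → ℝ} {l : ℤ → ℤ} {c : ℕ → ℤ → Bool} {t : ℕ} {k : ℤ}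
    (hk : ¬ Occ (fun k => c t (l k)) k) :
    pullback h x (recenter k y, recenter k l) (coinsFrom c t (l k)) = 0 := by
  have hrow : (fun i => coinsFrom c t (l k) 0 (recenter k l i)) = shift k fun i => c t (l i) := by
    ext i
    simp [coinsFrom, shift, recenter]
  rw [pullback, hrow, if_neg]
  rwa [occ_shift, add_zero]

/-- New points correspond to occupied gaps, and `pullback` vanishes at empty ones. So a sum over new
points is a sum over all old points. -/
lemma tsum_pullback (y : ℤ → ℝ) (l : ℤ → ℤ) (c : ℕ → ℤ → Bool) (t : ℕ) :
    ∑' j, h (advance (fun k => c t (l k)) y j)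
      (recenter j (advance (fun k => c t (l k)) y), recenter j (relabel (fun k => c t (l k)) l))
      (coinsFrom c (t + 1) (relabel (fun k => c t (l k)) l j)) =
    ∑' k, pullback h (y k) (recenter k y, recenter k l) (coinsFrom c t (l k)) := by
  simp only [← pullback_of_occ]
  refine (occIdx_strictMono fun k => c t (l k)).injective.tsum_eq
    (f := fun k => pullback h (y k) (recenter k y, recenter k l) (coinsFrom c t (l k))) ?_
  intro k hk
  rw [range_occIdx]
  by_contra hne
  exact hk (pullback_of_not_occ hne)

lemma lintegral_three_quarters {φ : ℝ → ℝ≥0∞} (hφ : Measurable φ) (v : ℝ) :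
    ∫⁻ x, φ (3 / 4 * (x + v)) = 4 / 3 * ∫⁻ x, φ x := by
  rw [lintegral_add_right_eq_self (fun x => φ (3 / 4 * x)) v]
  have h := Real.map_volume_mul_left (a := 3 / 4) (by norm_num)
  have hm : Measurable fun x : ℝ => 3 / 4 * x := measurable_id.const_mul _
  have h1 : ∫⁻ x, φ (3 / 4 * x) = ∫⁻ x, φ x ∂((volume : Measure ℝ).map fun x => 3 / 4 * x) :=
    (lintegral_map hφ hm).symm
  rw [h1, h, lintegral_smul_measure, smul_eq_mul]
  congr 1
  rw [show |(3 / 4 : ℝ)⁻¹| = 4 / 3 by norm_num, ENNReal.ofReal_div_of_pos (by norm_num)]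
  norm_num

/-- Averaging the observable of the next step over space and over the coins. -/
lemma lintegral_pullback
    (hh : Measurable fun q : ℝ × ((ℤ → ℝ) × (ℤ → ℤ)) × (ℕ → ℤ → Bool) => h q.1 q.2.1 q.2.2)
    (p : (ℤ → ℝ) × (ℤ → ℤ)) (hp : StrictMono p.2) :
    ∫⁻ d, ∫⁻ x, pullback h x p d ∂volume ∂fairPath =
      ∫⁻ b, ∫⁻ d, ∫⁻ x, h x (pairStep b p) d ∂volume ∂fairPath ∂palmRow := by
  classical
  have hH : Measurable fun q : ((ℤ → ℝ) × (ℤ → ℤ)) × (ℕ → ℤ → Bool) =>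
      ∫⁻ x, h x q.1 q.2 ∂volume := hh.lintegral_prod_left'
  have hx : ∀ p d, Measurable fun x => h x p d := fun p d =>
    hh.comp (measurable_id.prodMk (measurable_const (a := (p, d))))
  -- Scaling space by 3/4 produces 4/3, exactly the normalization of `palmRow`: the intensity stays
  -- one.
  have h1 : ∀ d : ℕ → ℤ → Bool, ∫⁻ x, pullback h x p d ∂volume =
      if Occ (fun k => d 0 (p.2 k)) 0 then
        4 / 3 * ∫⁻ x, h x (pairStep (fun k => d 0 (p.2 k)) p)
          (fun n => shift (p.2 (firstPt (fun k => d 0 (p.2 k)) 0)) (d (n + 1))) ∂volume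
      else 0 := fun d => by
    unfold pullback
    split_ifs
    · exact lintegral_three_quarters (φ := fun x => h x (pairStep (fun k => d 0 (p.2 k)) p)
        (fun n => shift (p.2 (firstPt (fun k => d 0 (p.2 k)) 0)) (d (n + 1))))
        (hx _ _) (p.1 1 / 2)
    · simp
  have hmeas : Measurable fun d : ℕ → ℤ → Bool => ∫⁻ x, pullback h x p d ∂volume := by
    have h2 : Measurable fun q : ((ℤ → ℝ) × (ℤ → ℤ)) × (ℕ → ℤ → Bool) =>
        ∫⁻ x, pullback h x q.1 q.2 ∂volume := (measurable_pullback hh).lintegral_prod_left'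
    exact h2.comp measurable_prodMk_left
  have h2 : ∀ b : ℤ → Bool, ∫⁻ d, ∫⁻ x, pullback h x p (cons b d) ∂volume ∂fairPath =
      {b | Occ b 0}.indicator (fun b => 4 / 3 * ∫⁻ d, ∫⁻ x, h x (pairStep b p) d ∂volume ∂fairPath)
        (fun k => b (p.2 k)) := fun b => by
    simp only [h1, cons_zero, cons_succ]
    by_cases hb : Occ (fun k => b (p.2 k)) 0
    · rw [indicator_of_mem (show (fun k => b (p.2 k)) ∈ {b | Occ b 0} from hb)]
      simp only [hb, if_true]
      have hm : Measurable fun d : ℕ → ℤ → Bool =>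
          ∫⁻ x, h x (pairStep (fun k => b (p.2 k)) p) d ∂volume := hH.comp measurable_prodMk_left
      rw [lintegral_const_mul _ ?_, lintegral_fairPath_shift _ hm]
      exact hm.comp (measurable_pi_lambda _ fun n =>
        (measurable_shift_const _).comp (measurable_pi_apply n))
    · rw [indicator_of_notMem (show (fun k => b (p.2 k)) ∉ {b | Occ b 0} from hb)]
      simp [hb]
  rw [fairPath, lintegral_infinitePi_cons _ hmeas, ← fairPath]
  simp only [h2]
  have hm : Measurable fun b : ℤ → Bool =>
      ∫⁻ d, ∫⁻ x, h x (pairStep b p) d ∂volume ∂fairPath := by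
    have h3 : Measurable fun p : (ℤ → ℝ) × (ℤ → ℤ) => ∫⁻ d, ∫⁻ x, h x p d ∂volume ∂fairPath :=
      hH.lintegral_prod_right'
    exact h3.comp (measurable_pairStep.comp measurable_prodMk_right)
  -- Distinct clusters have distinct first labels, so the coins they read form again a fair row.
  rw [lintegral_fairRow_comp hp.injective ((hm.const_mul (4 / 3)).indicator measurableSet_occ_zero),
    lintegral_indicator measurableSet_occ_zero, lintegral_const_mul _ hm, lintegral_palmRow]

end Pullback

/-! ### Campbell's formula at all times -/

section Campbell

variable {Ω : Type*} [MeasurableSpace Ω] {μ : Measure Ω} {X : Ω → ℤ → ℝ}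
  {c : Ω → ℕ → ℤ → Bool} {ν : Measure ℝ} [IsProbabilityMeasure ν]

/-- Campbell's formula for the initial points. -/
lemma campbell_zero [IsProbabilityMeasure μ] (hX : Measurable X) (hc : IsFairCoins μ c)
    (hXc : IndepFun X c μ)
    (hν : gapMeasure μ X = volume.prod (Measure.infinitePi fun _ : ℤ => ν))
    {h : ℝ → (ℤ → ℝ) × (ℤ → ℤ) → (ℕ → ℤ → Bool) → ℝ≥0∞}
    (hh : Measurable fun q : ℝ × ((ℤ → ℝ) × (ℤ → ℤ)) × (ℕ → ℤ → Bool) => h q.1 q.2.1 q.2.2) :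
    ∑' k : ℤ, ∫⁻ ω, h (X ω k) (recenter k (X ω), id) (coinsFrom (c ω) 0 k) ∂μ =
      ∫⁻ y, ∫⁻ d, ∫⁻ x, h x (y, id) d ∂volume ∂fairPath ∂(walkLaw ν) := by
  have hcm := hc.measurable
  have hlaw : μ.map (fun ω => (X ω, c ω)) = (μ.map X).prod fairPath := by
    rw [(indepFun_iff_map_prod_eq_prod_map_map hX.aemeasurable hcm.aemeasurable).1 hXc,
      map_eq_fairPath hc]
  have hid : Measurable fun q : ℝ × (ℤ → ℝ) × (ℕ → ℤ → Bool) => h q.1 (q.2.1, id) q.2.2 :=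
    hh.comp (measurable_fst.prodMk (((measurable_fst.comp measurable_snd).prodMk
      measurable_const).prodMk (measurable_snd.comp measurable_snd)))
  have hφ : Measurable fun p : ℝ × (ℤ → ℝ) => ∫⁻ d, h p.1 (p.2, id) d ∂fairPath := by
    have : Measurable fun q : (ℝ × (ℤ → ℝ)) × (ℕ → ℤ → Bool) => h q.1.1 (q.1.2, id) q.2 :=
      hid.comp ((measurable_fst.comp measurable_fst).prodMk
        ((measurable_snd.comp measurable_fst).prodMk measurable_snd))
    exact this.lintegral_prod_right'
  have h1 : ∀ k : ℤ, ∫⁻ ω, h (X ω k) (recenter k (X ω), id) (coinsFrom (c ω) 0 k) ∂μ =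
      ∫⁻ ω, ∫⁻ d, h (X ω k) (recenter k (X ω), id) d ∂fairPath ∂μ := fun k => by
    have hm : Measurable fun q : (ℤ → ℝ) × (ℕ → ℤ → Bool) =>
        h (q.1 k) (recenter k q.1, id) (coinsFrom q.2 0 k) :=
      hid.comp (((measurable_pi_apply k).comp measurable_fst).prodMk
        (((measurable_recenter_const k).comp measurable_fst).prodMk
          (measurable_coinsFrom measurable_snd 0 measurable_const)))
    have hm2 : Measurable fun x : ℤ → ℝ => ∫⁻ d, h (x k) (recenter k x, id) d ∂fairPath :=
      hφ.comp ((measurable_pi_apply k).prodMk (measurable_recenter_const k))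
    have h2 := lintegral_map (μ := μ) hm (hX.prodMk hcm)
    rw [hlaw, lintegral_prod _ hm.aemeasurable] at h2
    refine h2.symm.trans ?_
    have h3 : ∀ x : ℤ → ℝ, ∫⁻ d, h (x k) (recenter k x, id) (coinsFrom d 0 k) ∂fairPath =
        ∫⁻ d, h (x k) (recenter k x, id) d ∂fairPath := fun x => by
      have hm3 : Measurable fun d => h (x k) (recenter k x, id) d :=
        hid.comp (measurable_const.prodMk (measurable_const.prodMk measurable_id))
      refine Eq.trans (lintegral_congr fun d => ?_) (lintegral_fairPath_shift k hm3)
      have : coinsFrom d 0 k = fun n => shift k (d n) := by ext n; simp [coinsFrom]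
      rw [this]
    exact (lintegral_congr h3).trans (lintegral_map hm2 hX)
  rw [tsum_congr h1, tsum_lintegral_renewal (f := fun x y => ∫⁻ d, h x (y, id) d ∂fairPath) hX hν hφ]
  refine lintegral_congr fun y => ?_
  refine lintegral_lintegral_swap (Measurable.aemeasurable ?_)
  exact hid.comp (measurable_fst.prodMk (measurable_const.prodMk measurable_snd))

/-- Campbell's formula for the merged points at time `t`. -/
lemma campbell [IsProbabilityMeasure μ] (hX : Measurable X) (hc : IsFairCoins μ c)
    (hXc : IndepFun X c μ)
    (hν : gapMeasure μ X = volume.prod (Measure.infinitePi fun _ : ℤ => ν)) (t : ℕ)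
    {h : ℝ → (ℤ → ℝ) × (ℤ → ℤ) → (ℕ → ℤ → Bool) → ℝ≥0∞}
    (hh : Measurable fun q : ℝ × ((ℤ → ℝ) × (ℤ → ℤ)) × (ℕ → ℤ → Bool) => h q.1 q.2.1 q.2.2) :
    ∑' k : ℤ, ∫⁻ ω, h (positions (X ω) (c ω) t k)
        (recenter k (positions (X ω) (c ω) t), recenter k (labels (c ω) t))
        (coinsFrom (c ω) t (labels (c ω) t k)) ∂μ =
      ∫⁻ q, ∫⁻ d, ∫⁻ x, h x (palmState t q) d ∂volume ∂fairPath ∂(palmPath.prod (walkLaw ν)) := by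
  have hcm := hc.measurable
  have hpos : ∀ t, Measurable fun ω => positions (X ω) (c ω) t := fun t =>
    (measurable_positions t).comp (hX.prodMk hcm)
  have hlab : ∀ t, Measurable fun ω => labels (c ω) t := fun t => (measurable_labels t).comp hcm
  have hterm : ∀ (t : ℕ) (k : ℤ) {h : ℝ → (ℤ → ℝ) × (ℤ → ℤ) → (ℕ → ℤ → Bool) → ℝ≥0∞},
      (Measurable fun q : ℝ × ((ℤ → ℝ) × (ℤ → ℤ)) × (ℕ → ℤ → Bool) => h q.1 q.2.1 q.2.2) →
      Measurable fun ω => h (positions (X ω) (c ω) t k)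
        (recenter k (positions (X ω) (c ω) t), recenter k (labels (c ω) t))
        (coinsFrom (c ω) t (labels (c ω) t k)) := fun t k h hh =>
    hh.comp (((measurable_pi_apply k).comp (hpos t)).prodMk
      (((measurable_recenter (hpos t) measurable_const).prodMk
        (measurable_recenter (hlab t) measurable_const)).prodMk
        (measurable_coinsFrom hcm t ((measurable_pi_apply k).comp (hlab t)))))
  -- The observable must be arbitrary and see the future coins: the induction step replaces `h` by
  -- `pullback h`, which reads the coins of the step from `t` to `t + 1`.
  induction t generalizing h with
  | zero =>
    have h0 := campbell_zero hX hc hXc hν hh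
    have hid : ∀ k : ℤ, recenter k (id : ℤ → ℤ) = id := fun k => by ext i; simp [recenter]
    simp only [labels, positions, hid, id]
    refine h0.trans ?_
    have hm : Measurable fun y : ℤ → ℝ => ∫⁻ d, ∫⁻ x, h x (y, id) d ∂volume ∂fairPath := by
      have h1 : Measurable fun q : ((ℤ → ℝ) × (ℤ → ℤ)) × (ℕ → ℤ → Bool) =>
        ∫⁻ x, h x q.1 q.2 ∂volume := hh.lintegral_prod_left'
      have h2 : Measurable fun p : (ℤ → ℝ) × (ℤ → ℤ) => ∫⁻ d, ∫⁻ x, h x p d ∂volume ∂fairPath :=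
        h1.lintegral_prod_right'
      exact h2.comp measurable_prodMk_right
    exact (measurePreserving_snd (μ := palmPath) (ν := walkLaw ν)).lintegral_comp hm |>.symm
  | succ t ih =>
    have hp := measurable_pullback hh
    rw [← lintegral_tsum fun k => (hterm (t + 1) k hh).aemeasurable]
    have e : ∀ ω, ∑' k, h (positions (X ω) (c ω) (t + 1) k)
        (recenter k (positions (X ω) (c ω) (t + 1)), recenter k (labels (c ω) (t + 1)))
        (coinsFrom (c ω) (t + 1) (labels (c ω) (t + 1) k)) =
        ∑' k, pullback h (positions (X ω) (c ω) t k)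
        (recenter k (positions (X ω) (c ω) t), recenter k (labels (c ω) t))
        (coinsFrom (c ω) t (labels (c ω) t k)) := fun ω => tsum_pullback _ _ _ _
    simp only [e]
    rw [lintegral_tsum fun k => (hterm t k hp).aemeasurable, ih hp]
    have h1 : Measurable fun q : ((ℤ → ℝ) × (ℤ → ℤ)) × (ℕ → ℤ → Bool) =>
        ∫⁻ x, h x q.1 q.2 ∂volume := hh.lintegral_prod_left'
    have h2 : Measurable fun p : (ℤ → ℝ) × (ℤ → ℤ) => ∫⁻ d, ∫⁻ x, h x p d ∂volume ∂fairPath :=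
      h1.lintegral_prod_right'
    rw [lintegral_palmState_succ (walkLaw ν) t h2]
    exact lintegral_congr fun q => lintegral_pullback hh _ (palmState_snd_strictMono t q)

end Campbell

/-! ### Convergence in `Lᵖ` from bounded moments -/

section Moments

variable {Ω : Type*} [MeasurableSpace Ω] {P : Measure Ω}

/-- Hölder's inequality gives ‖f 1_s‖_p ≤ K μ(s)^a with a = 1/p - 1/q > 0. `K` is enlarged to a
positive `M` so that one can divide by it. -/
lemma unifIntegrable_of_eLpNorm_le {f : ℕ → Ω → ℝ} {p q K : ℝ≥0∞} (hf : ∀ n, Measurable (f n))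
    (hp : 0 < p) (hpq : p < q) (hq : q ≠ ∞) (hK : K ≠ ∞) (h : ∀ n, eLpNorm (f n) q P ≤ K) :
    UnifIntegrable f p P := by
  intro ε hε
  have hpt : 0 < p.toReal := ENNReal.toReal_pos hp.ne' (hpq.trans_le le_top).ne
  have hlt : p.toReal < q.toReal := (ENNReal.toReal_lt_toReal (hpq.trans_le le_top).ne hq).2 hpq
  set a : ℝ := 1 / p.toReal - 1 / q.toReal with ha
  have ha0 : 0 < a := sub_pos.2 (one_div_lt_one_div_of_lt hpt hlt)
  set M : ℝ := K.toReal + 1 with hM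
  have hM0 : 0 < M := add_pos_of_nonneg_of_pos ENNReal.toReal_nonneg one_pos
  have hKM : K ≤ ENNReal.ofReal M := by
    rw [ENNReal.le_ofReal_iff_toReal_le hK hM0.le]
    exact (lt_add_one _).le
  refine ⟨(ε / M) ^ (1 / a), Real.rpow_pos_of_pos (div_pos hε hM0) _, fun n s hs hμs => ?_⟩
  rw [eLpNorm_indicator_eq_eLpNorm_restrict hs]
  have h1 := eLpNorm_le_eLpNorm_mul_rpow_measure_univ (μ := P.restrict s) hpq.le
    (hf n).aestronglyMeasurable
  rw [Measure.restrict_apply_univ] at h1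
  refine h1.trans ?_
  have h2 : eLpNorm (f n) q (P.restrict s) ≤ ENNReal.ofReal M :=
    (eLpNorm_mono_measure _ Measure.restrict_le_self).trans ((h n).trans hKM)
  have h3 : P s ^ a ≤ ENNReal.ofReal (ε / M) := by
    refine (ENNReal.rpow_le_rpow hμs ha0.le).trans ?_
    rw [ENNReal.ofReal_rpow_of_nonneg (Real.rpow_nonneg (div_pos hε hM0).le _) ha0.le,
      ← Real.rpow_mul (div_pos hε hM0).le, one_div_mul_cancel ha0.ne', Real.rpow_one]
  refine (mul_le_mul' h2 h3).trans ?_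
  rw [← ENNReal.ofReal_mul hM0.le, mul_div_cancel₀ _ hM0.ne']

/-- A bounded integer moment of order above `p` gives uniform integrability in Lᵖ; Vitali's theorem
concludes. -/
lemma tendsto_Lp_of_moments [IsProbabilityMeasure P] {W : ℕ → Ω → ℝ} {V : Ω → ℝ} (hW : ∀ t, Measurable (W t))
    (hV : Measurable V) (h0 : ∀ t ω, 0 ≤ W t ω)
    (hM : ∀ n : ℕ, ∃ M : ℝ, ∀ t, ∫⁻ ω, ENNReal.ofReal (W t ω ^ (n + 1)) ∂P ≤ ENNReal.ofReal M)
    (hlim : ∀ᵐ ω ∂P, Tendsto (fun t => W t ω) atTop (𝓝 (V ω))) {p : ℝ≥0∞} (hp : 1 ≤ p)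
    (hp' : p < ∞) :
    MemLp V p P ∧ Tendsto (fun t => eLpNorm (W t - V) p P) atTop (𝓝 0) := by
  obtain ⟨n, hn⟩ := exists_nat_gt p.toReal
  obtain ⟨M, hM⟩ := hM n
  have hpq : p < ((n + 1 : ℕ) : ℝ≥0∞) := by
    rw [← ENNReal.ofReal_toReal hp'.ne, ← ENNReal.ofReal_natCast,
      ENNReal.ofReal_lt_ofReal_iff (by positivity)]
    push_cast
    linarith
  have hq : ((n + 1 : ℕ) : ℝ≥0∞) ≠ ∞ := ENNReal.natCast_ne_top _
  set K : ℝ≥0∞ := ENNReal.ofReal M ^ (1 / ((n + 1 : ℕ) : ℝ)) with hK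
  have hKtop : K ≠ ∞ := ENNReal.rpow_ne_top_of_nonneg (by positivity) ENNReal.ofReal_ne_top
  have hb : ∀ t, eLpNorm (W t) (n + 1 : ℕ) P ≤ K := fun t => by
    rw [eLpNorm_eq_lintegral_rpow_enorm_toReal (by simp) hq, ENNReal.toReal_natCast]
    refine ENNReal.rpow_le_rpow (le_trans (lintegral_mono fun ω => ?_) (hM t)) (by positivity)
    rw [ENNReal.rpow_natCast, Real.enorm_of_nonneg (h0 t ω), ENNReal.ofReal_pow (h0 t ω)]
  have hVq : MemLp V (n + 1 : ℕ) P := by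
    refine ⟨hV.aestronglyMeasurable, lt_of_le_of_lt ?_ hKtop.lt_top⟩
    refine (Lp.eLpNorm_lim_le_liminf_eLpNorm (fun t => (hW t).aestronglyMeasurable) V hlim).trans ?_
    exact (liminf_le_liminf (Eventually.of_forall hb)).trans (by simp)
  have hVp : MemLp V p P := hVq.mono_exponent hpq.le
  exact ⟨hVp, tendsto_Lp_finite_of_tendsto_ae hp hp'.ne (fun t => (hW t).aestronglyMeasurable) hVp
    (unifIntegrable_of_eLpNorm_le hW (zero_lt_one.trans_le hp) hpq hq hKtop hb) hlim⟩

end Moments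

/-! ### Laws at time `t` and their limits -/

/-- Identifies the real sequences of the contraction argument with rescaled integer labels. These
vanish at the index 0, so the value at 1 is the rescaled size of the cluster at the origin. -/
lemma iter_mergeMass_lattice (t : ℕ) (s : ℕ → ℤ → Bool) (j : ℤ) :
    iter mergeMass t s lattice j = (3 / 4 : ℝ) ^ t * ((iter merge t s (id : ℤ → ℤ) j : ℤ) : ℝ) := by
  induction t generalizing s j with
  | zero => simp [iter, lattice]
  | succ t ih =>
    simp only [iter, mergeMass, merge, ih]
    push_cast
    ring

/-- The rescaled size of the cluster at the origin at time `t`, seen from a typical point. -/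
def mass (t : ℕ) (s : ℕ → ℤ → Bool) : ℝ := iter mergeMass t s lattice 1

lemma measurable_mass (t : ℕ) : Measurable (mass t) :=
  (measurable_pi_apply 1).comp (measurable_iter_lattice contracting_mergeMass t)

lemma mass_nonneg (t : ℕ) (s : ℕ → ℤ → Bool) : 0 ≤ mass t s := by
  rw [mass, iter_mergeMass_lattice]
  have h0 : iter merge t s (id : ℤ → ℤ) 0 = 0 := by
    cases t with
    | zero => rfl
    | succ t => simp [iter, merge]
  have h1 := iter_merge_strictMono t s strictMono_id (show (0 : ℤ) < 1 by norm_num)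
  rw [h0] at h1
  have : (0 : ℝ) < ((iter merge t s (id : ℤ → ℤ) 1 : ℤ) : ℝ) := by exact_mod_cast h1
  positivity

section Laws

variable {Ω : Type*} [MeasurableSpace Ω] {μ : Measure Ω} [IsProbabilityMeasure μ]
  {X : Ω → ℤ → ℝ} {c : Ω → ℕ → ℤ → Bool} {ν : Measure ℝ} [IsProbabilityMeasure ν]

/-- The pair seen from a typical point at time `t`. -/
def pairState (t : ℕ) (q : (ℕ → ℤ → Bool) × (ℤ → ℝ)) : (ℤ → ℝ) × ℝ :=
  (iter thin t q.1 q.2, mass t q.1)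

lemma measurable_iter_thin (t : ℕ) :
    Measurable fun q : (ℕ → ℤ → Bool) × (ℤ → ℝ) => iter thin t q.1 q.2 :=
  measurable_iter contracting_thin.measurable t

lemma measurable_pairState (t : ℕ) : Measurable (pairState t) :=
  (measurable_iter_thin t).prodMk ((measurable_mass t).comp measurable_fst)

lemma pairState_eq (t : ℕ) (q : (ℕ → ℤ → Bool) × (ℤ → ℝ)) :
    pairState t q = ((palmState t q).1, (3 / 4 : ℝ) ^ t * (((palmState t q).2 1 : ℤ) : ℝ)) := by
  rw [palmState, iter_pairStep, pairState, mass, iter_mergeMass_lattice]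

/-- Campbell's formula for an observable restricted to points in [0, 1); the integral over space
contributes the length one. -/
lemma palmPair_eq (hX : IsUnitStationary μ X) (hc : IsFairCoins μ c) (hXc : IndepFun X c μ)
    (hν : gapMeasure μ X = volume.prod (Measure.infinitePi fun _ : ℤ => ν)) (t : ℕ) :
    palmPair μ X c t = (palmPath.prod (walkLaw ν)).map (pairState t) := by
  have hcm := hc.measurable
  have hpos : Measurable fun ω => positions (X ω) (c ω) t :=
    (measurable_positions t).comp (hX.measurable.prodMk hcm)
  have hlab : Measurable fun ω => labels (c ω) t := (measurable_labels t).comp hcm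
  have hG' : ∀ k : ℤ, Measurable fun p : (ℤ → ℝ) × (ℤ → ℤ) =>
      (p.1, (3 / 4 : ℝ) ^ t * ((p.2 k : ℤ) : ℝ)) := fun k => by
    have h1 : Measurable fun p : (ℤ → ℝ) × (ℤ → ℤ) => ((p.2 k : ℤ) : ℝ) :=
      (measurable_of_countable fun n : ℤ => (n : ℝ)).comp
        ((measurable_pi_apply k).comp measurable_snd)
    exact measurable_fst.prodMk (h1.const_mul _)
  refine measure_ext_lintegral fun f hf => ?_
  rw [lintegral_map hf (measurable_pairState t), palmPair,
    lintegral_palm (Y := fun ω => positions (X ω) (c ω) t)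
      (G := fun k ω => (recenter k (positions (X ω) (c ω) t),
        (3 / 4 : ℝ) ^ t * ((recenter k (labels (c ω) t) 1 : ℤ) : ℝ))) hpos
      (fun k => (hG' 1).comp ((measurable_recenter hpos measurable_const).prodMk
        (measurable_recenter hlab measurable_const))) ?_ hf]
  · have hh : Measurable fun q : ℝ × ((ℤ → ℝ) × (ℤ → ℤ)) × (ℕ → ℤ → Bool) =>
        (Ico (0 : ℝ) 1).indicator
          (fun _ => f (q.2.1.1, (3 / 4 : ℝ) ^ t * ((q.2.1.2 1 : ℤ) : ℝ))) q.1 := by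
      have h1 : Measurable fun q : ℝ × ((ℤ → ℝ) × (ℤ → ℤ)) × (ℕ → ℤ → Bool) =>
          f (q.2.1.1, (3 / 4 : ℝ) ^ t * ((q.2.1.2 1 : ℤ) : ℝ)) :=
        hf.comp ((hG' 1).comp (measurable_fst.comp measurable_snd))
      have h2 : MeasurableSet {q : ℝ × ((ℤ → ℝ) × (ℤ → ℤ)) × (ℕ → ℤ → Bool) |
          q.1 ∈ Ico (0 : ℝ) 1} := measurable_fst measurableSet_Ico
      exact h1.indicator h2
    have h := campbell hX.measurable hc hXc hν t
      (h := fun x p _ => (Ico (0 : ℝ) 1).indicator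
        (fun _ => f (p.1, (3 / 4 : ℝ) ^ t * ((p.2 1 : ℤ) : ℝ))) x) hh
    refine h.trans (lintegral_congr fun q => ?_)
    rw [pairState_eq]
    simp [lintegral_indicator measurableSet_Ico]
  · filter_upwards [hX.proper] with ω hω
    have hp := hω.positions (c ω) t
    refine ⟨hp, config_eq hω (c ω) t, fun k => ?_⟩
    rw [config_eq hω, hp.seenFrom_apply, clusterSize_eq hω]
    rfl

/-- Campbell's formula for an observable that puts the recentred sequence back at its position. This
recovers the law of the configuration itself from that of its Palm version. -/
lemma map_enum_config (hX : IsUnitStationary μ X) (hc : IsFairCoins μ c) (hXc : IndepFun X c μ)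
    (hν : gapMeasure μ X = volume.prod (Measure.infinitePi fun _ : ℤ => ν)) (t : ℕ) :
    (fun ω => enum (config (X ω) (c ω) t)) =ᵐ[μ] (fun ω => renumber (positions (X ω) (c ω) t)) ∧
    μ.map (fun ω => renumber (positions (X ω) (c ω) t)) =
      stationaryLaw ((palmPath.prod (walkLaw ν)).map fun q => iter thin t q.1 q.2) := by
  have hpos : Measurable fun ω => positions (X ω) (c ω) t :=
    (measurable_positions t).comp (hX.measurable.prodMk hc.measurable)
  have hpp : ∀ᵐ ω ∂μ, Proper (positions (X ω) (c ω) t) := by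
    filter_upwards [hX.proper] with ω hω using hω.positions _ _
  have hprob : IsProbabilityMeasure
      ((palmPath.prod (walkLaw ν)).map fun q => iter thin t q.1 q.2) :=
    Measure.isProbabilityMeasure_map (measurable_iter_thin t).aemeasurable
  constructor
  · filter_upwards [hX.proper] with ω hω
    rw [config_eq hω, (hω.positions _ _).enum_range]
  · refine map_renumber_eq_stationaryLaw hpos hpp fun h hh => ?_
    have hm : Measurable fun q : ℝ × ((ℤ → ℝ) × (ℤ → ℤ)) × (ℕ → ℤ → Bool) =>
        h (translate q.1 q.2.1.1) :=
      hh.comp (measurable_translate measurable_fst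
        (measurable_fst.comp (measurable_fst.comp measurable_snd)))
    have h1 := campbell hX.measurable hc hXc hν t (h := fun x p _ => h (translate x p.1)) hm
    have e : ∀ (k : ℤ) (y : ℤ → ℝ), shift k y = translate (y k) (recenter k y) := fun k y => by
      ext i; simp [shift, translate, recenter]
    simp only [e]
    refine h1.trans ?_
    have hm2 : Measurable fun p : (ℤ → ℝ) × ℝ => h (translate p.2 p.1) :=
      hh.comp measurable_translate_prod
    rw [lintegral_configMeasure _ hh,
      lintegral_map (f := fun y => ∫⁻ u, h (translate u y) ∂volume) hm2.lintegral_prod_right'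
        (measurable_iter_thin t)]
    refine lintegral_congr fun q => ?_
    rw [palmState, iter_pairStep]
    simp

end Laws

/-- Portmanteau: between probability measures the lower bound on open sets suffices. -/
lemma tendsto_stationaryLaw {X : Type*} [MeasurableSpace X] {P : Measure X}
    [IsProbabilityMeasure P] {u : ℕ → X → ℤ → ℝ} {U : X → ℤ → ℝ} (hu : ∀ t, Measurable (u t))
    (hU : Measurable U) (h : ∀ᵐ x ∂P, Tendsto (fun t => u t x) atTop (𝓝 (U x)))
    {ξs : ℕ → ProbabilityMeasure (ℤ → ℝ)} {ξ : ProbabilityMeasure (ℤ → ℝ)}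
    (hs : ∀ t, (ξs t : Measure (ℤ → ℝ)) = stationaryLaw (P.map (u t)))
    (hξ : (ξ : Measure (ℤ → ℝ)) = stationaryLaw (P.map U)) : Tendsto ξs atTop (𝓝 ξ) := by
  refine tendsto_of_forall_isOpen_le_liminf' fun G hG => ?_
  simp only [hs, hξ]
  exact measure_stationaryLaw_le_liminf hu hU h hG

end

end Clustering

/-! ### The limit theorem -/

theorem corollary2 :
    -- the laws of the limits, the same for all initial processes
    ∃ (ξ : ProbabilityMeasure (ℤ → ℝ)) (Q : ProbabilityMeasure ((ℤ → ℝ) × ℝ)),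
      Clustering.IsUnitStationary (ξ : Measure (ℤ → ℝ)) id ∧
      -- the first marginal of the limit is the Palm distribution of the limit process
      (Q : Measure ((ℤ → ℝ) × ℝ)).fst =
        Clustering.palm (ξ : Measure (ℤ → ℝ)) (fun x => range x)
          (fun x z => Clustering.seenFrom (range x) z) ∧
      ∀ (Ω : Type*) [MeasurableSpace Ω] (μ : Measure Ω) [IsProbabilityMeasure μ]
        (X : Ω → ℤ → ℝ) (c : Ω → ℕ → ℤ → Bool),
        Clustering.IsUnitRenewal μ X → Clustering.IsFairCoins μ c → IndepFun X c μ →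
          -- the limit process is the limit of the point processes themselves
          TendstoInDistribution
            (fun t ω => Clustering.enum (Clustering.config (X ω) (c ω) t)) atTop
            (fun x : ℤ → ℝ => Clustering.enum (range x)) (fun _ => μ) (ξ : Measure (ℤ → ℝ)) ∧
          -- the limit cluster size is the limit of the rescaled cluster sizes
          Clustering.IsLpLimitLaw (fun t => (Clustering.palmPair μ X c t).snd)
            (Q : Measure ((ℤ → ℝ) × ℝ)).snd ∧
          -- the joint convergence
          ∃ h : ∀ t, IsProbabilityMeasure (Clustering.palmPair μ X c t),
            Tendsto (β := ProbabilityMeasure ((ℤ → ℝ) × ℝ))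
              (fun t => ⟨Clustering.palmPair μ X c t, h t⟩) atTop (𝓝 Q) := by
  obtain ⟨z, hzm, hz⟩ := Clustering.exists_limit Clustering.contracting_thin
  obtain ⟨w, hwm, hw⟩ := Clustering.exists_limit Clustering.contracting_mergeMass
  have hgap := Clustering.isGapLaw_limit hzm hz
  have hw1 : Measurable fun s => w s 1 := (measurable_pi_apply 1).comp hwm
  -- Both limits are functions of the same rows; this is the source of the joint convergence.
  have hzw : Measurable fun s => (z s, w s 1) := hzm.prodMk hw1
  have hmass : ∀ᵐ s ∂Clustering.palmPath,
      Tendsto (fun t => Clustering.mass t s) atTop (𝓝 (w s 1)) := by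
    filter_upwards [hw] with s hs using (tendsto_pi_nhds.1 hs) 1
  obtain ⟨ξ, hξ⟩ : ∃ ξ : ProbabilityMeasure (ℤ → ℝ),
      (ξ : Measure (ℤ → ℝ)) = Clustering.stationaryLaw (Clustering.palmPath.map z) :=
    ⟨⟨_, Clustering.isProbabilityMeasure_stationaryLaw hgap⟩, rfl⟩
  obtain ⟨Q, hQ⟩ : ∃ Q : ProbabilityMeasure ((ℤ → ℝ) × ℝ),
      (Q : Measure ((ℤ → ℝ) × ℝ)) = Clustering.palmPath.map fun s => (z s, w s 1) :=
    ⟨⟨_, Measure.isProbabilityMeasure_map hzw.aemeasurable⟩, rfl⟩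
  have hae : ∀ᵐ x ∂(ξ : Measure (ℤ → ℝ)), Clustering.Proper x ∧ Clustering.Anchored x := by
    rw [hξ]
    exact Clustering.ae_stationaryLaw hgap
  refine ⟨ξ, Q, ?_, ?_, ?_⟩
  · rw [hξ]
    exact Clustering.isUnitStationary_stationaryLaw hgap
  · rw [hξ, hQ, Clustering.palm_stationaryLaw hgap, Measure.fst,
      Measure.map_map measurable_fst hzw]
    rfl
  intro Ω _ μ _ X c hX hc hXc
  obtain ⟨ν, hνp, hν2, hν⟩ := hX.renewal
  have hXs := hX.toIsUnitStationary
  have hgm := Clustering.gapMeasure_eq hXs hν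
  have hmean : ∫ x, x ∂ν = 1 := by
    have hpos := Clustering.ae_gap_pos hXs hgm
    rw [integral_eq_lintegral_of_nonneg_ae (hpos.mono fun x hx => le_of_lt hx)
      aestronglyMeasurable_id, Clustering.lintegral_gap_eq_one hXs hgm, ENNReal.toReal_one]
  -- Finite variance of the gaps enters here. The limit involves only the rows, not the initial
  -- walk, hence is the same for every renewal process.
  have hlim := Clustering.ae_tendsto_iter_of_diffusive Clustering.contracting_thin
    (Clustering.diffusive_walkLaw hν2 hmean) Clustering.walkLaw_zero hz
  have hpair : ∀ᵐ q ∂(Clustering.palmPath.prod (Clustering.walkLaw ν)),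
      Tendsto (fun t => Clustering.pairState t q) atTop (𝓝 (z q.1, w q.1 1)) := by
    filter_upwards [hlim, Measure.quasiMeasurePreserving_fst.ae hmass] with q h1 h2
    exact h1.prodMk_nhds h2
  have hfst : (Clustering.palmPath.prod (Clustering.walkLaw ν)).map Prod.fst =
      Clustering.palmPath := measurePreserving_fst.map_eq
  have hpp := Clustering.palmPair_eq hXs hc hXc hgm
  have hpprob : ∀ t, IsProbabilityMeasure (Clustering.palmPair μ X c t) := fun t => by
    rw [hpp t]
    exact Measure.isProbabilityMeasure_map (Clustering.measurable_pairState t).aemeasurable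
  refine ⟨⟨fun t => ?_, ?_, ?_⟩, ?_, hpprob, ?_⟩
  · have hpos : Measurable fun ω => Clustering.positions (X ω) (c ω) t :=
      (Clustering.measurable_positions t).comp (hXs.measurable.prodMk hc.measurable)
    exact (Clustering.measurable_renumber.comp hpos).aemeasurable.congr
      (Clustering.map_enum_config hXs hc hXc hgm t).1.symm
  · refine Clustering.measurable_renumber.aemeasurable.congr ?_
    filter_upwards [hae] with x hx
    exact hx.1.enum_range.symm
  · refine Clustering.tendsto_stationaryLaw (P := Clustering.palmPath.prod (Clustering.walkLaw ν))
      Clustering.measurable_iter_thin (hzm.comp measurable_fst) hlim (fun t => ?_) ?_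
    · have h := Clustering.map_enum_config hXs hc hXc hgm t
      exact (Measure.map_congr h.1).trans h.2
    · have h1 : (Clustering.palmPath.prod (Clustering.walkLaw ν)).map (z ∘ Prod.fst) =
          Clustering.palmPath.map z := by
        rw [← Measure.map_map hzm measurable_fst, hfst]
      have h2 : (fun x : ℤ → ℝ => Clustering.enum (range x))
          =ᵐ[(ξ : Measure (ℤ → ℝ))] id := by
        filter_upwards [hae] with x hx
        exact hx.1.enum_range.trans (hx.1.renumber_eq hx.2)
      rw [h1, ← hξ]
      exact (Measure.map_congr h2).trans Measure.map_id
  -- The masses depend only on the rows, so the space of rows carries the coupling for all `p`.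
  · refine ⟨ℕ → ℤ → Bool, inferInstance, Clustering.palmPath, inferInstance, Clustering.mass,
      fun s => w s 1, fun t => ⟨Clustering.measurable_mass t, ?_⟩, ⟨hw1, ?_⟩, fun p hp hp' => ?_⟩
    · beta_reduce
      rw [hpp t, Measure.snd, Measure.map_map measurable_snd (Clustering.measurable_pairState t)]
      conv_lhs => rw [← hfst]
      rw [Measure.map_map (Clustering.measurable_mass t) measurable_fst]
      rfl
    · rw [hQ, Measure.snd, Measure.map_map measurable_snd hzw]
      rfl
    · exact Clustering.tendsto_Lp_of_moments Clustering.measurable_mass hw1 Clustering.mass_nonneg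
        Clustering.exists_moment_bound hmass (one_le_two.trans hp) hp'
  · have hmap : (Clustering.palmPath.prod (Clustering.walkLaw ν)).map
        (fun q => (z q.1, w q.1 1)) = Clustering.palmPath.map fun s => (z s, w s 1) := by
      conv_rhs => rw [← hfst]
      rw [Measure.map_map hzw measurable_fst]
      rfl
    have h := (tendstoInDistribution_of_ae_tendsto
      (fun t => (Clustering.measurable_pairState t).aemeasurable)
      (hzw.comp measurable_fst).aemeasurable hpair).tendsto
    have hl : (fun t => (⟨Clustering.palmPair μ X c t, hpprob t⟩ :
        ProbabilityMeasure ((ℤ → ℝ) × ℝ))) = fun t =>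
        ⟨(Clustering.palmPath.prod (Clustering.walkLaw ν)).map (Clustering.pairState t),
          Measure.isProbabilityMeasure_map (Clustering.measurable_pairState t).aemeasurable⟩ :=
      funext fun t => Subtype.ext (hpp t)
    have hr : Q = ⟨(Clustering.palmPath.prod (Clustering.walkLaw ν)).map
        (fun q => (z q.1, w q.1 1)), by rw [hmap, ← hQ]; infer_instance⟩ :=
      Subtype.ext (hQ.trans hmap.symm)
    rw [hl, hr]
    exact h
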